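/- Let $\Lambda=(\lambda_k)_{k\ge 0}$ be a strictly increasing sequence of non-negative real numbers satisfying the Müntz condition $\sum_{\lambda\in\Lambda\setminus\{0\}}1/\lambda<\infty$. Consider functions with values in $\mathbb K=\mathbb R$ or $\mathbb K=\mathbb C$. Let $L^1=L^1([0,1])$, let $C=C([0,1])$ with the supremum norm, and let $M_\Lambda^1$ be the closure in $L^1$ of the linear span of the monomials $x^{\lambda_k}$, $k\ge 0$. Let $V_\Lambda:M_\Lambda^1\to C$ be the Volterra operator $$V_\Lambda f(x)=\int_0^x f(t)\,dt ,$$ and let $\Gamma_\Lambda$ be the Cesàro operator on $M_\Lambda^1$, $$\Gamma_\Lambda f(x)=\frac1x\int_0^x f(t)\,dt\quad(0<x\le 1),\qquad \Gamma_\Lambda f(0)=f(0),$$ where $f(0)$ is the value at $0$ of the representative of $f$ that is continuous on $[0,1)$. A bounded operator $T:X\to Y$ between Banach spaces is *finitely strictly singular* if for every $\varepsilon>0$ there is $N_\varepsilon\ge 1$ such that every subspace $E$ of $X$ with $\dim E>N_\varepsilon$ contains a vector $v$ with $\|v\|=1$ and $\|Tv\|\le\varepsilon$. For $n\ge 1$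 its $n$-th Bernstein number is $$b_n(T)=\sup_{E\subset X,\ \dim E=n}\ \inf_{v\in E,\ \|v\|=1}\|Tv\| .$$ Then every $f\in M_\Lambda^1$ has a representative that is continuous on $[0,1)$, $\Gamma_\Lambda$ is a well-defined bounded operator from $M_\Lambda^1$ to $C$, and: 1. $V_\Lambda$ and $\Gamma_\Lambda$ are finitely strictly singular. 2. For every $n\ge1$, $b_n(V_\Lambda)\ge\frac1{2n-1}$ and $b_n(\Gamma_\Lambda)\ge\frac1{2n-1}$. These numbers are exactly of order $\frac1n$: $b_n(V_\Lambda)\le\frac{\sqrt2}{n}$ for every $n\ge 1$, and there is a constant $C_\Lambda$ such that $b_n(\Gamma_\Lambda)\le\frac{C_\Lambda}{n}$ for every $n\ge1$. 3. If $\mathbb K=\mathbb R$, then $b_n(V_\Lambda)=\frac1{2n-1}$ for every $n\ge1$. -/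

import Mathlib

open MeasureTheory

noncomputable section

/-- The Banach space `L¹([0,1])` of `𝕜`-valued functions, for Lebesgue measure. -/
abbrev L1I (𝕜 : Type*) [RCLike 𝕜] : Type _ :=
  Lp 𝕜 1 (volume.restrict (Set.Icc (0 : ℝ) 1))

/-- The space `M_Λ^1`: the closure in `L¹([0,1])` of the linear span of the (classes of the)
monomials `x ↦ x ^ Λ k`. -/
def muntzSpace (𝕜 : Type*) [RCLike 𝕜] (Λ : ℕ → ℝ) : Submodule 𝕜 (L1I 𝕜) :=
  (Submodule.span 𝕜 {f : L1I 𝕜 | ∃ k : ℕ,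
    (f : ℝ → 𝕜) =ᵐ[volume.restrict (Set.Icc (0 : ℝ) 1)]
      fun x : ℝ => ((x ^ Λ k : ℝ) : 𝕜)}).topologicalClosure

theorem L1I.integrableOn {𝕜 : Type*} [RCLike 𝕜] (f : L1I 𝕜) :
    IntegrableOn (f : ℝ → 𝕜) (Set.Icc (0 : ℝ) 1) :=
  L1.integrable_coeFn f

theorem L1I.intervalIntegrable {𝕜 : Type*} [RCLike 𝕜] (f : L1I 𝕜) (x : unitInterval) :
    IntervalIntegrable (f : ℝ → 𝕜) volume 0 x := by
  rw [intervalIntegrable_iff_integrableOn_Ioc_of_le x.2.1]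
  exact (L1I.integrableOn f).mono_set
    (fun t ht => ⟨ht.1.le, ht.2.trans x.2.2⟩)

theorem L1I.integral_congr {𝕜 : Type*} [RCLike 𝕜] {u v : ℝ → 𝕜}
    (h : u =ᵐ[volume.restrict (Set.Icc (0 : ℝ) 1)] v) (x : unitInterval) :
    ∫ t in (0 : ℝ)..x, u t = ∫ t in (0 : ℝ)..x, v t := by
  rw [intervalIntegral.integral_of_le x.2.1, intervalIntegral.integral_of_le x.2.1]
  have hs : Set.Ioc (0 : ℝ) x ⊆ Set.Icc 0 1 := fun t ht => ⟨ht.1.le, ht.2.trans x.2.2⟩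
  exact integral_congr_ae (ae_restrict_of_ae_restrict_of_subset hs h)

/-- The Volterra operator `V f (x) = ∫₀ˣ f(t) dt`, from `L¹([0,1])` to `C([0,1])` (with the
supremum norm). -/
def volterra (𝕜 : Type*) [RCLike 𝕜] : L1I 𝕜 →L[𝕜] C(unitInterval, 𝕜) :=
  LinearMap.mkContinuous
    { toFun := fun f =>
        { toFun := fun x => ∫ t in (0 : ℝ)..x, (f : ℝ → 𝕜) t
          continuous_toFun := by
            have h := intervalIntegral.continuousOn_primitive_interval (a := 0) (b := 1)
              (μ := volume) (f := (f : ℝ → 𝕜))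
              (by rw [Set.uIcc_of_le zero_le_one]; exact L1I.integrableOn f)
            rw [Set.uIcc_of_le zero_le_one] at h
            exact continuousOn_iff_continuous_domRestrict.mp h }
      map_add' := fun f g => by
        ext x
        change ∫ t in (0 : ℝ)..x, ((f + g : L1I 𝕜) : ℝ → 𝕜) t = _ + _
        rw [L1I.integral_congr (Lp.coeFn_add f g) x]
        exact intervalIntegral.integral_add (L1I.intervalIntegrable f x)
          (L1I.intervalIntegrable g x)
      map_smul' := fun c f => by
        ext x
        change ∫ t in (0 : ℝ)..x, ((c • f : L1I 𝕜) : ℝ → 𝕜) t = c • _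
        rw [L1I.integral_congr (Lp.coeFn_smul c f) x]
        exact intervalIntegral.integral_smul c _ } 1
    (fun f => by
      rw [one_mul]
      refine (ContinuousMap.norm_le _ (norm_nonneg _)).2 fun x => ?_
      change ‖∫ t in (0 : ℝ)..x, (f : ℝ → 𝕜) t‖ ≤ ‖f‖
      rw [L1.norm_eq_integral_norm]
      refine (intervalIntegral.norm_integral_le_integral_norm x.2.1).trans ?_
      rw [intervalIntegral.integral_of_le x.2.1]
      exact setIntegral_mono_set (L1I.integrableOn f).norm
        (Filter.Eventually.of_forall fun t => norm_nonneg _)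
        (Filter.Eventually.of_forall fun t ht => ⟨ht.1.le, ht.2.trans x.2.2⟩))

/-- The operator `V_Λ`: the restriction of the Volterra operator to `M_Λ^1`. -/
def volterraMuntz (𝕜 : Type*) [RCLike 𝕜] (Λ : ℕ → ℝ) :
    muntzSpace 𝕜 Λ →L[𝕜] C(unitInterval, 𝕜) :=
  (volterra 𝕜).comp (muntzSpace 𝕜 Λ).subtypeL

/-- `f(0) = c` for the class `f`: the class has a representative `g` that is continuous on
`[0,1)` (such a `g` is unique on `[0,1)`), and `g 0 = c`. -/
def HasValueAtZero {𝕜 : Type*} [RCLike 𝕜] (f : L1I 𝕜) (c : 𝕜) : Prop :=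
  ∃ g : ℝ → 𝕜, ContinuousOn g (Set.Ico 0 1) ∧
    (f : ℝ → 𝕜) =ᵐ[volume.restrict (Set.Icc (0 : ℝ) 1)] g ∧ g 0 = c

/-- `T` is the Cesàro operator `Γ_Λ` from `M_Λ^1` to `C([0,1])`: `T f (x) = x⁻¹ ∫₀ˣ f(t) dt` for
`0 < x ≤ 1` and `T f (0) = f(0)`. All the values of `T` are prescribed, so there is at most one
such `T`. -/
def IsCesaroMuntz {𝕜 : Type*} [RCLike 𝕜] {Λ : ℕ → ℝ}
    (T : muntzSpace 𝕜 Λ →L[𝕜] C(unitInterval, 𝕜)) : Prop :=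
  ∀ f : muntzSpace 𝕜 Λ,
    HasValueAtZero (f : L1I 𝕜) (T f 0) ∧
    ∀ x : unitInterval, 0 < (x : ℝ) →
      T f x = (((x : ℝ) : 𝕜))⁻¹ * ∫ t in (0 : ℝ)..x, ((f : L1I 𝕜) : ℝ → 𝕜) t

/-- Finitely strictly singular operators: for every `ε > 0` there is `N ≥ 1` such that every
subspace of dimension greater than `N` (possibly infinite) has a unit vector `v` with
`‖T v‖ ≤ ε`. -/
def FinitelyStrictlySingular {𝕜 X Y : Type*} [RCLike 𝕜] [NormedAddCommGroup X] [NormedSpace 𝕜 X]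
    [NormedAddCommGroup Y] [NormedSpace 𝕜 Y] (T : X →L[𝕜] Y) : Prop :=
  ∀ ε : ℝ, 0 < ε → ∃ N : ℕ, 1 ≤ N ∧ ∀ E : Submodule 𝕜 X, (N : Cardinal) < Module.rank 𝕜 E →
    ∃ v ∈ E, ‖v‖ = 1 ∧ ‖T v‖ ≤ ε

/-- The `n`-th Bernstein number (`n ≥ 1`) of a bounded operator `T`: the supremum, over the
subspaces `E` of dimension `n`, of the infimum of `‖T v‖` over the unit sphere of `E`. -/
def bernsteinNumber {𝕜 X Y : Type*} [RCLike 𝕜] [NormedAddCommGroup X] [NormedSpace 𝕜 X]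
    [NormedAddCommGroup Y] [NormedSpace 𝕜 Y] (T : X →L[𝕜] Y) (n : ℕ) : ℝ :=
  ⨆ E : {E : Submodule 𝕜 X // Module.finrank 𝕜 E = n},
    ⨅ v : {v : X // v ∈ E.1 ∧ ‖v‖ = 1}, ‖T v‖

end

/-! The estimates for `V` rest on oscillation. A primitive vanishing at `0` has total variation
`‖f‖₁`. If it attains its maximal modulus `M` at `d` points with alternating signs, it travels at
least `M` to the first one and `2M` between consecutive ones, so `(2d-1) M ≤ ‖f‖₁`. Every
`d`-dimensional real space contains such an `f` up to `ε`: sample the primitives on a fine grid and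
apply the zigzag lemma `exists_zigzag` to the sampled values, which are linear forms listed in
order. Over `ℂ` the real parts are listed first and the imaginary parts after them; the real
dimension `2n` makes up for two losses of `√2`, and the bound is again `1/(2n-1)`.

The zigzag lemma is a parity count. For rows in general position, the number of vertices of the
polytope `|wᵢ · x| ≤ 1` whose active rows carry the signs `+,-,+,…` in order is odd
(`GenericRows.odd_card_altVertices`). The induction is on the dimension. An edge with alternating
signs, cut by a half-space, has two ends or is empty. The ends on the bounding hyperplane are the
alternating vertices of one dimension less. A vertex in the open half-space lies on an odd number of
such edges exactly when it is alternating up to a global sign. Arbitrary rows follow by density and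
compactness (`exists_alternating_rows`).

For the lower bound, take normalized powers with very lacunary exponents. At suitable points the
primitive of `∑ aⱼ (λⱼ+1) x^λⱼ` almost equals the partial sums of the `aⱼ`, so `∑ |aⱼ|` is at most
about `(2n-1) ‖V f‖`. Since `‖V f‖ ≤ ‖Γ f‖`, the same bound holds for `Γ`.

The operator `Γ` needs control near `0`, and here the Müntz condition is decisive. On `(0, ρ]` with
`ρ < 1` a generalized polynomial satisfies `|p'(x)| ≤ C ‖p‖₁ x^(β-1)`
(`exists_powerSum_deriv_bound`). Its Mellin transform is bounded by `‖p‖₁` on the imaginary axis; a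
Blaschke product removes the poles and the maximum principle carries the bound into the half-plane
containing them. Along a ray of direction `-1+i` the inverse Blaschke product grows more slowly than
any exponential, because `∑ 1/λ` converges, and integration along that ray recovers the exponentials
`x^λ`. Limits of polynomials then have continuous representatives with modulus of continuity `K (y^β
- x^β)`. In an `n`-dimensional space, let `V f` vanish at about `n/2` nodes with equally spaced
`β`-th powers: `f` becomes `O(1/n)` on `[0,1/2]`, and the bound for `V` on the remaining dimensions
takes care of `[1/2,1]`. -/

/-! ### Parity of sign patterns and of interval ends -/

/-- For subsets of a finite linearly ordered set: the number of positions at which the subset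
switches from absent to present is odd exactly for the empty and the full subset. -/
theorem odd_card_switch_iff {α : Type*} [LinearOrder α] (S D : Finset α) (hD : D ⊆ S)
    (hS : S.Nonempty) :
    Odd (S.filter fun i => ∀ j ∈ S, (j < i → j ∉ D) ∧ (i < j → j ∈ D)).card ↔
      D = ∅ ∨ D = S := by
  by_cases h0 : D = ∅
  · subst h0
    have : (S.filter fun i => ∀ j ∈ S, (j < i → j ∉ (∅ : Finset α)) ∧
        (i < j → j ∈ (∅ : Finset α))) = {S.max' hS} := by
      ext i
      simp only [Finset.mem_filter, Finset.mem_singleton, Finset.notMem_empty, not_false_eq_true,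
        imp_true_iff, true_and, imp_false, not_lt]
      constructor
      · rintro ⟨hi, h⟩
        exact le_antisymm (Finset.le_max' _ _ hi) (Finset.max'_le _ _ _ h)
      · rintro rfl
        exact ⟨Finset.max'_mem _ _, fun j hj => Finset.le_max' _ _ hj⟩
    rw [this]; simp
  by_cases h1 : D = S
  · subst h1
    have : (D.filter fun i => ∀ j ∈ D, (j < i → j ∉ D) ∧ (i < j → j ∈ D)) = {D.min' hS} := by
      ext i
      simp only [Finset.mem_filter, Finset.mem_singleton]
      constructor
      · rintro ⟨hi, h⟩
        refine le_antisymm (Finset.le_min' _ _ _ fun j hj => ?_) (Finset.min'_le _ _ hi)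
        by_contra hlt
        exact (h j hj).1 (not_le.1 hlt) hj
      · rintro rfl
        exact ⟨Finset.min'_mem _ _, fun j hj =>
          ⟨fun hlt => absurd (Finset.min'_le _ _ hj) (not_le.2 hlt), fun _ => hj⟩⟩
    rw [this]; simp
  simp only [h0, h1, or_self, iff_false, Nat.not_odd_iff_even]
  by_cases hne : ∃ i₀ ∈ S, ∀ j ∈ S, (j < i₀ → j ∉ D) ∧ (i₀ < j → j ∈ D)
  -- One switch forces `D` to be a proper nonempty upper part of `S`. The switches are then exactly
  -- the largest element outside `D` and the smallest element of `D`: two in all.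
  · obtain ⟨i₀, hi₀, h⟩ := hne
    have hDn : D.Nonempty := Finset.nonempty_iff_ne_empty.2 h0
    have hCn : (S \ D).Nonempty := by
      rw [Finset.sdiff_nonempty]; exact fun hh => h1 (Finset.Subset.antisymm hD hh)
    have hlt : ∀ a ∈ S \ D, ∀ b ∈ D, a < b := by
      intro a ha b hb
      rw [Finset.mem_sdiff] at ha
      have h1 : a ≤ i₀ := not_lt.1 fun hh => ha.2 ((h a ha.1).2 hh)
      have h2 : i₀ ≤ b := not_lt.1 fun hh => (h b (hD hb)).1 hh hb
      exact lt_of_le_of_ne (h1.trans h2) fun hh => ha.2 (hh ▸ hb)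
    have hmm := hlt _ ((S \ D).max'_mem hCn) _ (D.min'_mem hDn)
    have : (S.filter fun i => ∀ j ∈ S, (j < i → j ∉ D) ∧ (i < j → j ∈ D)) =
        {(S \ D).max' hCn, D.min' hDn} := by
      ext i
      simp only [Finset.mem_filter, Finset.mem_insert, Finset.mem_singleton]
      constructor
      · rintro ⟨hi, hh⟩
        by_cases hiD : i ∈ D
        · right
          refine le_antisymm (Finset.le_min' _ _ _ fun j hj => ?_) (Finset.min'_le _ _ hiD)
          exact not_lt.1 fun hc => (hh j (hD hj)).1 hc hj
        · left
          refine le_antisymm (Finset.le_max' _ _ (Finset.mem_sdiff.2 ⟨hi, hiD⟩))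
            (Finset.max'_le _ _ _ fun j hj => ?_)
          rw [Finset.mem_sdiff] at hj
          exact not_lt.1 fun hc => hj.2 ((hh j hj.1).2 hc)
      · rintro (rfl | rfl)
        · refine ⟨(Finset.mem_sdiff.1 ((S \ D).max'_mem hCn)).1, fun j hj => ⟨fun hc hjD => ?_,
            fun hc => ?_⟩⟩
          · exact (lt_asymm hc (hlt _ ((S \ D).max'_mem hCn) _ hjD))
          · by_contra hjD
            exact absurd (Finset.le_max' _ _ (Finset.mem_sdiff.2 ⟨hj, hjD⟩)) (not_le.2 hc)
        · refine ⟨hD (D.min'_mem hDn), fun j hj => ⟨fun hc hjD => ?_, fun hc => ?_⟩⟩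
          · exact absurd (Finset.min'_le _ _ hjD) (not_le.2 hc)
          · by_contra hjD
            exact lt_asymm hc (hlt _ (Finset.mem_sdiff.2 ⟨hj, hjD⟩) _ (D.min'_mem hDn))
    rw [this, Finset.card_pair hmm.ne]
    exact even_two
  · have : (S.filter fun i => ∀ j ∈ S, (j < i → j ∉ D) ∧ (i < j → j ∈ D)) = ∅ := by
      rw [Finset.filter_eq_empty_iff]
      exact fun i hi hh => hne ⟨i, hi, hh⟩
    rw [this]; simp

/-- The elements of even rank in a finite linearly ordered set. -/
def altPos {α : Type*} [LinearOrder α] (S : Finset α) : Finset α :=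
  S.filter fun i => Even (S.filter (· < i)).card

theorem altPos_subset {α : Type*} [LinearOrder α] (S : Finset α) : altPos S ⊆ S :=
  Finset.filter_subset _ _

/-- Erasing `i` leaves the ranks below `i` unchanged and lowers those above by one, so the
alternating pattern flips above `i`. -/
theorem mem_altPos_erase {α : Type*} [LinearOrder α] (S : Finset α) {i j : α} (hi : i ∈ S) :
    j ∈ altPos (S.erase i) ↔ j ∈ S ∧ j ≠ i ∧ (j < i → j ∈ altPos S) ∧ (i < j → j ∉ altPos S) := by
  simp only [altPos, Finset.mem_filter, Finset.mem_erase]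
  by_cases hj : j ∈ S
  swap
  · simp [hj]
  by_cases hji : j = i
  · simp [hji]
  rcases lt_or_gt_of_ne hji with h | h
  · have : (S.erase i).filter (· < j) = S.filter (· < j) := by
      ext l
      simp only [Finset.mem_filter, Finset.mem_erase]
      exact ⟨fun hh => ⟨hh.1.2, hh.2⟩, fun hh => ⟨⟨(hh.2.trans h).ne, hh.1⟩, hh.2⟩⟩
    rw [this]
    simp [hj, hji, h, h.not_gt]
  · have : (S.erase i).filter (· < j) = (S.filter (· < j)).erase i := by
      ext l
      simp only [Finset.mem_filter, Finset.mem_erase]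
      tauto
    have hmem : i ∈ S.filter (· < j) := Finset.mem_filter.2 ⟨hi, h⟩
    rw [this]
    have hc := Finset.card_erase_add_one hmem
    rw [← hc]
    simp [hj, hji, h, h.not_gt, Nat.even_add_one]

/-- Dropping `i` from a signed set leaves an alternating pattern exactly when the signs agree with
`altPos S` below `i` and disagree above it. Thus `i` is a switch of the set of disagreements, and
the number of switches is odd only if that set is empty or everything. This is the local count at a
vertex in the parity argument. -/
theorem odd_card_erase_altPos_iff {α : Type*} [LinearOrder α] (S P : Finset α) (hP : P ⊆ S)
    (hS : S.Nonempty) :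
    Odd (S.filter fun i => P.erase i = altPos (S.erase i)).card ↔
      P = altPos S ∨ P = S \ altPos S := by
  classical
  set D : Finset α := S.filter fun j => ¬ (j ∈ P ↔ j ∈ altPos S) with hDdef
  have hD : D ⊆ S := Finset.filter_subset _ _
  have h1 : (S.filter fun i => P.erase i = altPos (S.erase i)) =
      S.filter fun i => ∀ j ∈ S, (j < i → j ∉ D) ∧ (i < j → j ∈ D) := by
    refine Finset.filter_congr fun i hi => ?_
    rw [Finset.ext_iff]
    simp only [mem_altPos_erase S hi, hDdef, Finset.mem_filter, Finset.mem_erase]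
    constructor
    · intro h j hj
      have := h j
      refine ⟨fun hlt => ?_, fun hlt => ?_⟩
      · have := hlt.ne; have := hlt.not_gt; tauto
      · have := hlt.ne'; have := hlt.not_gt; tauto
    · intro h j
      by_cases hj : j ∈ S
      · have := h j hj
        rcases lt_trichotomy j i with hlt | rfl | hlt
        · have := hlt.ne; have := hlt.not_gt; tauto
        · simp
        · have := hlt.ne'; have := hlt.not_gt; tauto
      · have := fun hh => hj (hP hh); tauto
  rw [h1, odd_card_switch_iff S D hD hS]
  refine or_congr ?_ ?_
  · rw [hDdef, Finset.filter_eq_empty_iff]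
    constructor
    · intro h
      ext j
      by_cases hj : j ∈ S
      · exact not_not.1 (h hj)
      · exact ⟨fun hh => absurd (hP hh) hj, fun hh => absurd (altPos_subset S hh) hj⟩
    · rintro h j -
      rw [h]; simp
  · rw [hDdef, Finset.filter_eq_self]
    constructor
    · intro h
      ext j
      rw [Finset.mem_sdiff]
      by_cases hj : j ∈ S
      · have := h j hj; tauto
      · have := fun hh => hj (hP hh); tauto
    · intro h j hj
      rw [h, Finset.mem_sdiff]; tauto

/-- The ends of the intersection of finitely many compact intervals with a half-line. -/
theorem even_card_interval_ends {ι : Type*} (J : Finset ι) (hJ : J.Nonempty) (a b : ι → ℝ)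
    (hco : ∀ t, 0 ≤ t → (∀ i ∈ J, a i ≤ t ∧ t ≤ b i) → ∀ i ∈ J, ∀ j ∈ J,
      (t = a i ∨ t = b i) → (t = a j ∨ t = b j) → i = j)
    (h0 : (∀ i ∈ J, a i ≤ 0 ∧ 0 ≤ b i) → ∀ i ∈ J, a i ≠ 0 ∧ b i ≠ 0) :
    Even (((J.filter fun i => 0 < a i ∧ ∀ j ∈ J, a j ≤ a i ∧ a i ≤ b j).card +
      (J.filter fun i => 0 < b i ∧ ∀ j ∈ J, a j ≤ b i ∧ b i ≤ b j).card) +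
      if (∀ j ∈ J, a j ≤ 0 ∧ 0 ≤ b j) then 1 else 0) := by
  classical
  by_cases hD : ∃ t, 0 ≤ t ∧ ∀ j ∈ J, a j ≤ t ∧ t ≤ b j
  swap
  · have e1 : (J.filter fun i => 0 < a i ∧ ∀ j ∈ J, a j ≤ a i ∧ a i ≤ b j) = ∅ := by
      rw [Finset.filter_eq_empty_iff]
      exact fun i _ h => hD ⟨a i, h.1.le, h.2⟩
    have e2 : (J.filter fun i => 0 < b i ∧ ∀ j ∈ J, a j ≤ b i ∧ b i ≤ b j) = ∅ := by
      rw [Finset.filter_eq_empty_iff]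
      exact fun i _ h => hD ⟨b i, h.1.le, h.2⟩
    rw [e1, e2, if_neg fun h => hD ⟨0, le_rfl, h⟩]
    simp
  obtain ⟨t, ht0, ht⟩ := hD
  -- The intersection runs up to the least `b`, and starts at the largest `a` or at `0`. By `hco`
  -- each positive end comes from a single index, and by `h0` the upper end is not `0`, so there are
  -- exactly two ends.
  obtain ⟨u, hu, hub⟩ := Finset.exists_min_image J b hJ
  obtain ⟨l, hl, hla⟩ := Finset.exists_max_image J a hJ
  have hbu : ∀ j ∈ J, a j ≤ b u ∧ b u ≤ b j := fun j hj =>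
    ⟨(ht j hj).1.trans (ht u hu).2, hub j hj⟩
  have hbu0 : 0 < b u := by
    refine lt_of_le_of_ne (ht0.trans (ht u hu).2) fun hh => ?_
    rw [← hh] at hbu
    exact (h0 hbu u hu).2 hh.symm
  have e2 : (J.filter fun i => 0 < b i ∧ ∀ j ∈ J, a j ≤ b i ∧ b i ≤ b j) = {u} := by
    ext i
    simp only [Finset.mem_filter, Finset.mem_singleton]
    constructor
    · rintro ⟨hi, hpos, h⟩
      have : b i = b u := le_antisymm (h u hu).2 (hub i hi)
      exact hco (b i) hpos.le h i hi u hu (Or.inr rfl) (Or.inr this)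
    · rintro rfl
      exact ⟨hu, hbu0, hbu⟩
  have hal : ∀ j ∈ J, a j ≤ a l ∧ a l ≤ b j := fun j hj =>
    ⟨hla j hj, (ht l hl).1.trans (ht j hj).2⟩
  rw [e2]
  by_cases hf : ∀ j ∈ J, a j ≤ 0 ∧ 0 ≤ b j
  · have e1 : (J.filter fun i => 0 < a i ∧ ∀ j ∈ J, a j ≤ a i ∧ a i ≤ b j) = ∅ := by
      rw [Finset.filter_eq_empty_iff]
      exact fun i hi h => absurd (hf i hi).1 (not_le.2 h.1)
    rw [e1, if_pos hf]
    exact ⟨1, rfl⟩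
  · have hal0 : 0 < a l := by
      by_contra hh
      exact hf fun j hj => ⟨(hla j hj).trans (not_lt.1 hh), ht0.trans (ht j hj).2⟩
    have e1 : (J.filter fun i => 0 < a i ∧ ∀ j ∈ J, a j ≤ a i ∧ a i ≤ b j) = {l} := by
      ext i
      simp only [Finset.mem_filter, Finset.mem_singleton]
      constructor
      · rintro ⟨hi, hpos, h⟩
        have : a i = a l := le_antisymm (hla i hi) (h l hl).1
        exact hco (a i) hpos.le h i hi l hl (Or.inl rfl) (Or.inl this)
      · rintro rfl
        exact ⟨hl, hal0, hal⟩
    rw [e1, if_neg hf]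
    exact ⟨1, rfl⟩

/-! ### Alternating vertices of the polytope `|wᵢ · x| ≤ 1` -/

/-- The linear form `x ↦ ∑ⱼ wᵢⱼ xⱼ` on `ℝᵏ` given by the first `k` coordinates of the `i`-th row. -/
def rowForm {m : ℕ} (w : Fin m → ℕ → ℝ) (k : ℕ) (i : Fin m) (x : Fin k → ℝ) : ℝ :=
  ∑ j : Fin k, w i j * x j

section rowForm
variable {m : ℕ} (w : Fin m → ℕ → ℝ) (k : ℕ) (i : Fin m)

theorem rowForm_add (x y : Fin k → ℝ) :
    rowForm w k i (x + y) = rowForm w k i x + rowForm w k i y := by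
  simp [rowForm, mul_add, Finset.sum_add_distrib]

theorem rowForm_smul (c : ℝ) (x : Fin k → ℝ) :
    rowForm w k i (c • x) = c * rowForm w k i x := by
  simp [rowForm, Finset.mul_sum, mul_left_comm]

theorem rowForm_neg (x : Fin k → ℝ) : rowForm w k i (-x) = - rowForm w k i x := by
  simp [rowForm]

theorem rowForm_sub (x y : Fin k → ℝ) :
    rowForm w k i (x - y) = rowForm w k i x - rowForm w k i y := by
  rw [sub_eq_add_neg, rowForm_add, rowForm_neg, sub_eq_add_neg]

theorem rowForm_snoc (x : Fin k → ℝ) (t : ℝ) :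
    rowForm w (k + 1) i (Fin.snoc (α := fun _ => ℝ) x t) = rowForm w k i x + w i k * t := by
  simp [rowForm, Fin.sum_univ_castSucc]

end rowForm

/-- General position of the rows, for every number of coordinates. -/
structure GenericRows {m : ℕ} (w : Fin m → ℕ → ℝ) : Prop where
  eq_zero : ∀ (k : ℕ) (S : Finset (Fin m)), S.card = k → ∀ x : Fin k → ℝ,
    (∀ i ∈ S, rowForm w k i x = 0) → x = 0
  not_tight : ∀ (k : ℕ) (S : Finset (Fin m)), S.card = k → ∀ i₀ ∉ S, ∀ x : Fin k → ℝ,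
    (∀ i ∈ S, |rowForm w k i x| = 1) → |rowForm w k i₀ x| ≠ 1

theorem GenericRows.exists_solution {m : ℕ} {w : Fin m → ℕ → ℝ} (hw : GenericRows w) {k : ℕ}
    {S : Finset (Fin m)} (hS : S.card = k) (c : Fin m → ℝ) :
    ∃ x : Fin k → ℝ, ∀ i ∈ S, rowForm w k i x = c i := by
  let L : (Fin k → ℝ) →ₗ[ℝ] (S → ℝ) :=
    { toFun := fun x i => rowForm w k i x
      map_add' := fun x y => by ext i; exact rowForm_add w k i x y
      map_smul' := fun c x => by ext i; exact rowForm_smul w k i c x }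
  have hinj : Function.Injective L := by
    rw [← LinearMap.ker_eq_bot, LinearMap.ker_eq_bot']
    intro x hx
    exact hw.eq_zero k S hS x fun i hi => congrFun hx ⟨i, hi⟩
  have hsurj : Function.Surjective L :=
    (LinearMap.injective_iff_surjective_of_finrank_eq_finrank (by simp [hS])).1 hinj
  obtain ⟨x, hx⟩ := hsurj fun i => c i
  exact ⟨x, fun i hi => congrFun hx ⟨i, hi⟩⟩

theorem GenericRows.unique {m : ℕ} {w : Fin m → ℕ → ℝ} (hw : GenericRows w) {k : ℕ}
    {S : Finset (Fin m)} (hS : S.card = k) {x y : Fin k → ℝ}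
    (h : ∀ i ∈ S, rowForm w k i x = rowForm w k i y) : x = y := by
  rw [← sub_eq_zero]
  exact hw.eq_zero k S hS _ fun i hi => by rw [rowForm_sub, h i hi, sub_self]

/-- The sign `±1` of an index, given the set of positive indices. -/
noncomputable def signOf {m : ℕ} (P : Finset (Fin m)) (i : Fin m) : ℝ := if i ∈ P then 1 else -1

theorem abs_signOf {m : ℕ} (P : Finset (Fin m)) (i : Fin m) : |signOf P i| = 1 := by
  unfold signOf; split_ifs <;> simp

/-- `x` lies in the polytope `|wᵢ · x| ≤ 1`, with prescribed signs on the facets in `S`. -/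
def IsFeasible {m : ℕ} (w : Fin m → ℕ → ℝ) (k : ℕ) (S P : Finset (Fin m)) (x : Fin k → ℝ) :
    Prop :=
  (∀ i ∈ S, rowForm w k i x = signOf P i) ∧ ∀ i, |rowForm w k i x| ≤ 1

open Classical in
/-- The index sets of the alternating vertices (starting with `+`) in `ℝᵏ`. -/
noncomputable def altVertices {m : ℕ} (w : Fin m → ℕ → ℝ) (k : ℕ) : Finset (Finset (Fin m)) :=
  Finset.univ.filter fun S => S.card = k ∧ ∃ x, IsFeasible w k S (altPos S) x

/-- The facet `i` carries sign `τ` at a vertex adjacent to the edge `T`, in the half space. -/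
def IsEdgeEnd {m : ℕ} (w : Fin m → ℕ → ℝ) (k : ℕ) (T : Finset (Fin m)) (i : Fin m) (τ : Bool) :
    Prop :=
  ∃ x : Fin (k + 1) → ℝ, IsFeasible w (k + 1) (insert i T)
    (if τ then insert i (altPos T) else altPos T) x ∧ 0 < x (Fin.last k)

theorem interval_iff {α β t : ℝ} (hβ : β ≠ 0) :
    |α + β * t| ≤ 1 ↔ -α / β - 1 / |β| ≤ t ∧ t ≤ -α / β + 1 / |β| := by
  have h : |α + β * t| = |β| * |t - -α / β| := by
    rw [← abs_mul]; congr 1; field_simp; ring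
  rw [h, ← le_div_iff₀' (abs_pos.2 hβ), abs_le]
  constructor <;> rintro ⟨h1, h2⟩ <;> constructor <;> linarith

theorem interval_eq_iff {α β t : ℝ} (hβ : β ≠ 0) :
    |α + β * t| = 1 ↔ t = -α / β - 1 / |β| ∨ t = -α / β + 1 / |β| := by
  have h : |α + β * t| = |β| * |t - -α / β| := by
    rw [← abs_mul]; congr 1; field_simp; ring
  rw [h, mul_comm, ← eq_div_iff (abs_pos.2 hβ).ne', abs_eq (by positivity)]
  constructor <;> rintro (h1 | h1) <;> first | (left; linarith) | (right; linarith)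

open Classical in
/-- The two ends of an edge cut by a half space: parity version. -/
theorem GenericRows.even_edgeEnds {m : ℕ} {w : Fin m → ℕ → ℝ} (hw : GenericRows w) {k : ℕ}
    (hk : k + 1 ≤ m) {T : Finset (Fin m)} (hT : T.card = k) :
    Even ((∑ i ∈ Tᶜ, (Finset.univ.filter fun τ : Bool => IsEdgeEnd w k T i τ).card) +
      if T ∈ altVertices w k then 1 else 0) := by
  -- In `ℝ^(k+1)` the rows of `T` take their alternating signs on the line `(p + t q, t)`: `p` is
  -- the solution at height `0`, and `q` cancels the new column. Along it row `i` equals `α i + β i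
  -- t`, with `β i = 0` on `T` and, by general position, `β i ≠ 0` off `T`.
  obtain ⟨p, hp⟩ := hw.exists_solution hT (signOf (altPos T))
  obtain ⟨q, hq⟩ := hw.exists_solution hT fun i => - w i k
  set α : Fin m → ℝ := fun i => rowForm w k i p with hα
  set β : Fin m → ℝ := fun i => rowForm w k i q + w i k with hβ
  set pt : ℝ → Fin (k + 1) → ℝ := fun t => Fin.snoc (α := fun _ => ℝ) (p + t • q) t with hpt
  have hform : ∀ i t, rowForm w (k + 1) i (pt t) = α i + β i * t := by
    intro i t
    rw [hpt, rowForm_snoc, rowForm_add, rowForm_smul, hα, hβ]; ring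
  have hβT : ∀ i ∈ T, β i = 0 := fun i hi => by simp [hβ, hq i hi]
  have hαT : ∀ i ∈ T, α i = signOf (altPos T) i := fun i hi => hp i hi
  have hptlast : ∀ t, pt t (Fin.last k) = t := fun t => by simp [hpt]
  have hline : ∀ x : Fin (k + 1) → ℝ,
      (∀ i ∈ T, rowForm w (k + 1) i x = signOf (altPos T) i) → x = pt (x (Fin.last k)) := by
    intro x hx
    have hx' : x = Fin.snoc (α := fun _ => ℝ) (Fin.init x) (x (Fin.last k)) :=
      (Fin.snoc_init_self x).symm
    have : (Fin.init x : Fin k → ℝ) = p + x (Fin.last k) • q := by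
      refine hw.unique hT fun i hi => ?_
      have := hx i hi
      rw [hx', rowForm_snoc] at this
      rw [rowForm_add, rowForm_smul, hp i hi, hq i hi]
      linarith
    rw [this] at hx'
    exact hx'
  have hβ0 : ∀ i ∈ Tᶜ, β i ≠ 0 := by
    intro i hi h0
    have hiT : i ∉ T := Finset.mem_compl.1 hi
    have : (Fin.snoc (α := fun _ => ℝ) q 1 : Fin (k + 1) → ℝ) = 0 := by
      refine hw.eq_zero (k + 1) (insert i T) (by rw [Finset.card_insert_of_notMem hiT, hT]) _
        fun j hj => ?_
      rw [rowForm_snoc, mul_one]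
      rcases Finset.mem_insert.1 hj with rfl | hj
      · exact h0
      · exact hβT j hj
    have h2 := congrFun this (Fin.last k)
    simp at h2
  have hJ : (Tᶜ : Finset (Fin m)).Nonempty := by
    rw [← Finset.card_pos, Finset.card_compl, Fintype.card_fin]; omega
  set a : Fin m → ℝ := fun i => -α i / β i - 1 / |β i| with ha
  set b : Fin m → ℝ := fun i => -α i / β i + 1 / |β i| with hb
  have hle : ∀ i ∈ Tᶜ, ∀ t, |α i + β i * t| ≤ 1 ↔ a i ≤ t ∧ t ≤ b i := fun i hi t =>
    interval_iff (hβ0 i hi)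
  have heq : ∀ i ∈ Tᶜ, ∀ t, |α i + β i * t| = 1 ↔ t = a i ∨ t = b i := fun i hi t =>
    interval_eq_iff (hβ0 i hi)
  have hfeas : ∀ t, (∀ i, |rowForm w (k + 1) i (pt t)| ≤ 1) ↔ ∀ j ∈ Tᶜ, a j ≤ t ∧ t ≤ b j := by
    intro t
    constructor
    · intro h j hj
      rw [← hle j hj, ← hform]; exact h j
    · intro h j
      by_cases hj : j ∈ T
      · rw [hform, hβT j hj, hαT j hj, zero_mul, add_zero, abs_signOf]
      · rw [hform]; exact (hle j (Finset.mem_compl.2 hj) t).2 (h j (Finset.mem_compl.2 hj))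
  have htightT : ∀ t, ∀ i ∈ T, |rowForm w (k + 1) i (pt t)| = 1 := fun t i hi => by
    rw [hform, hβT i hi, hαT i hi, zero_mul, add_zero, abs_signOf]
  have hA : T ∈ altVertices w k ↔ ∀ j ∈ Tᶜ, a j ≤ 0 ∧ 0 ≤ b j := by
    rw [← hfeas 0]
    simp only [hform, mul_zero, add_zero]
    constructor
    · intro h
      obtain ⟨x, hx1, hx2⟩ := (Finset.mem_filter.1 h).2.2
      have : x = p := hw.unique hT fun i hi => by rw [hx1 i hi, hp i hi]
      rw [this] at hx2
      exact hx2
    · intro h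
      exact Finset.mem_filter.2 ⟨Finset.mem_univ _, hT, p, hp, h⟩
  -- Both side conditions come from `not_tight`: two ends at one point would give `k + 2` tight rows
  -- in `ℝ^(k+1)`, and an end at height `0` would give `k + 1` tight rows in `ℝ^k`.
  have key := even_card_interval_ends Tᶜ hJ a b
    (fun t _ ht i hi j hj hti htj => by
      by_contra hij
      rw [← heq i hi, ← hform] at hti
      rw [← heq j hj, ← hform] at htj
      refine hw.not_tight (k + 1) (insert i T)
        (by rw [Finset.card_insert_of_notMem (Finset.mem_compl.1 hi), hT]) j ?_ (pt t) ?_ htj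
      · rw [Finset.mem_insert, not_or]
        exact ⟨fun h => hij h.symm, Finset.mem_compl.1 hj⟩
      · intro l hl
        rcases Finset.mem_insert.1 hl with rfl | hl
        · exact hti
        · exact htightT t l hl)
    (fun h i hi => by
      rw [← not_or]
      intro hh
      have h2 : |α i + β i * 0| = 1 := (heq i hi 0).2 (by
        rcases hh with hh | hh
        · exact Or.inl hh.symm
        · exact Or.inr hh.symm)
      rw [mul_zero, add_zero] at h2
      refine hw.not_tight k T hT i (Finset.mem_compl.1 hi) p (fun l hl => ?_) h2
      rw [hp l hl, abs_signOf])
  have hends : ∀ i ∈ Tᶜ, (Finset.univ.filter fun τ : Bool => IsEdgeEnd w k T i τ).card =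
      (if 0 < a i ∧ ∀ j ∈ Tᶜ, a j ≤ a i ∧ a i ≤ b j then 1 else 0) +
      (if 0 < b i ∧ ∀ j ∈ Tᶜ, a j ≤ b i ∧ b i ≤ b j then 1 else 0) := by
    intro i hi
    have hiT := Finset.mem_compl.1 hi
    have hend : ∀ τ : Bool, IsEdgeEnd w k T i τ ↔ ∃ t, 0 < t ∧
        α i + β i * t = (if τ then 1 else -1) ∧ ∀ j ∈ Tᶜ, a j ≤ t ∧ t ≤ b j := by
      intro τ
      have hs : ∀ j, signOf (if τ then insert i (altPos T) else altPos T) j =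
          if j = i then (if τ then 1 else -1) else signOf (altPos T) j := by
        intro j
        have : i ∉ altPos T := fun h => hiT (altPos_subset T h)
        by_cases hji : j = i
        · subst hji; cases τ <;> simp [signOf, this]
        · cases τ <;> simp [signOf, hji]
      constructor
      · rintro ⟨x, ⟨hx1, hx2⟩, hx3⟩
        have hx : x = pt (x (Fin.last k)) := hline x fun j hj => by
          rw [hx1 j (Finset.mem_insert_of_mem hj), hs, if_neg (ne_of_mem_of_not_mem hj hiT)]
        refine ⟨x (Fin.last k), hx3, ?_, ?_⟩
        · rw [← hform, ← hx, hx1 i (Finset.mem_insert_self _ _), hs, if_pos rfl]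
        · rw [← hfeas, ← hx]; exact hx2
      · rintro ⟨t, ht, hti, htf⟩
        refine ⟨pt t, ⟨fun j hj => ?_, (hfeas t).2 htf⟩, by rwa [hptlast]⟩
        rw [hs, hform]
        rcases Finset.mem_insert.1 hj with rfl | hj
        · rw [if_pos rfl, hti]
        · rw [if_neg (ne_of_mem_of_not_mem hj hiT), hβT j hj, hαT j hj]; ring
    have hcard : (Finset.univ.filter fun τ : Bool => IsEdgeEnd w k T i τ).card =
        (if IsEdgeEnd w k T i true then 1 else 0) + (if IsEdgeEnd w k T i false then 1 else 0) := by
      rw [Finset.card_filter, Fintype.sum_bool]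
    rw [hcard]
    have hβi := hβ0 i hi
    have hend' : ∀ τ : Bool, ∀ t₀, α i + β i * t₀ = (if τ then 1 else -1) →
        (IsEdgeEnd w k T i τ ↔ 0 < t₀ ∧ ∀ j ∈ Tᶜ, a j ≤ t₀ ∧ t₀ ≤ b j) := by
      intro τ t₀ ht₀
      rw [hend]
      constructor
      · rintro ⟨t, h1, h2, h3⟩
        have : t = t₀ := by
          have : β i * (t - t₀) = 0 := by linarith
          rcases mul_eq_zero.1 this with h | h
          · exact absurd h hβi
          · linarith
        rw [← this]; exact ⟨h1, h3⟩
      · rintro ⟨h1, h3⟩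
        exact ⟨t₀, h1, ht₀, h3⟩
    -- Row `i` takes the value `+1` at the left end of its interval when it decreases along the
    -- line, and at the right end when it increases.
    rcases lt_or_gt_of_ne hβi with hneg | hpos
    · rw [if_congr (hend' true (a i) (by
        simp only [ha, abs_of_neg hneg, if_true]; field_simp; ring)) rfl rfl,
        if_congr (hend' false (b i) (by
        simp only [hb, abs_of_neg hneg]; field_simp; simp; try ring)) rfl rfl]
    · rw [if_congr (hend' true (b i) (by
        simp only [hb, abs_of_pos hpos, if_true]; field_simp; ring)) rfl rfl,
        if_congr (hend' false (a i) (by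
        simp only [ha, abs_of_pos hpos]; field_simp; simp; try ring)) rfl rfl, add_comm]
  rw [Finset.sum_congr rfl hends, Finset.sum_add_distrib, ← Finset.card_filter,
    ← Finset.card_filter, if_congr hA rfl rfl]
  convert key

theorem IsFeasible.neg {m : ℕ} {w : Fin m → ℕ → ℝ} {k : ℕ} {S P : Finset (Fin m)}
    {x : Fin k → ℝ} (h : IsFeasible w k S P x) : IsFeasible w k S (S \ P) (-x) := by
  refine ⟨fun i hi => ?_, fun i => by rw [rowForm_neg, abs_neg]; exact h.2 i⟩
  rw [rowForm_neg, h.1 i hi]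
  by_cases hP : i ∈ P <;> simp [signOf, hP, hi]

/-- At height `0` the `k + 1` active rows would all be tight at a point of `ℝ^k`. Hence no vertex
lies on the hyperplane bounding the half-space. -/
theorem GenericRows.last_ne_zero {m : ℕ} {w : Fin m → ℕ → ℝ} (hw : GenericRows w) {k : ℕ}
    {S P : Finset (Fin m)} (hS : S.card = k + 1) {x : Fin (k + 1) → ℝ}
    (h : IsFeasible w (k + 1) S P x) : x (Fin.last k) ≠ 0 := by
  intro h0
  have hx : x = Fin.snoc (α := fun _ => ℝ) (Fin.init x) (x (Fin.last k)) :=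
    (Fin.snoc_init_self x).symm
  have h1 : ∀ i ∈ S, |rowForm w k i (Fin.init x : Fin k → ℝ)| = 1 := by
    intro i hi
    have := h.1 i hi
    rw [hx, rowForm_snoc, h0, mul_zero, add_zero] at this
    rw [this, abs_signOf]
  obtain ⟨i, hi⟩ : S.Nonempty := by rw [← Finset.card_pos]; omega
  exact hw.not_tight k (S.erase i) (by rw [Finset.card_erase_of_mem hi, hS]; rfl) i
    (Finset.notMem_erase _ _) _ (fun j hj => h1 j (Finset.mem_of_mem_erase hj)) (h1 i hi)

open Classical in
/-- The number of alternating vertices is odd in every dimension. -/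
theorem GenericRows.odd_card_altVertices {m : ℕ} {w : Fin m → ℕ → ℝ} (hw : GenericRows w) {k : ℕ}
    (hk : k ≤ m) : Odd (altVertices w k).card := by
  induction k with
  | zero =>
    have : altVertices w 0 = {∅} := by
      ext S
      simp only [altVertices, Finset.mem_filter, Finset.mem_univ, true_and, Finset.card_eq_zero,
        Finset.mem_singleton]
      refine ⟨fun h => h.1, fun h => ⟨h, 0, ?_, ?_⟩⟩
      · subst h; simp
      · intro i; simp [rowForm]
    rw [this]; simp
  | succ k ih =>
    have ih := ih (by omega)
    -- All signed vertices in the open upper half-space, alternating or not: the ends of alternating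
    -- edges are among them.
    set V : Finset (Finset (Fin m) × Finset (Fin m)) := Finset.univ.filter fun y =>
      y.1.card = k + 1 ∧ y.2 ⊆ y.1 ∧ ∃ x, IsFeasible w (k + 1) y.1 y.2 x ∧ 0 < x (Fin.last k)
      with hV
    have h1 : Even ((∑ T ∈ Finset.univ.filter (fun T : Finset (Fin m) => T.card = k),
        ∑ i ∈ Tᶜ, (Finset.univ.filter fun τ : Bool => IsEdgeEnd w k T i τ).card) +
        (altVertices w k).card) := by
      have : (altVertices w k).card = ∑ T ∈ Finset.univ.filter
          (fun T : Finset (Fin m) => T.card = k), if T ∈ altVertices w k then 1 else 0 := by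
        rw [← Finset.card_filter]
        congr 1
        ext T
        simp only [Finset.mem_filter, Finset.mem_univ, true_and]
        exact ⟨fun h => ⟨(Finset.mem_filter.1 h).2.1, h⟩, fun h => h.2⟩
      rw [this, ← Finset.sum_add_distrib]
      exact Finset.even_sum _ fun T hT => hw.even_edgeEnds hk (Finset.mem_filter.1 hT).2
    -- Double counting of incidences. An edge `T` with an end where row `i` becomes tight with sign
    -- `τ` corresponds to a vertex `T ∪ {i}` together with the facet `i` whose removal leaves an
    -- alternating pattern.
    have h2 : (∑ T ∈ Finset.univ.filter (fun T : Finset (Fin m) => T.card = k),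
        ∑ i ∈ Tᶜ, (Finset.univ.filter fun τ : Bool => IsEdgeEnd w k T i τ).card) =
        ∑ y ∈ V, (y.1.filter fun i => y.2.erase i = altPos (y.1.erase i)).card := by
      have e1 : (∑ T ∈ Finset.univ.filter (fun T : Finset (Fin m) => T.card = k),
          ∑ i ∈ Tᶜ, (Finset.univ.filter fun τ : Bool => IsEdgeEnd w k T i τ).card) =
          ((Finset.univ.filter (fun T : Finset (Fin m) => T.card = k)).sigma fun T =>
            Tᶜ.sigma fun i => Finset.univ.filter fun τ : Bool => IsEdgeEnd w k T i τ).card := by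
        simp only [Finset.card_sigma]
      have e2 : ∑ y ∈ V, (y.1.filter fun i => y.2.erase i = altPos (y.1.erase i)).card =
          (V.sigma fun y => y.1.filter fun i => y.2.erase i = altPos (y.1.erase i)).card := by
        simp only [Finset.card_sigma]
      rw [e1, e2]
      refine Finset.card_bij'
        (fun z _ => ⟨(insert z.2.1 z.1, if z.2.2 then insert z.2.1 (altPos z.1) else altPos z.1),
          z.2.1⟩)
        (fun z _ => ⟨z.1.1.erase z.2, z.2, decide (z.2 ∈ z.1.2)⟩) ?_ ?_ ?_ ?_
      · rintro ⟨T, i, τ⟩ hz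
        simp only [Finset.mem_sigma, Finset.mem_filter, Finset.mem_univ, true_and,
          Finset.mem_compl] at hz
        obtain ⟨hT, hi, hτ⟩ := hz
        have hi' : i ∉ altPos T := fun h => hi (altPos_subset T h)
        simp only [Finset.mem_sigma, hV, Finset.mem_filter, Finset.mem_univ, true_and]
        refine ⟨⟨by rw [Finset.card_insert_of_notMem hi, hT], ?_, hτ⟩,
          Finset.mem_insert_self _ _, ?_⟩
        · split_ifs
          · exact Finset.insert_subset_insert _ (altPos_subset T)
          · exact (altPos_subset T).trans (Finset.subset_insert _ _)
        · rw [Finset.erase_insert hi]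
          split_ifs
          · rw [Finset.erase_insert hi']
          · rw [Finset.erase_eq_of_notMem hi']
      · rintro ⟨⟨S, P⟩, i⟩ hz
        simp only [Finset.mem_sigma, hV, Finset.mem_filter, Finset.mem_univ, true_and] at hz
        obtain ⟨⟨hS, hP, hf⟩, hi, hPi⟩ := hz
        simp only [Finset.mem_sigma, Finset.mem_filter, Finset.mem_univ, true_and,
          Finset.mem_compl, Finset.notMem_erase, not_false_eq_true]
        refine ⟨by rw [Finset.card_erase_of_mem hi, hS]; rfl, ?_⟩
        unfold IsEdgeEnd
        rw [← hPi, Finset.insert_erase hi]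
        by_cases hiP : i ∈ P
        · simpa [hiP] using hf
        · simpa [hiP] using hf
      · rintro ⟨T, i, τ⟩ hz
        simp only [Finset.mem_sigma, Finset.mem_filter, Finset.mem_univ, true_and,
          Finset.mem_compl] at hz
        obtain ⟨hT, hi, hτ⟩ := hz
        have hi' : i ∉ altPos T := fun h => hi (altPos_subset T h)
        cases τ <;> simp [Finset.erase_insert hi, hi']
      · rintro ⟨⟨S, P⟩, i⟩ hz
        simp only [Finset.mem_sigma, hV, Finset.mem_filter, Finset.mem_univ, true_and] at hz
        obtain ⟨⟨hS, hP, hf⟩, hi, hPi⟩ := hz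
        by_cases hiP : i ∈ P
        · simp [← hPi, Finset.insert_erase hi, hiP]
        · simp [← hPi, Finset.insert_erase hi, hiP]
    rw [h2] at h1
    have h3 : Odd (∑ y ∈ V, (y.1.filter fun i => y.2.erase i = altPos (y.1.erase i)).card) := by
      rw [Nat.even_add] at h1
      rw [← Nat.not_even_iff_odd] at ih ⊢
      exact fun h => ih (h1.1 h)
    rw [Finset.odd_sum_iff_odd_card_odd] at h3
    have hne : ∀ S : Finset (Fin m), S.card = k + 1 → S.Nonempty := fun S hS => by
      rw [← Finset.card_pos]; omega
    -- The vertices with an odd count are the alternating ones and their opposites. By the symmetry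
    -- `x ↦ -x`, exactly one of each antipodal pair lies in the upper half-space, so index sets are
    -- counted once.
    have h4 : (V.filter fun y => Odd (y.1.filter fun i =>
        y.2.erase i = altPos (y.1.erase i)).card).card = (altVertices w (k + 1)).card := by
      have hmem : ∀ y, y ∈ (V.filter fun y => Odd (y.1.filter fun i =>
          y.2.erase i = altPos (y.1.erase i)).card) ↔ y.1.card = k + 1 ∧
          (y.2 = altPos y.1 ∨ y.2 = y.1 \ altPos y.1) ∧
          ∃ x, IsFeasible w (k + 1) y.1 y.2 x ∧ 0 < x (Fin.last k) := by
        intro y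
        simp only [hV, Finset.mem_filter, Finset.mem_univ, true_and]
        constructor
        · rintro ⟨⟨hc, hs, hf⟩, ho⟩
          exact ⟨hc, (odd_card_erase_altPos_iff _ _ hs (hne _ hc)).1 ho, hf⟩
        · rintro ⟨hc, ho, hf⟩
          have hs : y.2 ⊆ y.1 := by
            rcases ho with h | h <;> rw [h]
            · exact altPos_subset _
            · exact Finset.sdiff_subset
          exact ⟨⟨hc, hs, hf⟩, (odd_card_erase_altPos_iff _ _ hs (hne _ hc)).2 ho⟩
      have hss : ∀ S : Finset (Fin m), S \ (S \ altPos S) = altPos S := fun S => by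
        rw [Finset.sdiff_sdiff_eq_self (altPos_subset S)]
      refine Finset.card_bij (fun y _ => y.1) ?_ ?_ ?_
      · rintro ⟨S, P⟩ hy
        obtain ⟨hc, ho, x, hx, -⟩ := (hmem _).1 hy
        refine Finset.mem_filter.2 ⟨Finset.mem_univ _, hc, ?_⟩
        rcases ho with h | h
        · exact ⟨x, h ▸ hx⟩
        · refine ⟨-x, ?_⟩
          have := hx.neg
          rw [h, hss] at this
          exact this
      · have key : ∀ S : Finset (Fin m), S.card = k + 1 → ∀ x y : Fin (k + 1) → ℝ,
            IsFeasible w (k + 1) S (altPos S) x → IsFeasible w (k + 1) S (S \ altPos S) y →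
            0 < x (Fin.last k) → 0 < y (Fin.last k) → False := by
          intro S hS x y hx hy h0 h0'
          have : y = -x := hw.unique hS fun i hi => by rw [hy.1 i hi, hx.neg.1 i hi]
          rw [this] at h0'
          simp only [Pi.neg_apply] at h0'
          linarith
        rintro ⟨S, P⟩ hy ⟨S', P'⟩ hy' hSS
        obtain ⟨hc, ho, x, hx, hx0⟩ := (hmem _).1 hy
        obtain ⟨hc', ho', x', hx', hx0'⟩ := (hmem _).1 hy'
        dsimp only at *
        subst hSS
        rcases ho with rfl | rfl <;> rcases ho' with rfl | rfl
        · rfl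
        · exact (key S hc _ _ hx hx' hx0 hx0').elim
        · exact (key S hc _ _ hx' hx hx0' hx0).elim
        · rfl
      · intro S hS
        obtain ⟨-, hc, x, hx⟩ := Finset.mem_filter.1 hS
        rcases lt_or_gt_of_ne (hw.last_ne_zero hc hx) with h | h
        · refine ⟨(S, S \ altPos S), (hmem _).2 ⟨hc, Or.inr rfl, -x, hx.neg, ?_⟩, rfl⟩
          simpa using h
        · exact ⟨(S, altPos S), (hmem _).2 ⟨hc, Or.inl rfl, x, hx, h⟩, rfl⟩
    rwa [h4] at h3

/-! ### Genericity, compactness and the zigzag lemma -/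

/-- The matrix with rows `± w_{f j} - w_{i₀}` (the last term is absent when `o = none`). -/
noncomputable def signedMatrix {m k : ℕ} (f : Fin k → Fin m) (τ : Fin k → Bool)
    (o : Option (Fin m)) (w : Fin m → ℕ → ℝ) : Matrix (Fin k) (Fin k) ℝ :=
  Matrix.of fun j l => (if τ j then 1 else -1) * w (f j) l - o.elim 0 fun i => w i l

/-- `det (A + t)` is the characteristic polynomial of `-A` at `t`, and a monic polynomial has
finitely many roots. -/
theorem finite_det_add_smul_eq_zero {k : ℕ} (A : Matrix (Fin k) (Fin k) ℝ) :
    {t : ℝ | (A + t • (1 : Matrix (Fin k) (Fin k) ℝ)).det = 0}.Finite := by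
  have h : {t : ℝ | (A + t • (1 : Matrix (Fin k) (Fin k) ℝ)).det = 0} ⊆
      {t | (-A).charpoly.IsRoot t} := by
    intro t ht
    simp only [Set.mem_ofPred_eq, Polynomial.IsRoot.def, Matrix.eval_charpoly] at ht ⊢
    rw [← ht]
    congr 1
    rw [sub_neg_eq_add, add_comm, Matrix.scalar_apply, Matrix.smul_one_eq_diagonal]
  exact (Polynomial.finite_setOfPred_isRoot (Matrix.charpoly_monic _).ne_zero).subset h

theorem signedMatrix_isOpen {m k : ℕ} (f : Fin k → Fin m) (τ : Fin k → Bool)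
    (o : Option (Fin m)) : IsOpen {w : Fin m → ℕ → ℝ | (signedMatrix f τ o w).det ≠ 0} := by
  have hc : Continuous fun w : Fin m → ℕ → ℝ => (signedMatrix f τ o w).det := by
    refine Continuous.matrix_det (continuous_matrix fun j l => ?_)
    cases o with
    | none => simp only [signedMatrix, Matrix.of_apply, Option.elim]; fun_prop
    | some i => simp only [signedMatrix, Matrix.of_apply, Option.elim]; fun_prop
  exact isOpen_ne_fun hc continuous_const

/-- The direction `u` is chosen so that moving `w` to `w + t u` adds `t` times the identity to the
signed matrix; `ho` ensures that the subtracted row does not move. The determinant then vanishes for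
finitely many `t` only. -/
theorem signedMatrix_dense {m k : ℕ} {f : Fin k → Fin m} (hf : Function.Injective f)
    (τ : Fin k → Bool) (o : Option (Fin m)) (ho : ∀ i ∈ o, i ∉ Set.range f) :
    Dense {w : Fin m → ℕ → ℝ | (signedMatrix f τ o w).det ≠ 0} := by
  intro w
  set u : Fin m → ℕ → ℝ := fun i l =>
    ∑ j : Fin k, if f j = i ∧ l = j then (if τ j then 1 else -1) else 0 with hu
  have hmat : ∀ t : ℝ, signedMatrix f τ o (w + t • u) =
      signedMatrix f τ o w + t • (1 : Matrix (Fin k) (Fin k) ℝ) := by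
    intro t
    ext j l
    have h1 : u (f j) l = if j = l then (if τ j then 1 else -1) else 0 := by
      rw [hu]
      simp only
      rw [Finset.sum_eq_single j]
      · simp only [true_and, Fin.val_inj, @eq_comm _ l j]
      · intro j' _ hj'
        rw [if_neg fun h => hj' (hf h.1)]
      · simp
    have h2 : (o.elim 0 fun i => (w + t • u) i l) = o.elim 0 fun i => w i l := by
      cases o with
      | none => rfl
      | some i =>
        have : u i l = 0 := by
          refine Finset.sum_eq_zero fun j' _ => if_neg fun h => ?_
          exact ho i rfl ⟨j', h.1⟩
        simp [this]
    simp only [signedMatrix, Matrix.of_apply, Matrix.add_apply, Matrix.smul_apply, h2,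
      Matrix.one_apply]
    simp only [Pi.add_apply, Pi.smul_apply, smul_eq_mul, h1]
    by_cases hjl : j = l <;> cases τ j <;> simp [hjl] <;> ring
  have hcont : Filter.Tendsto (fun t : ℝ => w + t • u) (nhdsWithin 0 {0}ᶜ) (nhds w) := by
    have : Continuous fun t : ℝ => w + t • u := by fun_prop
    have h0 := (this.tendsto 0).mono_left (nhdsWithin_le_nhds (s := {0}ᶜ))
    simpa using h0
  refine mem_closure_of_tendsto hcont ?_
  have hfin := finite_det_add_smul_eq_zero (signedMatrix f τ o w)
  have := (hfin.isClosed.isOpen_compl)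
  have h3 : ({t : ℝ | (signedMatrix f τ o w + t • (1 : Matrix (Fin k) (Fin k) ℝ)).det = 0} \ {0})ᶜ
      ∈ nhds (0 : ℝ) :=
    (hfin.subset Set.sdiff_subset).isClosed.isOpen_compl.mem_nhds (by simp)
  filter_upwards [mem_nhdsWithin_of_mem_nhds h3, self_mem_nhdsWithin] with t ht ht0
  rw [hmat]
  intro h
  exact ht ⟨h, ht0⟩

/-- By Baire it suffices that countably many determinants be nonzero. For `not_tight`: if all rows
of `S` and the row `i₀` have modulus `1` at `x`, then suitable signs make every `± wᵢ - w_{i₀}`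
vanish at `x`, which forces `x = 0`, where the rows vanish. -/
theorem dense_genericRows (m : ℕ) : Dense {w : Fin m → ℕ → ℝ | GenericRows w} := by
  let I := {c : (Σ k : ℕ, (Fin k → Fin m) × (Fin k → Bool) × Option (Fin m)) //
    Function.Injective c.2.1 ∧ ∀ i ∈ c.2.2.2, i ∉ Set.range c.2.1}
  have hd : Dense (⋂ c : I, {w : Fin m → ℕ → ℝ |
      (signedMatrix c.1.2.1 c.1.2.2.1 c.1.2.2.2 w).det ≠ 0}) :=
    dense_iInter_of_isOpen (fun c => signedMatrix_isOpen _ _ _)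
      fun c => signedMatrix_dense c.2.1 _ _ c.2.2
  refine hd.mono fun w hw => ?_
  rw [Set.mem_iInter] at hw
  have hmul : ∀ {k : ℕ} (f : Fin k → Fin m) (τ : Fin k → Bool) (o : Option (Fin m))
      (x : Fin k → ℝ) (j : Fin k), (signedMatrix f τ o w).mulVec x j =
        (if τ j then 1 else -1) * rowForm w k (f j) x - o.elim 0 fun i => rowForm w k i x := by
    intro k f τ o x j
    cases o <;> simp [Matrix.mulVec, dotProduct, signedMatrix, rowForm, Finset.mul_sum, sub_mul]
  constructor
  · intro k S hS x hx
    set f := S.orderEmbOfFin hS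
    have := hw ⟨⟨k, f, fun _ => true, none⟩, f.injective, by simp⟩
    refine Matrix.eq_zero_of_mulVec_eq_zero this (funext fun j => ?_)
    rw [hmul]
    simp [hx (f j) (S.orderEmbOfFin_mem hS j)]
  · intro k S hS i₀ hi₀ x hx h1
    set f := S.orderEmbOfFin hS
    have := hw ⟨⟨k, f, fun j => decide (rowForm w k (f j) x = rowForm w k i₀ x), some i₀⟩,
      f.injective, by
        intro i hi
        simp only [Option.mem_def, Option.some.injEq] at hi
        subst hi
        rintro ⟨j, hj⟩
        exact hi₀ (hj ▸ S.orderEmbOfFin_mem hS j)⟩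
    have hx0 : x = 0 := by
      refine Matrix.eq_zero_of_mulVec_eq_zero this (funext fun j => ?_)
      rw [hmul]
      have h2 := hx (f j) (S.orderEmbOfFin_mem hS j)
      by_cases he : rowForm w k (f j) x = rowForm w k i₀ x
      · simp [he]
      · simp only [he, decide_false, Option.elim]
        rcases abs_eq_abs.1 (h2.trans h1.symm) with h | h
        · exact absurd h he
        · simp [h]
    rw [hx0] at h1
    simp [rowForm] at h1

theorem card_filter_lt_orderEmbOfFin {α : Type*} [LinearOrder α] {S : Finset α} {k : ℕ}
    (hS : S.card = k) (j : Fin k) : (S.filter (· < S.orderEmbOfFin hS j)).card = j := by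
  have : S.filter (· < S.orderEmbOfFin hS j) =
      (Finset.Iio j).map (S.orderEmbOfFin hS).toEmbedding := by
    ext i
    simp only [Finset.mem_filter, Finset.mem_map, Finset.mem_Iio, RelEmbedding.coe_toEmbedding]
    constructor
    · rintro ⟨hi, hlt⟩
      rw [← Finset.mem_coe, ← S.range_orderEmbOfFin hS] at hi
      obtain ⟨l, rfl⟩ := hi
      exact ⟨l, (S.orderEmbOfFin hS).lt_iff_lt.1 hlt, rfl⟩
    · rintro ⟨l, hl, rfl⟩
      exact ⟨S.orderEmbOfFin_mem hS l, (S.orderEmbOfFin hS).lt_iff_lt.2 hl⟩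
  rw [this, Finset.card_map, Fin.card_Iio]

/-- Every family of linear forms, in the order given, has a point where `d` of them attain the
maximal absolute value with alternating signs. -/
theorem exists_alternating_rows {m d : ℕ} (hd : 1 ≤ d) (hdm : d ≤ m) (w : Fin m → ℕ → ℝ) :
    ∃ x : Fin d → ℝ, ‖x‖ = 1 ∧ ∃ f : Fin d → Fin m, StrictMono f ∧
      ∀ i (j : Fin d), |rowForm w d i x| ≤ (-1) ^ (j : ℕ) * rowForm w d (f j) x := by
  classical
  -- The set of rows for which the conclusion holds. It is a finite union of projections along the
  -- compact unit sphere, hence closed, and it contains the dense set of generic rows, by rescaling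
  -- an alternating vertex to norm `1`.
  set G : Set (Fin m → ℕ → ℝ) := ⋃ f : {f : Fin d → Fin m // StrictMono f},
    (fun p : Metric.sphere (0 : Fin d → ℝ) 1 × (Fin m → ℕ → ℝ) => p.2) ''
      {p | ∀ i (j : Fin d), |rowForm p.2 d i p.1| ≤ (-1) ^ (j : ℕ) * rowForm p.2 d (f.1 j) p.1} with hG
  have hclosed : IsClosed G := by
    refine isClosed_iUnion_of_finite fun f => ?_
    refine isClosedMap_snd_of_compactSpace _ ?_
    simp only [Set.ofPred_forall]
    refine isClosed_iInter fun i => isClosed_iInter fun j => ?_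
    have hc : ∀ i, Continuous fun p : Metric.sphere (0 : Fin d → ℝ) 1 × (Fin m → ℕ → ℝ) =>
        rowForm p.2 d i p.1 := fun i => by
      unfold rowForm
      refine continuous_finsetSum _ fun j _ => ?_
      exact ((continuous_apply_apply (ρ := fun _ _ => ℝ) i (j : ℕ)).comp continuous_snd).mul
        ((continuous_apply j).comp (continuous_subtype_val.comp continuous_fst))
    exact isClosed_le (hc i).abs (continuous_const.mul (hc _))
  have hgen : {w : Fin m → ℕ → ℝ | GenericRows w} ⊆ G := by
    intro w hw
    obtain ⟨S, hS⟩ := (GenericRows.odd_card_altVertices hw hdm).pos |> Finset.card_pos.1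
    obtain ⟨-, hc, x, hx1, hx2⟩ := Finset.mem_filter.1 hS
    have hsgn : ∀ j : Fin d, rowForm w d (S.orderEmbOfFin hc j) x = (-1) ^ (j : ℕ) := by
      intro j
      rw [hx1 _ (S.orderEmbOfFin_mem hc j), signOf]
      simp only [altPos, Finset.mem_filter, S.orderEmbOfFin_mem hc j, true_and,
        card_filter_lt_orderEmbOfFin hc j]
      split_ifs with h
      · rw [h.neg_one_pow]
      · rw [(Nat.not_even_iff_odd.1 h).neg_one_pow]
    have hx0 : x ≠ 0 := by
      rintro rfl
      have := hsgn ⟨0, hd⟩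
      simp [rowForm] at this
    have hn : 0 < ‖x‖ := norm_pos_iff.2 hx0
    refine Set.mem_iUnion.2 ⟨⟨S.orderEmbOfFin hc, (S.orderEmbOfFin hc).strictMono⟩,
      (⟨‖x‖⁻¹ • x, ?_⟩, w), ?_, rfl⟩
    · rw [mem_sphere_zero_iff_norm, norm_smul, norm_inv, norm_norm, inv_mul_cancel₀ hn.ne']
    · intro i j
      simp only
      rw [rowForm_smul, rowForm_smul, hsgn, abs_mul, abs_of_pos (inv_pos.2 hn), mul_left_comm,
        ← pow_add, Even.neg_one_pow ⟨_, rfl⟩]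
      exact mul_le_mul_of_nonneg_left (hx2 i) (inv_pos.2 hn).le
  have huniv : w ∈ G := by
    have := (dense_genericRows m).mono hgen
    rw [← hclosed.closure_eq, this.closure_eq]
    trivial
  obtain ⟨f, p, hp, rfl⟩ := Set.mem_iUnion.1 huniv
  exact ⟨p.1, mem_sphere_zero_iff_norm.1 p.1.2, f.1, f.2, hp⟩

/-- Zigzag lemma: in a `d`-dimensional space with an ordered list of linear forms there is a unit
vector for which `d` of the forms attain the maximal absolute value with alternating signs. -/
theorem exists_zigzag {d m : ℕ} (hd : 1 ≤ d) (hdm : d ≤ m) (φ : ℕ → (Fin d → ℝ) →ₗ[ℝ] ℝ) :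
    ∃ x : Fin d → ℝ, ‖x‖ = 1 ∧ ∃ u : ℕ → ℕ, (∀ j, j + 1 < d → u j < u (j + 1)) ∧
      (∀ j < d, u j < m) ∧ ∀ i < m, ∀ j < d, |φ i x| ≤ (-1) ^ j * φ (u j) x := by
  set w : Fin m → ℕ → ℝ := fun i j => if h : j < d then φ i (Pi.single ⟨j, h⟩ 1) else 0 with hw
  have hrow : ∀ i x, rowForm w d i x = φ i x := by
    intro i x
    conv_rhs => rw [← Finset.univ_sum_single x, map_sum]
    refine Finset.sum_congr rfl fun j _ => ?_
    have : Pi.single j (x j) = x j • (Pi.single j 1 : Fin d → ℝ) := by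
      rw [← Pi.single_smul]; simp
    rw [this, map_smul, smul_eq_mul, mul_comm, hw]
    simp
  obtain ⟨x, hx, f, hf, h⟩ := exists_alternating_rows hd hdm w
  refine ⟨x, hx, fun j => if hj : j < d then f ⟨j, hj⟩ else 0, fun j hj => ?_, fun j hj => ?_,
    fun i hi j hj => ?_⟩
  · simp only [hj, (Nat.lt_succ_self j).trans hj, dif_pos]
    exact hf (Fin.mk_lt_mk.2 (Nat.lt_succ_self j))
  · simp only [hj, dif_pos]
    exact (f ⟨j, hj⟩).2
  · have := h ⟨i, hi⟩ ⟨j, hj⟩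
    rw [hrow, hrow] at this
    simpa [hj] using this

/-- Reaching the first peak costs at least `M - |y 0|`, and each change of sign costs another `2 M`.
-/
theorem zigzag_variation {y : ℕ → ℝ} {u : ℕ → ℕ} {d : ℕ} {M : ℝ}
    (hu : ∀ j, j + 1 < d → u j < u (j + 1)) (hM : ∀ j < d, M ≤ (-1) ^ j * y (u j)) {j : ℕ}
    (hj : j < d) : (2 * j + 1) * M ≤ |y 0| + ∑ i ∈ Finset.range (u j), |y (i + 1) - y i| := by
  have htel : ∀ a b : ℕ, a ≤ b → |y b - y a| ≤ ∑ i ∈ Finset.Ico a b, |y (i + 1) - y i| := by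
    intro a b hab
    rw [← Finset.sum_Ico_sub y hab]
    exact Finset.abs_sum_le_sum_abs _ _
  induction j with
  | zero =>
    have h1 := htel 0 (u 0) (Nat.zero_le _)
    have h2 := hM 0 hj
    rw [Finset.range_eq_Ico]
    simp only [pow_zero, one_mul] at h2
    have h3 : y (u 0) ≤ |y 0| + |y (u 0) - y 0| := by
      have := le_abs_self (y 0); have := le_abs_self (y (u 0) - y 0); linarith
    push_cast
    linarith
  | succ j ih =>
    have ih := ih (by omega)
    have h1 := htel _ _ (hu j hj).le
    have h2 : 2 * M ≤ |y (u (j + 1)) - y (u j)| := by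
      have e1 := hM j (by omega)
      have e2 := hM (j + 1) hj
      rw [pow_succ] at e2
      calc 2 * M ≤ (-1) ^ j * (y (u j) - y (u (j + 1))) := by linarith
        _ ≤ |(-1) ^ j * (y (u j) - y (u (j + 1)))| := le_abs_self _
        _ = |y (u (j + 1)) - y (u j)| := by
          rw [abs_mul, abs_pow, abs_neg, abs_one, one_pow, one_mul, abs_sub_comm]
    rw [Finset.range_eq_Ico] at ih ⊢
    rw [← Finset.sum_Ico_consecutive _ (Nat.zero_le _) (hu j hj).le]
    push_cast
    linarith

/-! ### Upper estimate for the Volterra operator -/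

section
variable {𝕜 : Type*} [RCLike 𝕜]

theorem volterra_apply (f : L1I 𝕜) (x : unitInterval) :
    volterra 𝕜 f x = ∫ t in (0 : ℝ)..x, (f : ℝ → 𝕜) t := rfl

theorem L1I.intervalIntegrable_of_mem (f : L1I 𝕜) {a b : ℝ} (ha : a ∈ Set.Icc (0 : ℝ) 1)
    (hb : b ∈ Set.Icc (0 : ℝ) 1) : IntervalIntegrable (f : ℝ → 𝕜) volume a b := by
  rw [intervalIntegrable_iff]
  refine (L1I.integrableOn f).mono_set ?_
  exact Set.uIoc_subset_uIcc.trans (Set.uIcc_subset_Icc ha hb)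

theorem L1I.norm_eq (f : L1I 𝕜) : ‖f‖ = ∫ t in (0 : ℝ)..1, ‖(f : ℝ → 𝕜) t‖ := by
  rw [L1.norm_eq_integral_norm, intervalIntegral.integral_of_le zero_le_one,
    integral_Icc_eq_integral_Ioc]

/-- The point `i / N` of the unit interval. -/
noncomputable def gridPoint (N i : ℕ) : unitInterval := Set.projIcc 0 1 zero_le_one ((i : ℝ) / N)

theorem coe_gridPoint {N i : ℕ} (hN : 1 ≤ N) (hi : i ≤ N) : (gridPoint N i : ℝ) = i / N := by
  have hN' : (0 : ℝ) < N := by exact_mod_cast hN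
  rw [gridPoint, Set.projIcc_of_mem]
  exact ⟨by positivity, (div_le_one hN').2 (by exact_mod_cast hi)⟩

/-- The variation along a grid of a primitive of `g` is at most `∫ |g|`. -/
theorem sum_abs_integral_le {g : ℝ → ℝ} (hg : IntegrableOn g (Set.Icc 0 1)) {N : ℕ} (hN : 1 ≤ N) :
    ∑ i ∈ Finset.range N, |(∫ t in (0 : ℝ)..gridPoint N (i + 1), g t) -
      ∫ t in (0 : ℝ)..gridPoint N i, g t| ≤ ∫ t in (0 : ℝ)..1, |g t| := by
  have hint : ∀ a ∈ Set.Icc (0 : ℝ) 1, ∀ b ∈ Set.Icc (0 : ℝ) 1, IntervalIntegrable g volume a b := by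
    intro a ha b hb
    rw [intervalIntegrable_iff]
    exact hg.mono_set (Set.uIoc_subset_uIcc.trans (Set.uIcc_subset_Icc ha hb))
  have h0 : (0 : ℝ) ∈ Set.Icc (0 : ℝ) 1 := ⟨le_rfl, zero_le_one⟩
  have h1 : ∑ i ∈ Finset.range N, ∫ t in (gridPoint N i : ℝ)..gridPoint N (i + 1), |g t| =
      ∫ t in (gridPoint N 0 : ℝ)..gridPoint N N, |g t| :=
    intervalIntegral.sum_integral_adjacent_intervals (a := fun i => (gridPoint N i : ℝ))
      fun i _ => (hint _ (gridPoint N i).2 _ (gridPoint N (i + 1)).2).abs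
  have e0 : (gridPoint N 0 : ℝ) = 0 := by rw [coe_gridPoint hN (Nat.zero_le _)]; simp
  have e1 : (gridPoint N N : ℝ) = 1 := by
    rw [coe_gridPoint hN le_rfl, div_self]
    exact_mod_cast (by omega : N ≠ 0)
  rw [e0, e1] at h1
  rw [← h1]
  refine Finset.sum_le_sum fun i hi => ?_
  rw [intervalIntegral.integral_interval_sub_left (hint _ h0 _ (gridPoint N (i + 1)).2)
    (hint _ h0 _ (gridPoint N i).2)]
  refine intervalIntegral.abs_integral_le_integral_abs ?_
  have hi := Finset.mem_range.1 hi
  rw [coe_gridPoint hN hi.le, coe_gridPoint hN hi]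
  gcongr
  simp

theorem re_volterra (f : L1I 𝕜) (x : unitInterval) :
    RCLike.re (volterra 𝕜 f x) = ∫ t in (0 : ℝ)..x, RCLike.re ((f : ℝ → 𝕜) t) := by
  rw [volterra_apply]
  exact ((RCLike.reCLM (K := 𝕜)).intervalIntegral_comp_comm (L1I.intervalIntegrable f x)).symm

theorem im_volterra (f : L1I 𝕜) (x : unitInterval) :
    RCLike.im (volterra 𝕜 f x) = ∫ t in (0 : ℝ)..x, RCLike.im ((f : ℝ → 𝕜) t) := by
  rw [volterra_apply]
  exact ((RCLike.imCLM (K := 𝕜)).intervalIntegral_comp_comm (L1I.intervalIntegrable f x)).symm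

/-- On the unit sphere of a finite dimensional space, `V f` is determined by a grid up to `η`. -/
theorem exists_grid_approx {d : ℕ} (L : (Fin d → ℝ) →ₗ[ℝ] L1I 𝕜) {η : ℝ} (hη : 0 < η) (N₀ : ℕ) :
    ∃ N, N₀ ≤ N ∧ 1 ≤ N ∧ ∀ x, ‖x‖ = 1 → ∀ t : unitInterval, ∃ i ≤ N,
      ‖volterra 𝕜 (L x) t - volterra 𝕜 (L x) (gridPoint N i)‖ ≤ η := by
  have hLc : Continuous L := L.continuous_of_finiteDimensional
  have hc : Continuous fun p : Metric.sphere (0 : Fin d → ℝ) 1 × unitInterval =>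
      volterra 𝕜 (L p.1) p.2 := by
    have h1 : Continuous fun p : Metric.sphere (0 : Fin d → ℝ) 1 × unitInterval =>
      volterra 𝕜 (L p.1) := (volterra 𝕜).continuous.comp
        (hLc.comp (continuous_subtype_val.comp continuous_fst))
    exact ContinuousEval.continuous_eval.comp (h1.prodMk continuous_snd)
  -- Uniform continuity in both variables lets a single mesh serve the whole sphere, so the grid can
  -- be fixed before the zigzag vector is found.
  have hu := CompactSpace.uniformContinuous_of_continuous hc
  obtain ⟨δ, hδ, h⟩ := Metric.uniformContinuous_iff.1 hu η hη
  obtain ⟨N₁, hN₁⟩ := exists_nat_gt (1 / δ)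
  refine ⟨max N₀ (N₁ + 1), le_max_left _ _, (Nat.le_add_left 1 N₁).trans (le_max_right _ _),
    fun x hx t => ?_⟩
  set N := max N₀ (N₁ + 1) with hN
  have hN1 : 1 ≤ N := (Nat.le_add_left 1 N₁).trans (le_max_right _ _)
  have hNpos : (0 : ℝ) < N := by exact_mod_cast hN1
  have hNδ : 1 / δ < N := hN₁.trans_le (by
    have : N₁ ≤ N := (Nat.le_succ N₁).trans (le_max_right _ _)
    exact_mod_cast this)
  have hi : ⌊(t : ℝ) * N⌋₊ ≤ N := by
    refine Nat.floor_le_of_le ?_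
    exact mul_le_of_le_one_left hNpos.le t.2.2
  refine ⟨⌊(t : ℝ) * N⌋₊, hi, ?_⟩
  have hd : dist t (gridPoint N ⌊(t : ℝ) * N⌋₊) < δ := by
    rw [Subtype.dist_eq, coe_gridPoint hN1 hi, Real.dist_eq]
    have e1 := Nat.floor_le (mul_nonneg t.2.1 hNpos.le)
    have e2 := Nat.lt_floor_add_one ((t : ℝ) * N)
    have e3 : (t : ℝ) - (⌊(t : ℝ) * N⌋₊ : ℝ) / N = ((t : ℝ) * N - ⌊(t : ℝ) * N⌋₊) / N := by
      field_simp
    rw [e3, abs_of_nonneg (div_nonneg (by linarith) hNpos.le), div_lt_iff₀ hNpos]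
    have : 1 < δ * N := by rwa [div_lt_iff₀' hδ] at hNδ
    linarith
  have := @h (⟨x, mem_sphere_zero_iff_norm.2 hx⟩, t)
    (⟨x, mem_sphere_zero_iff_norm.2 hx⟩, gridPoint N ⌊(t : ℝ) * N⌋₊)
    (by rw [Prod.dist_eq, dist_self]; exact max_lt hδ hd)
  rw [dist_eq_norm] at this
  exact this.le

/-- Turns an additive error `ε / K` on the unit sphere of the coordinates into the relative error `ε
‖L x‖`. -/
theorem exists_one_le_mul_norm {d : ℕ} {L : (Fin d → ℝ) →ₗ[ℝ] L1I 𝕜}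
    (hL : Function.Injective L) : ∃ K : ℝ, 0 < K ∧ ∀ x, ‖x‖ = 1 → 1 ≤ K * ‖L x‖ := by
  obtain ⟨K, hK, h⟩ := L.exists_antilipschitzWith (LinearMap.ker_eq_bot.2 hL)
  refine ⟨K, hK, fun x hx => ?_⟩
  have := h.le_mul_dist x 0
  rwa [map_zero, dist_zero_right, dist_zero_right, hx] at this

/-- The linear form `x ↦ re (V (L x) t)`. -/
noncomputable def reForm {d : ℕ} (L : (Fin d → ℝ) →ₗ[ℝ] L1I 𝕜) (t : unitInterval) :
    (Fin d → ℝ) →ₗ[ℝ] ℝ where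
  toFun x := RCLike.re (volterra 𝕜 (L x) t)
  map_add' x y := by simp
  map_smul' c x := by
    rw [map_smul, RCLike.real_smul_eq_coe_smul (K := 𝕜), map_smul, ContinuousMap.smul_apply,
      smul_eq_mul]
    simp

/-- The linear form `x ↦ im (V (L x) t)`. -/
noncomputable def imForm {d : ℕ} (L : (Fin d → ℝ) →ₗ[ℝ] L1I 𝕜) (t : unitInterval) :
    (Fin d → ℝ) →ₗ[ℝ] ℝ where
  toFun x := RCLike.im (volterra 𝕜 (L x) t)
  map_add' x y := by simp
  map_smul' c x := by
    rw [map_smul, RCLike.real_smul_eq_coe_smul (K := 𝕜), map_smul, ContinuousMap.smul_apply,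
      smul_eq_mul]
    simp

/-- Upper estimate for the Volterra operator on a `d`-dimensional space, real scalars. -/
theorem exists_volterra_le_of_real (hI : (RCLike.I : 𝕜) = 0) {d : ℕ} (hd : 1 ≤ d)
    {L : (Fin d → ℝ) →ₗ[ℝ] L1I 𝕜} (hL : Function.Injective L) {ε : ℝ} (hε : 0 < ε) :
    ∃ x ≠ 0, ‖volterra 𝕜 (L x)‖ ≤ (1 / (2 * (d : ℝ) - 1) + ε) * ‖L x‖ := by
  obtain ⟨K, hK, hKx⟩ := exists_one_le_mul_norm hL
  obtain ⟨N, hdN, hN, hgrid⟩ := exists_grid_approx L (div_pos hε hK) d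
  obtain ⟨x, hx, u, hu, hum, hz⟩ := exists_zigzag hd (show d ≤ N + 1 by omega)
    fun i => reForm L (gridPoint N i)
  refine ⟨x, fun h => by simp [h] at hx, ?_⟩
  set y : ℕ → ℝ := fun i => RCLike.re (volterra 𝕜 (L x) (gridPoint N i)) with hy
  set M : ℝ := y (u 0) with hMdef
  have hM : ∀ j < d, M ≤ (-1) ^ j * y (u j) := fun j hj =>
    (le_abs_self _).trans (hz _ (hum 0 hd) j hj)
  have hMi : ∀ i ≤ N, |y i| ≤ M := fun i hi => by
    have := hz i (by omega) 0 hd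
    rw [pow_zero, one_mul] at this
    exact this
  -- The last of the `d` peaks, of index `d - 1`, gives the factor `2 (d - 1) + 1 = 2 d - 1`; the
  -- start is free because the primitive vanishes at `0`.
  have hvar := zigzag_variation hu hM (show d - 1 < d by omega)
  have hy0 : y 0 = 0 := by
    simp only [hy, re_volterra, coe_gridPoint hN (Nat.zero_le _)]
    simp
  have hsum : ∑ i ∈ Finset.range (u (d - 1)), |y (i + 1) - y i| ≤ ‖L x‖ := by
    calc ∑ i ∈ Finset.range (u (d - 1)), |y (i + 1) - y i|
        ≤ ∑ i ∈ Finset.range N, |y (i + 1) - y i| := by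
          refine Finset.sum_le_sum_of_subset_of_nonneg (Finset.range_mono ?_)
            fun _ _ _ => abs_nonneg _
          have := hum (d - 1) (by omega); omega
      _ ≤ ∫ t in (0 : ℝ)..1, |RCLike.re ((L x : ℝ → 𝕜) t)| := by
          simp only [hy, re_volterra]
          exact sum_abs_integral_le (L1I.integrableOn (L x)).re hN
      _ ≤ ‖L x‖ := by
          rw [L1I.norm_eq]
          have h0 : (0 : ℝ) ∈ Set.Icc (0 : ℝ) 1 := ⟨le_rfl, zero_le_one⟩
          have h1 : (1 : ℝ) ∈ Set.Icc (0 : ℝ) 1 := ⟨zero_le_one, le_rfl⟩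
          have hi := L1I.intervalIntegrable_of_mem (L x) h0 h1
          refine intervalIntegral.integral_mono_on zero_le_one ?_ hi.norm
            fun t _ => RCLike.abs_re_le_norm _
          rw [intervalIntegrable_iff] at hi ⊢
          exact Integrable.abs (Integrable.re hi)
  have hcast : ((d - 1 : ℕ) : ℝ) = d - 1 := by rw [Nat.cast_sub hd]; simp
  rw [hy0, abs_zero, zero_add, hcast] at hvar
  have hd' : (1 : ℝ) ≤ d := by exact_mod_cast hd
  have hMle : M ≤ 1 / (2 * (d : ℝ) - 1) * ‖L x‖ := by
    rw [one_div_mul_eq_div, le_div_iff₀ (by linarith)]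
    linarith
  have hC : 0 ≤ 1 / (2 * (d : ℝ) - 1) + ε :=
    add_nonneg (div_nonneg zero_le_one (by linarith)) hε.le
  refine (ContinuousMap.norm_le _ (mul_nonneg hC (norm_nonneg _))).2 fun t => ?_
  obtain ⟨i, hi, hti⟩ := hgrid x hx t
  have h1 : ‖volterra 𝕜 (L x) (gridPoint N i)‖ = |y i| := by
    rw [← RCLike.norm_ofReal (K := 𝕜), hy]
    conv_lhs => rw [← RCLike.re_add_im (volterra 𝕜 (L x) (gridPoint N i)), hI, mul_zero, add_zero]
  have h2 := norm_le_norm_add_norm_sub' (volterra 𝕜 (L x) t) (volterra 𝕜 (L x) (gridPoint N i))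
  have h3 : ε / K ≤ ε * ‖L x‖ := by
    rw [div_le_iff₀ hK, mul_assoc]
    have := hKx x hx
    rw [mul_comm] at this
    exact le_mul_of_one_le_right hε.le this
  have := hMi i hi
  linarith

theorem abs_re_add_abs_im_le (z : 𝕜) : |RCLike.re z| + |RCLike.im z| ≤ √2 * ‖z‖ := by
  refine abs_le_of_sq_le_sq' ?_ (by positivity) |>.2
  rw [mul_pow, Real.sq_sqrt zero_le_two, RCLike.norm_sq_eq_def]
  nlinarith [sq_nonneg (|RCLike.re z| - |RCLike.im z|), sq_abs (RCLike.re z), sq_abs (RCLike.im z)]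

theorem norm_le_sqrt_two_mul {z : 𝕜} {M : ℝ} (h1 : |RCLike.re z| ≤ M) (h2 : |RCLike.im z| ≤ M) :
    ‖z‖ ≤ √2 * M := by
  have hM : 0 ≤ M := (abs_nonneg _).trans h1
  refine abs_le_of_sq_le_sq' ?_ (by positivity) |>.2
  rw [mul_pow, Real.sq_sqrt zero_le_two, RCLike.norm_sq_eq_def]
  have := sq_le_sq' (by linarith [neg_abs_le (RCLike.re z)]) ((le_abs_self _).trans h1)
  have := sq_le_sq' (by linarith [neg_abs_le (RCLike.im z)]) ((le_abs_self _).trans h2)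
  nlinarith

/-- Upper estimate for the Volterra operator on a space of real dimension `d`. -/
theorem exists_volterra_le {d : ℕ} (hd : 2 ≤ d)
    {L : (Fin d → ℝ) →ₗ[ℝ] L1I 𝕜} (hL : Function.Injective L) {ε : ℝ} (hε : 0 < ε) :
    ∃ x ≠ 0, ‖volterra 𝕜 (L x)‖ ≤ (1 / ((d : ℝ) - 1) + ε) * ‖L x‖ := by
  obtain ⟨K, hK, hKx⟩ := exists_one_le_mul_norm hL
  obtain ⟨N, hdN, hN, hgrid⟩ := exists_grid_approx L (div_pos hε hK) d
  -- One list: the real parts along the grid, then the imaginary parts. The imaginary part starts at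
  -- `0`, so the junction costs at most `M`, and `|re| + |im| ≤ √2 |z|` gives `(2 d - 1) M ≤ √2 ‖f‖
  -- + M`. Since the modulus is at most `√2 M` on the grid, the constant becomes `1 / (d - 1)`.
  obtain ⟨x, hx, u, hu, hum, hz⟩ := exists_zigzag (show 1 ≤ d by omega)
    (show d ≤ (N + 1) + (N + 1) by omega)
    fun i => if i < N + 1 then reForm L (gridPoint N i) else imForm L (gridPoint N (i - (N + 1)))
  refine ⟨x, fun h => by simp [h] at hx, ?_⟩
  set F := volterra 𝕜 (L x) with hF
  set y : ℕ → ℝ := fun i => if i < N + 1 then RCLike.re (F (gridPoint N i)) else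
    RCLike.im (F (gridPoint N (i - (N + 1)))) with hy
  have hyφ : ∀ i, (if i < N + 1 then reForm L (gridPoint N i) else
      imForm L (gridPoint N (i - (N + 1)))) x = y i := by
    intro i
    simp only [hy]
    split_ifs <;> rfl
  simp only [hyφ] at hz
  have hre : ∀ i, i ≤ N → y i = RCLike.re (F (gridPoint N i)) := fun i hi =>
    if_pos (Nat.lt_succ_of_le hi)
  have him : ∀ i, y (N + 1 + i) = RCLike.im (F (gridPoint N i)) := fun i => by
    simp only [hy]
    rw [if_neg (by omega), Nat.add_sub_cancel_left]
  set M : ℝ := y (u 0) with hMdef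
  have hM : ∀ j < d, M ≤ (-1) ^ j * y (u j) := fun j hj =>
    (le_abs_self _).trans (hz _ (hum 0 (by omega)) j hj)
  have hMi : ∀ i < (N + 1) + (N + 1), |y i| ≤ M := fun i hi => by
    have := hz i hi 0 (by omega)
    rwa [pow_zero, one_mul] at this
  have hvar := zigzag_variation hu hM (show d - 1 < d by omega)
  have hF0 : F (gridPoint N 0) = 0 := by
    rw [hF, volterra_apply, coe_gridPoint hN (Nat.zero_le _)]
    simp
  have hy0 : y 0 = 0 := by rw [hre 0 (Nat.zero_le _), hF0, map_zero]
  have hyN : y (N + 1) = 0 := by rw [← add_zero (N + 1), him 0, hF0, map_zero]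
  have h0 : (0 : ℝ) ∈ Set.Icc (0 : ℝ) 1 := ⟨le_rfl, zero_le_one⟩
  have h1 : (1 : ℝ) ∈ Set.Icc (0 : ℝ) 1 := ⟨zero_le_one, le_rfl⟩
  have hi := L1I.intervalIntegrable_of_mem (L x) h0 h1
  have hire : IntervalIntegrable (fun t => |RCLike.re ((L x : ℝ → 𝕜) t)|) volume 0 1 := by
    rw [intervalIntegrable_iff] at hi ⊢
    exact Integrable.abs (Integrable.re hi)
  have hiim : IntervalIntegrable (fun t => |RCLike.im ((L x : ℝ → 𝕜) t)|) volume 0 1 := by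
    rw [intervalIntegrable_iff] at hi ⊢
    exact Integrable.abs (Integrable.im hi)
  have hsum : ∑ i ∈ Finset.range (u (d - 1)), |y (i + 1) - y i| ≤ √2 * ‖L x‖ + M := by
    calc ∑ i ∈ Finset.range (u (d - 1)), |y (i + 1) - y i|
        ≤ ∑ i ∈ Finset.range ((N + 1) + N), |y (i + 1) - y i| := by
          refine Finset.sum_le_sum_of_subset_of_nonneg (Finset.range_mono ?_)
            fun _ _ _ => abs_nonneg _
          have := hum (d - 1) (by omega); omega
      _ = ∑ i ∈ Finset.range N, |y (i + 1) - y i| + |y (N + 1) - y N| +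
          ∑ i ∈ Finset.range N, |y (N + 1 + i + 1) - y (N + 1 + i)| := by
          rw [Finset.sum_range_add, Finset.sum_range_succ]
      _ ≤ (∫ t in (0 : ℝ)..1, |RCLike.re ((L x : ℝ → 𝕜) t)|) + M +
          ∫ t in (0 : ℝ)..1, |RCLike.im ((L x : ℝ → 𝕜) t)| := by
          refine add_le_add (add_le_add ?_ ?_) ?_
          · refine le_of_eq_of_le (Finset.sum_congr rfl fun i hi => ?_)
              (sum_abs_integral_le (L1I.integrableOn (L x)).re hN)
            have hi := Finset.mem_range.1 hi
            rw [hre i hi.le, hre (i + 1) hi, hF, re_volterra, re_volterra]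
          · rw [hyN, zero_sub, abs_neg]
            exact hMi N (by omega)
          · refine le_of_eq_of_le (Finset.sum_congr rfl fun i hi => ?_)
              (sum_abs_integral_le (L1I.integrableOn (L x)).im hN)
            rw [him i, add_assoc, him (i + 1), hF, im_volterra, im_volterra]
      _ ≤ √2 * ‖L x‖ + M := by
          have : (∫ t in (0 : ℝ)..1, |RCLike.re ((L x : ℝ → 𝕜) t)|) +
              (∫ t in (0 : ℝ)..1, |RCLike.im ((L x : ℝ → 𝕜) t)|) ≤ √2 * ‖L x‖ := by
            rw [L1I.norm_eq, ← intervalIntegral.integral_add hire hiim,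
              ← intervalIntegral.integral_const_mul]
            exact intervalIntegral.integral_mono_on zero_le_one (hire.add hiim)
              (hi.norm.const_mul _) fun t _ => abs_re_add_abs_im_le _
          linarith
  have hcast : ((d - 1 : ℕ) : ℝ) = d - 1 := by rw [Nat.cast_sub (by omega)]; simp
  rw [hy0, abs_zero, zero_add, hcast] at hvar
  have hd' : (2 : ℝ) ≤ d := by exact_mod_cast hd
  have hMle : √2 * M ≤ 1 / ((d : ℝ) - 1) * ‖L x‖ := by
    rw [one_div_mul_eq_div, le_div_iff₀ (by linarith)]
    have h2 : 2 * ((d : ℝ) - 1) * M ≤ √2 * ‖L x‖ := by linarith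
    have h3 := mul_le_mul_of_nonneg_left h2 (Real.sqrt_nonneg 2)
    rw [← mul_assoc √2 √2, Real.mul_self_sqrt zero_le_two] at h3
    linarith
  have hC : 0 ≤ 1 / ((d : ℝ) - 1) + ε :=
    add_nonneg (div_nonneg zero_le_one (by linarith)) hε.le
  refine (ContinuousMap.norm_le _ (mul_nonneg hC (norm_nonneg _))).2 fun t => ?_
  obtain ⟨i, hiN, hti⟩ := hgrid x hx t
  have h4 : ‖F (gridPoint N i)‖ ≤ √2 * M := by
    refine norm_le_sqrt_two_mul ?_ ?_
    · rw [← hre i hiN]; exact hMi i (by omega)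
    · rw [← him i]; exact hMi _ (by omega)
  have h2 := norm_le_norm_add_norm_sub' (F t) (F (gridPoint N i))
  have h3 : ε / K ≤ ε * ‖L x‖ := by
    rw [div_le_iff₀ hK, mul_assoc]
    have := hKx x hx
    rw [mul_comm] at this
    exact le_mul_of_one_le_right hε.le this
  linarith

end

/-! ### Bernstein numbers, and the Volterra bound on `n`-dimensional subspaces -/

section
variable {𝕜 X Y : Type*} [RCLike 𝕜] [NormedAddCommGroup X] [NormedSpace 𝕜 X]
  [NormedAddCommGroup Y] [NormedSpace 𝕜 Y]

theorem exists_unit_of_ne_zero {T : X →L[𝕜] Y} {E : Submodule 𝕜 X} {c : ℝ} {v : X} (hv : v ∈ E)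
    (h0 : v ≠ 0) (h : ‖T v‖ ≤ c * ‖v‖) : ∃ v ∈ E, ‖v‖ = 1 ∧ ‖T v‖ ≤ c := by
  have hn : 0 < ‖v‖ := norm_pos_iff.2 h0
  refine ⟨((‖v‖⁻¹ : ℝ) : 𝕜) • v, E.smul_mem _ hv, ?_, ?_⟩
  · rw [norm_smul, RCLike.norm_ofReal, abs_of_pos (inv_pos.2 hn), inv_mul_cancel₀ hn.ne']
  · rw [map_smul, norm_smul, RCLike.norm_ofReal, abs_of_pos (inv_pos.2 hn),
      inv_mul_le_iff₀ hn, mul_comm]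
    exact h

/-- The hypothesis `0 ≤ c` covers the case where no subspace has dimension `n`: the real supremum of
an empty family is `0`. -/
theorem bernsteinNumber_le {T : X →L[𝕜] Y} {n : ℕ} {c : ℝ} (hc : 0 ≤ c)
    (h : ∀ E : Submodule 𝕜 X, Module.finrank 𝕜 E = n → ∀ ε : ℝ, 0 < ε →
      ∃ v ∈ E, v ≠ 0 ∧ ‖T v‖ ≤ (c + ε) * ‖v‖) : bernsteinNumber T n ≤ c := by
  refine Real.iSup_le (fun E => ?_) hc
  refine le_of_forall_pos_le_add fun ε hε => ?_
  obtain ⟨v, hv, h0, hle⟩ := h E.1 E.2 ε hε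
  obtain ⟨v, hv, h1, hle⟩ := exists_unit_of_ne_zero hv h0 hle
  refine (ciInf_le ⟨0, ?_⟩ (⟨v, hv, h1⟩ : {v : X // v ∈ E.1 ∧ ‖v‖ = 1})).trans hle
  rintro _ ⟨w, rfl⟩
  exact norm_nonneg _

theorem le_bernsteinNumber {T : X →L[𝕜] Y} {n : ℕ} (hn : 1 ≤ n) {c : ℝ}
    (h : ∀ ε : ℝ, 0 < ε → ∃ E : Submodule 𝕜 X, Module.finrank 𝕜 E = n ∧
      ∀ v ∈ E, (c - ε) * ‖v‖ ≤ ‖T v‖) : c ≤ bernsteinNumber T n := by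
  have hex : ∀ E : Submodule 𝕜 X, Module.finrank 𝕜 E = n → ∃ v ∈ E, ‖v‖ = 1 := by
    intro E hE
    have : Nontrivial E := Module.nontrivial_of_finrank_pos (R := 𝕜) (by omega)
    obtain ⟨v, hv⟩ := exists_ne (0 : E)
    obtain ⟨w, hw, h1, -⟩ := exists_unit_of_ne_zero (T := (0 : X →L[𝕜] Y)) (c := 0) v.2
      (fun h => hv (Subtype.ext h)) (by simp)
    exact ⟨w, hw, h1⟩
  refine le_of_forall_pos_sub_le fun ε hε => ?_
  obtain ⟨E, hE, hle⟩ := h ε hε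
  have hbdd : BddAbove (Set.range fun E : {E : Submodule 𝕜 X // Module.finrank 𝕜 E = n} =>
      ⨅ v : {v : X // v ∈ E.1 ∧ ‖v‖ = 1}, ‖T v‖) := by
    refine ⟨‖T‖, ?_⟩
    rintro _ ⟨E, rfl⟩
    obtain ⟨v, hv, h1⟩ := hex E.1 E.2
    refine (ciInf_le ⟨0, ?_⟩ (⟨v, hv, h1⟩ : {v : X // v ∈ E.1 ∧ ‖v‖ = 1})).trans ?_
    · rintro _ ⟨w, rfl⟩
      exact norm_nonneg _
    · exact T.unit_le_opNorm v h1.le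
  refine le_trans ?_ (le_ciSup hbdd ⟨E, hE⟩)
  obtain ⟨v, hv, h1⟩ := hex E hE
  have : Nonempty {v : X // v ∈ E ∧ ‖v‖ = 1} := ⟨⟨v, hv, h1⟩⟩
  refine le_ciInf fun v => ?_
  have := hle v.1 v.2.1
  rwa [v.2.2, mul_one] at this

theorem exists_submodule_finrank_eq {E : Submodule 𝕜 X} {n : ℕ}
    (h : (n : Cardinal) ≤ Module.rank 𝕜 E) :
    ∃ F ≤ E, Module.finrank 𝕜 F = n := by
  obtain ⟨f, hf⟩ := Module.le_rank_iff_exists_linearMap.1 h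
  refine ⟨LinearMap.range (E.subtype.comp f), ?_, ?_⟩
  · rintro _ ⟨x, rfl⟩
    exact (f x).2
  · rw [LinearMap.finrank_range_of_inj (Subtype.val_injective.comp hf)]
    simp

/-- A space of large dimension, finite or not, contains a subspace of any smaller finite dimension,
so the estimate at one well-chosen `n` is enough. -/
theorem finitelyStrictlySingular_of_tendsto {T : X →L[𝕜] Y} {c : ℕ → ℝ}
    (hc : Filter.Tendsto c Filter.atTop (nhds 0))
    (h : ∀ n, 1 ≤ n → ∀ E : Submodule 𝕜 X, Module.finrank 𝕜 E = n →
      ∃ v ∈ E, v ≠ 0 ∧ ‖T v‖ ≤ c n * ‖v‖) : FinitelyStrictlySingular T := by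
  intro ε hε
  obtain ⟨N, hN⟩ := Filter.eventually_atTop.1 (hc.eventually (gt_mem_nhds hε))
  refine ⟨N + 1, by omega, fun E hE => ?_⟩
  obtain ⟨F, hF, hFn⟩ := exists_submodule_finrank_eq hE.le
  obtain ⟨v, hv, h0, hle⟩ := h (N + 1) (by omega) F hFn
  obtain ⟨v, hv, h1, hle⟩ := exists_unit_of_ne_zero hv h0 hle
  exact ⟨v, hF hv, h1, hle.trans (hN _ (by omega)).le⟩

end

theorem two_le_finrank_real {𝕜 : Type*} [RCLike 𝕜] (hI : (RCLike.I : 𝕜) ≠ 0) :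
    Module.finrank ℝ 𝕜 = 2 := by
  have h := (RCLike.I_eq_zero_or_im_I_eq_one (K := 𝕜)).resolve_left hI
  rw [(RCLike.complexLinearIsometryEquiv h).toLinearEquiv.finrank_eq, Complex.finrank_real_complex]

/-- Every `n`-dimensional subspace of `L¹` contains a vector on which the Volterra operator is
at most `1 / (2 n - 1) + ε`. -/
theorem exists_volterra_le_of_finrank {𝕜 : Type*} [RCLike 𝕜] {E : Submodule 𝕜 (L1I 𝕜)} {n : ℕ}
    (hn : 1 ≤ n) (hE : Module.finrank 𝕜 E = n) {ε : ℝ} (hε : 0 < ε) :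
    ∃ v ∈ E, v ≠ 0 ∧ ‖volterra 𝕜 v‖ ≤ (1 / (2 * (n : ℝ) - 1) + ε) * ‖v‖ := by
  have hfin : FiniteDimensional 𝕜 E := Module.finite_of_finrank_pos (by omega)
  have hfinR : FiniteDimensional ℝ E := FiniteDimensional.trans ℝ 𝕜 E
  set d := Module.finrank ℝ E with hd
  have hdn : d = Module.finrank ℝ 𝕜 * n := by
    rw [hd, ← hE, Module.finrank_mul_finrank]
  let B := Module.finBasis ℝ E
  let L : (Fin d → ℝ) →ₗ[ℝ] L1I 𝕜 :=
    (E.subtype.restrictScalars ℝ).comp (B.equivFun.symm : (Fin d → ℝ) ≃ₗ[ℝ] E).toLinearMap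
  have hL : Function.Injective L := Subtype.val_injective.comp B.equivFun.symm.injective
  have hLE : ∀ x, L x ∈ E := fun x => (B.equivFun.symm x).2
  have hn' : (1 : ℝ) ≤ n := by exact_mod_cast hn
  have key : ∃ x ≠ 0, ‖volterra 𝕜 (L x)‖ ≤ (1 / (2 * (n : ℝ) - 1) + ε) * ‖L x‖ := by
    -- For real scalars `d ≥ n`, and the real estimate applies. Otherwise `d = 2 n`, and `1 / (d -
    -- 1)` is the same constant `1 / (2 n - 1)`.
    by_cases hI : (RCLike.I : 𝕜) = 0
    · have hpos : 0 < Module.finrank ℝ 𝕜 := Module.finrank_pos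
      have hle : n ≤ d := hdn ▸ Nat.le_mul_of_pos_left n hpos
      have hle' : (n : ℝ) ≤ d := by exact_mod_cast hle
      obtain ⟨x, hx, h⟩ := exists_volterra_le_of_real hI (hn.trans hle) hL hε
      refine ⟨x, hx, h.trans (mul_le_mul_of_nonneg_right ?_ (norm_nonneg _))⟩
      have : 1 / (2 * (d : ℝ) - 1) ≤ 1 / (2 * (n : ℝ) - 1) :=
        one_div_le_one_div_of_le (by linarith) (by linarith)
      linarith
    · rw [two_le_finrank_real hI] at hdn
      obtain ⟨x, hx, h⟩ := exists_volterra_le (show 2 ≤ d by omega) hL hε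
      refine ⟨x, hx, ?_⟩
      rwa [show (d : ℝ) = 2 * n by rw [hdn]; push_cast; ring] at h
  obtain ⟨x, hx, h⟩ := key
  exact ⟨L x, hLE x, fun h0 => hx (hL (by rw [h0, map_zero])), h⟩

theorem exists_volterraMuntz_le {𝕜 : Type*} [RCLike 𝕜] {Λ : ℕ → ℝ}
    {E : Submodule 𝕜 (muntzSpace 𝕜 Λ)} {n : ℕ} (hn : 1 ≤ n) (hE : Module.finrank 𝕜 E = n) {ε : ℝ}
    (hε : 0 < ε) :
    ∃ v ∈ E, v ≠ 0 ∧ ‖volterraMuntz 𝕜 Λ v‖ ≤ (1 / (2 * (n : ℝ) - 1) + ε) * ‖v‖ := by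
  have h1 : Module.finrank 𝕜 (E.map (muntzSpace 𝕜 Λ).subtype) = n := by
    rw [← hE]
    exact (Submodule.equivMapOfInjective _ (muntzSpace 𝕜 Λ).injective_subtype E).finrank_eq.symm
  obtain ⟨v, hv, h0, h⟩ := exists_volterra_le_of_finrank hn h1 hε
  obtain ⟨w, hw, rfl⟩ := hv
  exact ⟨w, hw, fun h => h0 (by rw [h]; rfl), h⟩

theorem one_div_two_mul_sub_one_le {n : ℕ} (hn : 1 ≤ n) :
    1 / (2 * (n : ℝ) - 1) ≤ 1 / (n : ℝ) := by
  have hn' : (1 : ℝ) ≤ n := by exact_mod_cast hn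
  exact one_div_le_one_div_of_le (by linarith) (by linarith)

/-! ### Lower estimate: lacunary powers -/

section
variable {𝕜 : Type*} [RCLike 𝕜]

/-- The `i`-th sum is, up to `η ∑ ‖aⱼ‖`, the partial sum `a₀ + ⋯ + aᵢ`. If all partial sums are at
most `D`, then `‖a₀‖ ≤ D` and each of the `n - 1` other coefficients, being a difference of two of
them, is at most `2 D`: the total is `(2 n - 1) D`. -/
theorem sum_norm_le_of_partialSums {n : ℕ} (hn : 1 ≤ n) {a : ℕ → 𝕜} {c : ℕ → ℕ → ℝ} {η B : ℝ}
    (hc1 : ∀ i < n, ∀ j < n, j ≤ i → |c i j - 1| ≤ η)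
    (hc0 : ∀ i < n, ∀ j < n, i < j → |c i j| ≤ η)
    (hB : ∀ i < n, ‖∑ j ∈ Finset.range n, a j * (c i j : 𝕜)‖ ≤ B) :
    ∑ j ∈ Finset.range n, ‖a j‖ ≤
      (2 * (n : ℝ) - 1) * (B + η * ∑ j ∈ Finset.range n, ‖a j‖) := by
  set A := ∑ j ∈ Finset.range n, ‖a j‖ with hA
  set D := B + η * A with hD
  have hs : ∀ i < n, ‖∑ j ∈ Finset.range (i + 1), a j‖ ≤ D := by
    intro i hi
    have e1 : ∑ j ∈ Finset.range (i + 1), a j =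
        ∑ j ∈ Finset.range n, a j * ((if j ≤ i then 1 else 0 : ℝ) : 𝕜) := by
      rw [← Finset.sum_subset (Finset.range_mono (show i + 1 ≤ n from hi))
        (f := fun j => a j * ((if j ≤ i then 1 else 0 : ℝ) : 𝕜))]
      · refine Finset.sum_congr rfl fun j hj => ?_
        rw [if_pos (by have := Finset.mem_range.1 hj; omega)]
        simp
      · intro j _ hj
        rw [if_neg (by simpa [Nat.lt_succ_iff] using hj)]
        simp
    have e2 : ∑ j ∈ Finset.range (i + 1), a j = ∑ j ∈ Finset.range n, a j * (c i j : 𝕜) -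
        ∑ j ∈ Finset.range n, a j * ((c i j - (if j ≤ i then 1 else 0) : ℝ) : 𝕜) := by
      rw [e1, ← Finset.sum_sub_distrib]
      refine Finset.sum_congr rfl fun j _ => ?_
      push_cast
      ring
    rw [e2]
    refine (norm_sub_le _ _).trans (add_le_add (hB i hi) ?_)
    refine (norm_sum_le _ _).trans ?_
    rw [hA, Finset.mul_sum]
    refine Finset.sum_le_sum fun j hj => ?_
    rw [norm_mul, RCLike.norm_ofReal, mul_comm]
    refine mul_le_mul_of_nonneg_right ?_ (norm_nonneg _)
    have hj := Finset.mem_range.1 hj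
    split_ifs with h
    · exact hc1 i hi j hj h
    · rw [sub_zero]; exact hc0 i hi j hj (not_le.1 h)
  obtain ⟨m, rfl⟩ : ∃ m, n = m + 1 := ⟨n - 1, by omega⟩
  have h0 := hs 0 (by omega)
  rw [zero_add, Finset.sum_range_one] at h0
  have hsucc : ∀ j < m, ‖a (j + 1)‖ ≤ 2 * D := by
    intro j hj
    have e : a (j + 1) = ∑ l ∈ Finset.range (j + 1 + 1), a l - ∑ l ∈ Finset.range (j + 1), a l := by
      rw [Finset.sum_range_succ _ (j + 1)]; ring
    rw [e]
    refine (norm_sub_le _ _).trans ?_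
    have := hs (j + 1) (by omega)
    have := hs j (by omega)
    linarith
  calc A = ∑ j ∈ Finset.range m, ‖a (j + 1)‖ + ‖a 0‖ := by rw [hA, Finset.sum_range_succ']
    _ ≤ ∑ j ∈ Finset.range m, 2 * D + D :=
      add_le_add (Finset.sum_le_sum fun j hj => hsucc j (Finset.mem_range.1 hj)) h0
    _ = (2 * ((m + 1 : ℕ) : ℝ) - 1) * D := by
      rw [Finset.sum_const, Finset.card_range, nsmul_eq_mul]; push_cast; ring

theorem tendsto_atTop_of_summable_inv {Λ : ℕ → ℝ} (hmono : StrictMono Λ) (hnonneg : ∀ k, 0 ≤ Λ k)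
    (hM : Summable fun k => 1 / Λ k) : Filter.Tendsto Λ Filter.atTop Filter.atTop := by
  have h0 := hM.tendsto_atTop_zero
  have h1 : Filter.Tendsto (fun k => 1 / Λ k) Filter.atTop (nhdsWithin 0 (Set.Ioi 0)) := by
    refine tendsto_nhdsWithin_iff.2 ⟨h0, Filter.eventually_atTop.2 ⟨1, fun k hk => ?_⟩⟩
    have : 0 < Λ k := (hnonneg 0).trans_lt (hmono (by omega))
    exact one_div_pos.2 this
  refine h1.inv_tendsto_nhdsGT_zero.congr fun k => ?_
  simp

theorem exists_lacunary {Λ : ℕ → ℝ} (hΛ : Filter.Tendsto Λ Filter.atTop Filter.atTop) (R : ℝ) :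
    ∃ k : ℕ → ℕ, ∀ i, R * (Λ (k i) + 1) ≤ Λ (k (i + 1)) + 1 := by
  have h : ∀ a, ∃ b, R * (Λ a + 1) ≤ Λ b + 1 := by
    intro a
    obtain ⟨b, hb⟩ := (hΛ.eventually_ge_atTop (R * (Λ a + 1))).exists
    exact ⟨b, by linarith⟩
  choose s hs using h
  exact ⟨fun i => s^[i] 0, fun i => by simp only [Function.iterate_succ_apply']; exact hs _⟩

/-- Points at which lacunary powers are either close to `1` or close to `0`. -/
theorem exists_separating_points {η : ℝ} (h0 : 0 < η) (h1 : η < 1) :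
    ∃ R : ℝ, 1 ≤ R ∧ ∀ μ : ℕ → ℝ, (∀ i, 1 ≤ μ i) → (∀ i, R * μ i ≤ μ (i + 1)) →
      ∃ x : ℕ → ℝ, (∀ i, x i ∈ Set.Ioo (0 : ℝ) 1) ∧ (∀ i j, j ≤ i → |x i ^ μ j - 1| ≤ η) ∧
        ∀ i j, i < j → |x i ^ μ j| ≤ η := by
  obtain ⟨N, hN⟩ := exists_pow_lt_of_lt_one h0 (show 1 - η < 1 by linarith)
  refine ⟨max 1 N, le_max_left _ _, fun μ hμ hR => ?_⟩
  have hpos : ∀ i, 0 < μ i := fun i => zero_lt_one.trans_le (hμ i)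
  have hbase : 0 < 1 - η := by linarith
  have hmono : Monotone μ := monotone_nat_of_le_succ fun i =>
    (le_mul_of_one_le_left (hpos i).le (le_max_left _ _)).trans (hR i)
  have hpow : ∀ i j, ((1 - η) ^ (1 / μ i)) ^ μ j = (1 - η) ^ (μ j / μ i) := by
    intro i j
    rw [← Real.rpow_mul hbase.le]
    congr 1
    ring
  -- The point is chosen so that `x i ^ μ i = 1 - η`. Smaller exponents give values in `[1 - η, 1]`,
  -- and exponents at least `N` times larger give at most `(1 - η) ^ N < η`.
  refine ⟨fun i => (1 - η) ^ (1 / μ i), fun i => ⟨Real.rpow_pos_of_pos hbase _,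
    Real.rpow_lt_one hbase.le (by linarith) (one_div_pos.2 (hpos i))⟩, fun i j hj => ?_,
    fun i j hij => ?_⟩
  · rw [hpow]
    have hle : μ j / μ i ≤ 1 := (div_le_one (hpos i)).2 (hmono hj)
    have e1 : (1 - η) ^ (1 : ℝ) ≤ (1 - η) ^ (μ j / μ i) :=
      Real.rpow_le_rpow_of_exponent_ge hbase (by linarith) hle
    have e2 : (1 - η) ^ (μ j / μ i) ≤ 1 :=
      Real.rpow_le_one hbase.le (by linarith) (div_nonneg (hpos j).le (hpos i).le)
    rw [Real.rpow_one] at e1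
    rw [abs_le]; constructor <;> linarith
  · rw [hpow, abs_of_nonneg (Real.rpow_nonneg hbase.le _)]
    have hle : (N : ℝ) ≤ μ j / μ i := by
      rw [le_div_iff₀ (hpos i)]
      calc (N : ℝ) * μ i ≤ max 1 (N : ℝ) * μ i :=
            mul_le_mul_of_nonneg_right (le_max_right _ _) (hpos i).le
        _ ≤ μ (i + 1) := hR i
        _ ≤ μ j := hmono hij
    refine (Real.rpow_le_rpow_of_exponent_ge hbase (by linarith) hle).trans ?_
    rw [Real.rpow_natCast]
    exact hN.le

theorem continuous_rpow_ofReal {s : ℝ} (hs : 0 ≤ s) :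
    Continuous fun x : ℝ => ((x ^ s : ℝ) : 𝕜) :=
  RCLike.continuous_ofReal.comp (Real.continuous_rpow_const hs)

theorem integrableOn_rpow_ofReal {s : ℝ} (hs : 0 ≤ s) :
    Integrable (fun x : ℝ => ((x ^ s : ℝ) : 𝕜)) (volume.restrict (Set.Icc (0 : ℝ) 1)) :=
  (continuous_rpow_ofReal hs).continuousOn.integrableOn_compact isCompact_Icc

variable (𝕜) in
/-- The normalized power `(s + 1) x ^ s` in `L¹`. -/
noncomputable def unitPower (s : ℝ) (hs : 0 ≤ s) : L1I 𝕜 :=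
  ((s + 1 : ℝ) : 𝕜) • (integrableOn_rpow_ofReal (𝕜 := 𝕜) hs).toL1 _

theorem unitPower_mem {Λ : ℕ → ℝ} (k : ℕ) (hk : 0 ≤ Λ k) : unitPower 𝕜 (Λ k) hk ∈ muntzSpace 𝕜 Λ :=
  Submodule.smul_mem _ _ (Submodule.le_topologicalClosure _
    (Submodule.subset_span ⟨k, Integrable.coeFn_toL1 _⟩))

theorem coeFn_unitPower (s : ℝ) (hs : 0 ≤ s) :
    (unitPower 𝕜 s hs : ℝ → 𝕜) =ᵐ[volume.restrict (Set.Icc (0 : ℝ) 1)]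
      fun x => (((s + 1) * x ^ s : ℝ) : 𝕜) := by
  filter_upwards [Lp.coeFn_smul ((s + 1 : ℝ) : 𝕜) ((integrableOn_rpow_ofReal (𝕜 := 𝕜) hs).toL1 _),
    (integrableOn_rpow_ofReal (𝕜 := 𝕜) hs).coeFn_toL1] with x h1 h2
  rw [unitPower, h1, Pi.smul_apply, h2, smul_eq_mul]
  push_cast
  rfl

theorem integral_mul_rpow {s x : ℝ} (hs : 0 ≤ s) :
    ∫ t in (0 : ℝ)..x, (s + 1) * t ^ s = x ^ (s + 1) := by
  rw [intervalIntegral.integral_const_mul, integral_rpow (Or.inl (by linarith)),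
    Real.zero_rpow (by linarith)]
  field_simp
  ring

theorem volterra_unitPower (s : ℝ) (hs : 0 ≤ s) (x : unitInterval) :
    volterra 𝕜 (unitPower 𝕜 s hs) x = (((x : ℝ) ^ (s + 1) : ℝ) : 𝕜) := by
  rw [volterra_apply, L1I.integral_congr (coeFn_unitPower s hs), ← integral_mul_rpow hs]
  exact (RCLike.ofRealCLM (K := 𝕜)).intervalIntegral_comp_comm
    ((continuous_const.mul (Real.continuous_rpow_const hs)).intervalIntegrable _ _)

theorem norm_unitPower (s : ℝ) (hs : 0 ≤ s) : ‖unitPower 𝕜 s hs‖ = 1 := by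
  rw [L1.norm_eq_integral_norm]
  have h : ∫ x in Set.Icc (0 : ℝ) 1, ‖(unitPower 𝕜 s hs : ℝ → 𝕜) x‖ =
      ∫ x in Set.Icc (0 : ℝ) 1, (s + 1) * x ^ s := by
    refine integral_congr_ae ?_
    filter_upwards [coeFn_unitPower (𝕜 := 𝕜) s hs, ae_restrict_mem measurableSet_Icc] with x h1 h2
    rw [h1, RCLike.norm_ofReal, abs_of_nonneg (mul_nonneg (by linarith) (Real.rpow_nonneg h2.1 _))]
  rw [h, integral_Icc_eq_integral_Ioc, ← intervalIntegral.integral_of_le zero_le_one,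
    integral_mul_rpow hs, Real.one_rpow]

/-- Lower estimate for the Volterra operator on the span of lacunary powers. -/
theorem exists_le_volterraMuntz (𝕜 : Type*) [RCLike 𝕜] {Λ : ℕ → ℝ} (hmono : StrictMono Λ)
    (hnonneg : ∀ k, 0 ≤ Λ k) (hM : Summable fun k => 1 / Λ k) {n : ℕ} (hn : 1 ≤ n) {ε : ℝ}
    (hε : 0 < ε) : ∃ E : Submodule 𝕜 (muntzSpace 𝕜 Λ), Module.finrank 𝕜 E = n ∧
      ∀ v ∈ E, (1 / (2 * (n : ℝ) - 1) - ε) * ‖v‖ ≤ ‖volterraMuntz 𝕜 Λ v‖ := by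
  have hn' : (1 : ℝ) ≤ n := by exact_mod_cast hn
  have hc : 0 < 1 / (2 * (n : ℝ) - 1) := one_div_pos.2 (by linarith)
  have hc1 : 1 / (2 * (n : ℝ) - 1) ≤ 1 := by rw [div_le_one (by linarith)]; linarith
  set c := 1 / (2 * (n : ℝ) - 1) with hcdef
  -- The inequality `A ≤ (2 n - 1) (B + η A)` rearranges to `(c - η) A ≤ B`. The bound `η ≤ c / 2`
  -- keeps `c - η` positive, so that the same estimate yields linear independence.
  set η := min ε (c / 2) with hη
  have hη0 : 0 < η := lt_min hε (by linarith)
  have hη1 : η ≤ c / 2 := min_le_right _ _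
  obtain ⟨R, hR1, hR⟩ := exists_separating_points hη0 (by linarith)
  obtain ⟨k, hk⟩ := exists_lacunary (tendsto_atTop_of_summable_inv hmono hnonneg hM) R
  obtain ⟨x, hx, hx1, hx0⟩ := hR (fun i => Λ (k i) + 1) (fun i => by linarith [hnonneg (k i)]) hk
  let e : Fin n → muntzSpace 𝕜 Λ := fun j =>
    ⟨unitPower 𝕜 (Λ (k j)) (hnonneg _), unitPower_mem _ (hnonneg _)⟩
  have hest : ∀ g : Fin n → 𝕜, (c - η) * ∑ j, ‖g j‖ ≤ ‖volterraMuntz 𝕜 Λ (∑ j, g j • e j)‖ := by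
    intro g
    set B := ‖volterraMuntz 𝕜 Λ (∑ j, g j • e j)‖ with hB
    set a : ℕ → 𝕜 := fun j => if h : j < n then g ⟨j, h⟩ else 0 with ha
    have hag : ∀ j : Fin n, a j = g j := fun j => by simp [ha]
    have hval : ∀ y : unitInterval, volterraMuntz 𝕜 Λ (∑ j, g j • e j) y =
        ∑ j ∈ Finset.range n, a j * (((y : ℝ) ^ (Λ (k j) + 1) : ℝ) : 𝕜) := by
      intro y
      rw [map_sum, ContinuousMap.sum_apply, ← Fin.sum_univ_eq_sum_range
        (fun j => a j * (((y : ℝ) ^ (Λ (k j) + 1) : ℝ) : 𝕜))]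
      refine Finset.sum_congr rfl fun j _ => ?_
      rw [map_smul, ContinuousMap.smul_apply, smul_eq_mul, hag]
      congr 1
      exact volterra_unitPower _ (hnonneg _) _
    have h := sum_norm_le_of_partialSums hn (a := a) (c := fun i j => x i ^ (Λ (k j) + 1))
      (η := η) (B := B) (fun i _ j _ hj => hx1 i j hj) (fun i _ j _ hj => hx0 i j hj)
      (fun i _ => by
        have := hval ⟨x i, (hx i).1.le, (hx i).2.le⟩
        rw [← this]
        exact ContinuousMap.norm_coe_le_norm _ _)
    have hA : ∑ j ∈ Finset.range n, ‖a j‖ = ∑ j, ‖g j‖ := by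
      rw [← Fin.sum_univ_eq_sum_range (fun j => ‖a j‖)]
      exact Finset.sum_congr rfl fun j _ => by rw [hag]
    rw [hA, ← div_le_iff₀' (by linarith), ← one_div_mul_eq_div, ← hcdef] at h
    linarith
  have hcη : 0 < c - η := by linarith
  have hli : LinearIndependent 𝕜 e := by
    rw [Fintype.linearIndependent_iff]
    intro g hg i
    have := hest g
    rw [hg, map_zero, norm_zero] at this
    have hs : ∑ j, ‖g j‖ ≤ 0 := by
      by_contra hh
      have := mul_pos hcη (not_le.1 hh)
      linarith
    have := (Finset.single_le_sum (fun j _ => norm_nonneg (g j)) (Finset.mem_univ i)).trans hs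
    exact norm_le_zero_iff.1 this
  refine ⟨Submodule.span 𝕜 (Set.range e), by rw [finrank_span_eq_card hli, Fintype.card_fin], ?_⟩
  intro v hv
  obtain ⟨g, rfl⟩ := (Submodule.mem_span_range_iff_exists_fun 𝕜).1 hv
  refine le_trans ?_ (hest g)
  have hnorm : ‖∑ j, g j • e j‖ ≤ ∑ j, ‖g j‖ := by
    refine (norm_sum_le _ _).trans (Finset.sum_le_sum fun j _ => ?_)
    rw [norm_smul]
    have : ‖e j‖ = 1 := norm_unitPower _ (hnonneg _)
    rw [this, mul_one]
  calc (c - ε) * ‖∑ j, g j • e j‖ ≤ (c - η) * ‖∑ j, g j • e j‖ :=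
        mul_le_mul_of_nonneg_right (by linarith [min_le_left ε (c / 2)]) (norm_nonneg _)
    _ ≤ (c - η) * ∑ j, ‖g j‖ := mul_le_mul_of_nonneg_left hnorm hcη.le

end

/-! ### Exponentials as imaginary parts of ray integrals -/

/-- The direction `-1 + i` of the integration ray. -/
noncomputable def rayDir : ℂ := -1 + Complex.I

theorem normSq_rayDir_mul_add (r ν : ℝ) :
    ‖rayDir * r + ν‖ ^ 2 = (ν - r) ^ 2 + r ^ 2 := by
  rw [← Complex.normSq_eq_norm_sq, Complex.normSq_apply]
  simp [rayDir]
  ring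

theorem half_le_norm_rayDir_mul_add (r ν : ℝ) : ν / 2 ≤ ‖rayDir * r + ν‖ := by
  refine abs_le_of_sq_le_sq' ?_ (norm_nonneg _) |>.2
  rw [normSq_rayDir_mul_add]
  nlinarith [sq_nonneg (ν - 2 * r)]

theorem rayDir_mul_add_ne_zero (r : ℝ) {ν : ℝ} (hν : 0 < ν) : rayDir * r + ν ≠ 0 := by
  rw [← norm_pos_iff]
  linarith [half_le_norm_rayDir_mul_add r ν]

theorem norm_rayDir_le : ‖rayDir‖ ≤ 2 := by
  refine (norm_add_le _ _).trans ?_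
  simp; norm_num

theorem norm_exp_ray (r s : ℝ) : ‖Complex.exp (rayDir * r * s)‖ = Real.exp (-(s * r)) := by
  rw [Complex.norm_exp]
  congr 1
  simp [rayDir]
  ring

theorem integrableOn_exp_ray {s : ℝ} (hs : 0 < s) :
    IntegrableOn (fun r : ℝ => Real.exp (-(s * r))) (Set.Ioi 0) := by
  simpa using integrableOn_exp_mul_Ioi (a := -s) (by linarith) 0

theorem integrableOn_mul_exp_ray {s : ℝ} (hs : 0 < s) :
    IntegrableOn (fun r : ℝ => r * Real.exp (-(s * r))) (Set.Ioi 0) := by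
  refine Integrable.mono' (g := fun r => 2 / s * Real.exp (-(s / 2 * r)))
    ((integrableOn_exp_ray (half_pos hs)).const_mul _)
    (Measurable.aestronglyMeasurable (by fun_prop)) ?_
  filter_upwards [ae_restrict_mem measurableSet_Ioi] with r hr
  have hr : (0 : ℝ) < r := hr
  rw [Real.norm_eq_abs, abs_of_nonneg (by positivity)]
  have h1 : s / 2 * r ≤ Real.exp (s / 2 * r) := by linarith [Real.add_one_le_exp (s / 2 * r)]
  have h2 : r ≤ 2 / s * Real.exp (s / 2 * r) := by
    rw [div_mul_eq_mul_div, le_div_iff₀ hs]; linarith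
  calc r * Real.exp (-(s * r)) ≤ 2 / s * Real.exp (s / 2 * r) * Real.exp (-(s * r)) :=
        mul_le_mul_of_nonneg_right h2 (Real.exp_pos _).le
    _ = 2 / s * Real.exp (-(s / 2 * r)) := by
        rw [mul_assoc, ← Real.exp_add]; congr 2; ring

theorem integrableOn_ray_of_bound {f : ℝ → ℂ} (hf : Measurable f) {s C : ℝ} (hs : 0 < s)
    (h : ∀ r > 0, ‖f r‖ ≤ C * Real.exp (-(s * r))) : IntegrableOn f (Set.Ioi 0) := by
  refine Integrable.mono' ((integrableOn_exp_ray hs).const_mul C) hf.aestronglyMeasurable ?_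
  filter_upwards [ae_restrict_mem measurableSet_Ioi] with r hr
  exact h r hr

theorem integrableOn_ray_kernel {ν s : ℝ} (hν : 0 < ν) (hs : 0 < s) :
    IntegrableOn (fun r : ℝ => rayDir * Complex.exp (rayDir * r * s) / (rayDir * r + ν))
      (Set.Ioi 0) := by
  refine integrableOn_ray_of_bound (by fun_prop) hs (C := 2 / (ν / 2)) fun r _ => ?_
  rw [norm_div, norm_mul, norm_exp_ray, div_mul_eq_mul_div]
  exact div_le_div₀ (by positivity) (mul_le_mul_of_nonneg_right norm_rayDir_le (Real.exp_pos _).le)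
    (by positivity) (half_le_norm_rayDir_mul_add r ν)

theorem integrableOn_ray_exp {s : ℝ} (hs : 0 < s) :
    IntegrableOn (fun r : ℝ => rayDir * Complex.exp (rayDir * r * s)) (Set.Ioi 0) := by
  refine integrableOn_ray_of_bound (by fun_prop) hs (C := 2) fun r _ => ?_
  rw [norm_mul, norm_exp_ray]
  exact mul_le_mul_of_nonneg_right norm_rayDir_le (Real.exp_pos _).le

theorem integral_ray_exp {s : ℝ} (hs : 0 < s) :
    ∫ r in Set.Ioi (0 : ℝ), rayDir * Complex.exp (rayDir * r * s) = -(1 / s : ℝ) := by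
  have h := integral_exp_mul_complex_Ioi (a := rayDir * s) (by simp [rayDir, hs]) 0
  have hr : rayDir ≠ 0 := fun h0 => by
    have := congrArg Complex.im h0
    simp [rayDir] at this
  have hs' : (s : ℂ) ≠ 0 := by exact_mod_cast hs.ne'
  rw [integral_const_mul]
  have : ∀ r : ℝ, rayDir * r * s = rayDir * s * r := fun r => by ring
  simp_rw [this, h]
  simp
  field_simp

/-- `∫₀^∞ ω e^{ω r s} / (ω r + ν) dr` along the ray of direction `ω = -1 + i`. -/
noncomputable def rayIntegral (ν s : ℝ) : ℂ :=
  ∫ r in Set.Ioi (0 : ℝ), rayDir * Complex.exp (rayDir * r * s) / (rayDir * r + ν)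

/-- Write `ω r / (ω r + ν) = 1 - ν / (ω r + ν)`. The first term integrates to `-1 / s`, which is
real, so for imaginary parts the extra factor `ω r` acts as multiplication by `-ν`. -/
theorem rayIntegral_moment {ν s : ℝ} (hν : 0 < ν) (hs : 0 < s) :
    ∫ r in Set.Ioi (0 : ℝ), rayDir ^ 2 * r * Complex.exp (rayDir * r * s) / (rayDir * r + ν) =
      -(1 / s : ℝ) - ν * rayIntegral ν s := by
  rw [rayIntegral, ← integral_ray_exp hs, ← integral_const_mul, ← integral_sub
    (integrableOn_ray_exp hs) ((integrableOn_ray_kernel hν hs).const_mul _)]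
  refine integral_congr_ae (Filter.Eventually.of_forall fun r => ?_)
  have := rayDir_mul_add_ne_zero r hν
  simp only
  field_simp
  ring

theorem rayIntegral_scale {ν : ℝ} (hν : 0 < ν) (s : ℝ) :
    rayIntegral ν s = rayIntegral 1 (ν * s) := by
  have h := integral_comp_mul_left_Ioi
    (fun r : ℝ => rayDir * Complex.exp (rayDir * r * s) / (rayDir * r + ν)) 0 hν
  rw [mul_zero] at h
  have h2 : rayIntegral ν s = ν • ∫ r in Set.Ioi (0 : ℝ),
      rayDir * Complex.exp (rayDir * (ν * r : ℝ) * s) / (rayDir * (ν * r : ℝ) + ν) := by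
    rw [h, smul_smul, mul_inv_cancel₀ hν.ne', one_smul]
    rfl
  rw [h2, rayIntegral, ← integral_smul]
  refine integral_congr_ae (Filter.Eventually.of_forall fun r => ?_)
  simp only
  have h3 := rayDir_mul_add_ne_zero r one_pos
  have h4 := rayDir_mul_add_ne_zero (ν * r) hν
  have e1 : rayDir * r * (ν * s : ℝ) = rayDir * (ν * r : ℝ) * s := by push_cast; ring
  have e2 : rayDir * (ν * r : ℝ) + ν = ν * (rayDir * r + (1 : ℝ)) := by push_cast; ring
  have hν' : (ν : ℂ) ≠ 0 := by exact_mod_cast hν.ne'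
  rw [e1, e2, Complex.real_smul]
  field_simp

/-- Differentiation under the integral sign brings down `ω r`, which produces the moment integral.
-/
theorem hasDerivAt_rayIntegral {s : ℝ} (hs : 0 < s) :
    HasDerivAt (rayIntegral 1) (-(1 / s : ℝ) - rayIntegral 1 s) s := by
  have hm := rayIntegral_moment one_pos hs
  rw [Complex.ofReal_one, one_mul] at hm
  rw [← hm]
  have hb : ∀ r > (0 : ℝ), ∀ x ∈ Set.Ioi (s / 2),
      ‖rayDir ^ 2 * r * Complex.exp (rayDir * r * x) / (rayDir * r + (1 : ℝ))‖ ≤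
        8 * (r * Real.exp (-(s / 2 * r))) := by
    intro r hr x hx
    rw [norm_div, norm_mul, norm_mul, norm_pow, norm_exp_ray, Complex.norm_real, Real.norm_eq_abs,
      abs_of_pos hr, div_le_iff₀ (norm_pos_iff.2 (rayDir_mul_add_ne_zero r one_pos))]
    have e1 : ‖rayDir‖ ^ 2 ≤ 4 := by nlinarith [norm_rayDir_le, norm_nonneg rayDir]
    have e2 : Real.exp (-(x * r)) ≤ Real.exp (-(s / 2 * r)) := by
      rw [Real.exp_le_exp, neg_le_neg_iff]
      exact mul_le_mul_of_nonneg_right (le_of_lt hx) hr.le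
    have e3 := half_le_norm_rayDir_mul_add r 1
    have e4 : 0 ≤ r * Real.exp (-(s / 2 * r)) := by positivity
    calc ‖rayDir‖ ^ 2 * r * Real.exp (-(x * r)) ≤ 4 * r * Real.exp (-(s / 2 * r)) := by gcongr
      _ = 8 * (r * Real.exp (-(s / 2 * r))) * (1 / 2) := by ring
      _ ≤ _ := mul_le_mul_of_nonneg_left e3 (by positivity)
  have h := hasDerivAt_integral_of_dominated_loc_of_deriv_le
    (μ := volume.restrict (Set.Ioi (0 : ℝ)))
    (F := fun (x r : ℝ) => rayDir * Complex.exp (rayDir * r * x) / (rayDir * r + (1 : ℝ)))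
    (F' := fun (x r : ℝ) =>
      rayDir ^ 2 * r * Complex.exp (rayDir * r * x) / (rayDir * r + (1 : ℝ)))
    (x₀ := s) (s := Set.Ioi (s / 2)) (bound := fun r => 8 * (r * Real.exp (-(s / 2 * r))))
    (Ioi_mem_nhds (by linarith))
    (Filter.Eventually.of_forall fun x => Measurable.aestronglyMeasurable (by fun_prop))
    (integrableOn_ray_kernel one_pos hs)
    (Measurable.aestronglyMeasurable (by fun_prop))
    (by
      filter_upwards [ae_restrict_mem measurableSet_Ioi] with r hr
      exact hb r hr)
    ((integrableOn_mul_exp_ray (by linarith)).const_mul 8)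
    (Filter.Eventually.of_forall fun r x _ => by
      have h1 : HasDerivAt (fun x : ℝ => rayDir * r * (x : ℂ)) (rayDir * r) x := by
        simpa using (Complex.ofRealCLM.hasDerivAt (x := x)).const_mul (rayDir * (r : ℂ))
      have h2 := (h1.cexp.const_mul rayDir).div_const (rayDir * r + (1 : ℝ))
      refine h2.congr_deriv ?_
      ring)
  exact h.2

/-- Since `1 / s` is real, the imaginary part solves `y' = -y`. This replaces a residue computation
at the pole `-1`; only the sign of the constant is needed afterwards. -/
theorem rayIntegral_im_eq {s : ℝ} (hs : 0 < s) :
    (rayIntegral 1 s).im = ((rayIntegral 1 1).im * Real.exp 1) * Real.exp (-s) := by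
  set h : ℝ → ℝ := fun s => (rayIntegral 1 s).im * Real.exp s with hh
  have hd : ∀ x > 0, HasDerivAt h 0 x := by
    intro x hx
    have h1 : HasDerivAt (fun s => (rayIntegral 1 s).im) (- (rayIntegral 1 x).im) x := by
      have := Complex.imCLM.hasFDerivAt.comp_hasDerivAt x (hasDerivAt_rayIntegral hx)
      refine this.congr_deriv ?_
      simp
    refine (h1.mul (Real.hasDerivAt_exp x)).congr_deriv ?_
    ring
  have hconst : h s = h 1 := by
    refine isOpen_Ioi.is_const_of_deriv_eq_zero (s := Set.Ioi (0 : ℝ)) isPreconnected_Ioi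
      (fun x hx => (hd x hx).differentiableAt.differentiableWithinAt) (fun x hx => (hd x hx).deriv)
      hs (Set.mem_Ioi.2 one_pos)
  have : (rayIntegral 1 s).im = h s * Real.exp (-s) := by
    rw [hh]; simp only; rw [mul_assoc, ← Real.exp_add]; simp
  rw [this, hconst]

/-- Fubini for the Laplace transform at `1`: the `τ`-integral is `1 / (1 - ω r)`, and `ω² = -2 i`
turns `(1 + ω r)(1 - ω r)` into `1 + 2 i r²`. -/
theorem integral_exp_neg_mul_rayIntegral :
    IntegrableOn (fun τ : ℝ => (Real.exp (-τ) : ℂ) * rayIntegral 1 τ) (Set.Ioi 0) ∧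
    ∫ τ in Set.Ioi (0 : ℝ), (Real.exp (-τ) : ℂ) * rayIntegral 1 τ =
      ∫ r in Set.Ioi (0 : ℝ), rayDir / (1 + 2 * Complex.I * r ^ 2) := by
  set f : ℝ → ℝ → ℂ := fun τ r => (Real.exp (-τ) : ℂ) *
    (rayDir * Complex.exp (rayDir * r * τ) / (rayDir * r + (1 : ℝ))) with hf
  have hnorm : ∀ τ r : ℝ, ‖f τ r‖ = ‖rayDir‖ / ‖rayDir * r + (1 : ℝ)‖ *
      Real.exp (-((1 + r) * τ)) := by
    intro τ r
    rw [hf]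
    simp only
    rw [norm_mul, norm_div, norm_mul, norm_exp_ray, Complex.norm_real, Real.norm_eq_abs,
      abs_of_pos (Real.exp_pos _), show -((1 + r) * τ) = -τ + -(τ * r) by ring, Real.exp_add]
    ring
  have hmeas : Measurable (Function.uncurry f) := by
    rw [hf]; unfold Function.uncurry; fun_prop
  have hint : Integrable (Function.uncurry f)
      ((volume.restrict (Set.Ioi (0 : ℝ))).prod (volume.restrict (Set.Ioi (0 : ℝ)))) := by
    rw [integrable_prod_iff' hmeas.aestronglyMeasurable]
    constructor
    · filter_upwards [ae_restrict_mem measurableSet_Ioi] with r hr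
      have hr : (0 : ℝ) < r := hr
      refine integrableOn_ray_of_bound (s := 1 + r) (C := ‖rayDir‖ / ‖rayDir * r + (1 : ℝ)‖)
        (hmeas.comp (measurable_id.prodMk measurable_const)) (by linarith) fun τ _ => ?_
      exact (hnorm τ r).le
    · have hle : ∀ r > (0 : ℝ), ∫ τ in Set.Ioi (0 : ℝ), ‖Function.uncurry f (τ, r)‖ =
          ‖rayDir‖ / ‖rayDir * r + (1 : ℝ)‖ * (1 / (1 + r)) := by
        intro r hr
        simp only [Function.uncurry_apply_pair, hnorm]
        rw [integral_const_mul]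
        congr 1
        have := integral_exp_mul_Ioi (a := -(1 + r)) (by linarith) 0
        simp only [neg_mul] at this
        rw [this, mul_zero, neg_zero, Real.exp_zero, neg_div_neg_eq]
      refine Integrable.mono' (g := fun r : ℝ => 6 * (1 + r ^ 2)⁻¹)
        (integrable_inv_one_add_sq.const_mul 6).restrict ?_ ?_
      · exact (hmeas.norm.stronglyMeasurable.integral_prod_left').aestronglyMeasurable
      · filter_upwards [ae_restrict_mem measurableSet_Ioi] with r hr
        have hr : (0 : ℝ) < r := hr
        rw [hle r hr, Real.norm_eq_abs, abs_of_nonneg (by positivity)]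
        have h5 : (1 + r) / 3 ≤ ‖rayDir * r + (1 : ℝ)‖ := by
          refine abs_le_of_sq_le_sq' ?_ (norm_nonneg _) |>.2
          rw [normSq_rayDir_mul_add]
          nlinarith [sq_nonneg (3 * r - 2)]
        calc ‖rayDir‖ / ‖rayDir * r + (1 : ℝ)‖ * (1 / (1 + r))
            ≤ 2 / ((1 + r) / 3) * (1 / (1 + r)) := by
              gcongr
              exact norm_rayDir_le
          _ = 6 * ((1 + r) ^ 2)⁻¹ := by field_simp; ring
          _ ≤ 6 * (1 + r ^ 2)⁻¹ := by
              gcongr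
              nlinarith
  have hswap := integral_integral_swap hint
  have h1 : ∀ τ : ℝ, ∫ r in Set.Ioi (0 : ℝ), f τ r = (Real.exp (-τ) : ℂ) * rayIntegral 1 τ := by
    intro τ
    rw [hf]; simp only
    rw [integral_const_mul]
    rfl
  simp_rw [h1] at hswap
  have hleft := hint.integral_prod_left
  simp only [Function.uncurry_apply_pair, h1] at hleft
  refine ⟨hleft, ?_⟩
  rw [hswap]
  refine setIntegral_congr_fun measurableSet_Ioi fun r hr => ?_
  have hr : (0 : ℝ) < r := hr
  have h2 : ∀ τ : ℝ, f τ r = rayDir / (rayDir * r + (1 : ℝ)) *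
      Complex.exp ((rayDir * r - 1) * τ) := by
    intro τ
    rw [hf]; simp only
    rw [show (rayDir * r - 1) * (τ : ℂ) = ((-τ : ℝ) : ℂ) + rayDir * r * τ by push_cast; ring,
      Complex.exp_add, Complex.ofReal_exp]
    ring
  simp_rw [h2]
  rw [integral_const_mul, integral_exp_mul_complex_Ioi (by simp [rayDir]; linarith)]
  have h3 := rayDir_mul_add_ne_zero r one_pos
  have hsq : rayDir ^ 2 = -2 * Complex.I := by
    rw [rayDir]; ring_nf; rw [Complex.I_sq]; ring
  have h4 : rayDir * r - 1 ≠ 0 := by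
    intro h0
    have := congrArg Complex.re h0
    simp [rayDir] at this
    linarith
  have h5 : 1 + 2 * Complex.I * r ^ 2 = -((rayDir * r + (1 : ℝ)) * (rayDir * r - 1)) := by
    push_cast
    linear_combination (r : ℂ) ^ 2 * hsq
  rw [h5]
  simp
  field_simp

/-- The right side of the Laplace identity has integrand with positive imaginary part, while the
left side is the unknown constant times the integral of a positive function. -/
theorem rayIntegral_im_pos : 0 < (rayIntegral 1 1).im := by
  obtain ⟨hint, heq⟩ := integral_exp_neg_mul_rayIntegral
  have him : ∀ r : ℝ, (rayDir / (1 + 2 * Complex.I * r ^ 2)).im =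
      (1 + 2 * r ^ 2) / (1 + 4 * r ^ 4) := by
    intro r
    have h : (1 + 2 * Complex.I * r ^ 2 : ℂ) = ⟨1, 2 * r ^ 2⟩ := by
      apply Complex.ext <;> simp [← Complex.ofReal_pow]
    rw [h, Complex.div_im, Complex.normSq_apply]
    simp [rayDir]
    ring
  have hint2 : IntegrableOn (fun r : ℝ => rayDir / (1 + 2 * Complex.I * r ^ 2)) (Set.Ioi 0) := by
    refine Integrable.mono' (g := fun r : ℝ => 4 * (1 + r ^ 2)⁻¹)
      (integrable_inv_one_add_sq.const_mul 4).restrict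
      (Measurable.aestronglyMeasurable (by fun_prop)) (Filter.Eventually.of_forall fun r => ?_)
    have h5 : (1 + r ^ 2) / 2 ≤ ‖(1 + 2 * Complex.I * r ^ 2 : ℂ)‖ := by
      refine abs_le_of_sq_le_sq' ?_ (norm_nonneg _) |>.2
      rw [← Complex.normSq_eq_norm_sq, Complex.normSq_apply]
      simp [← Complex.ofReal_pow]
      nlinarith [sq_nonneg (r ^ 2 - 1)]
    rw [norm_div]
    calc ‖rayDir‖ / ‖(1 + 2 * Complex.I * r ^ 2 : ℂ)‖ ≤ 2 / ((1 + r ^ 2) / 2) :=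
          div_le_div₀ (by positivity) norm_rayDir_le (by positivity) h5
      _ = 4 * (1 + r ^ 2)⁻¹ := by field_simp; norm_num
  have e1 := integral_im hint
  have e2 := integral_im hint2
  rw [heq, ← e2] at e1
  simp only [RCLike.im_to_complex, him] at e1
  have hpos : 0 < ∫ r in Set.Ioi (0 : ℝ), (1 + 2 * r ^ 2) / (1 + 4 * r ^ 4) := by
    rw [integral_pos_iff_support_of_nonneg (fun r => by positivity)]
    · have : Function.support (fun r : ℝ => (1 + 2 * r ^ 2) / (1 + 4 * r ^ 4)) = Set.univ := by
        ext r
        simp only [Function.mem_support, Set.mem_univ, iff_true]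
        positivity
      rw [this]
      simp
    · have := Integrable.im hint2
      simp only [RCLike.im_to_complex, him] at this
      exact this
  rw [← e1] at hpos
  have e3 : ∫ τ in Set.Ioi (0 : ℝ), ((Real.exp (-τ) : ℂ) * rayIntegral 1 τ).im =
      (rayIntegral 1 1).im * (Real.exp 1 * ∫ τ in Set.Ioi (0 : ℝ), Real.exp (-τ) * Real.exp (-τ)) := by
    rw [← integral_const_mul, ← integral_const_mul]
    refine setIntegral_congr_fun measurableSet_Ioi fun τ hτ => ?_
    simp only [Complex.im_ofReal_mul]
    rw [rayIntegral_im_eq hτ]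
    ring
  rw [e3] at hpos
  have hI : 0 ≤ Real.exp 1 * ∫ τ in Set.Ioi (0 : ℝ), Real.exp (-τ) * Real.exp (-τ) :=
    mul_nonneg (Real.exp_pos _).le (integral_nonneg fun τ => by positivity)
  by_contra hneg
  exact absurd hpos (not_lt.2 (mul_nonpos_of_nonpos_of_nonneg (not_lt.1 hneg) hI))

/-- The positive constant in the representation of exponentials by ray integrals. -/
theorem exists_ray_representation : ∃ c : ℝ, 0 < c ∧ ∀ ν s : ℝ, 0 < ν → 0 < s →
    (∫ r in Set.Ioi (0 : ℝ), rayDir * Complex.exp (rayDir * r * s) / (rayDir * r + ν)).im =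
      c * Real.exp (-(ν * s)) ∧
    (∫ r in Set.Ioi (0 : ℝ), rayDir ^ 2 * r * Complex.exp (rayDir * r * s) /
      (rayDir * r + ν)).im = -(ν * (c * Real.exp (-(ν * s)))) := by
  refine ⟨(rayIntegral 1 1).im * Real.exp 1, mul_pos rayIntegral_im_pos (Real.exp_pos _),
    fun ν s hν hs => ?_⟩
  have h : (rayIntegral ν s).im = (rayIntegral 1 1).im * Real.exp 1 * Real.exp (-(ν * s)) := by
    rw [rayIntegral_scale hν, rayIntegral_im_eq (mul_pos hν hs)]
  refine ⟨h, ?_⟩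
  rw [rayIntegral_moment hν hs, Complex.sub_im, Complex.im_ofReal_mul, h]
  simp

/-! ### Mellin transforms, Blaschke products and exponential sums -/

/-- The generalized polynomial `∑ aₖ x ^ λₖ`. -/
noncomputable def powerSum (l : ℕ → ℝ) (S : Finset ℕ) (a : ℕ → ℝ) (x : ℝ) : ℝ :=
  ∑ k ∈ S, a k * x ^ l k

/-- The `L¹` norm on `[0,1]` of the generalized polynomial `∑ aₖ x ^ λₖ`. -/
noncomputable def powerSumNorm (l : ℕ → ℝ) (S : Finset ℕ) (a : ℕ → ℝ) : ℝ :=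
  ∫ x in (0 : ℝ)..1, |powerSum l S a x|

theorem powerSumNorm_nonneg (l : ℕ → ℝ) (S : Finset ℕ) (a : ℕ → ℝ) : 0 ≤ powerSumNorm l S a :=
  intervalIntegral.integral_nonneg zero_le_one fun _ _ => abs_nonneg _

/-- The sum is the Mellin integral of `x^(i y) p(x)` over `[0, 1]`, and `|x^(i y)| = 1`. -/
theorem norm_mellin_le {l : ℕ → ℝ} (hl : ∀ k, 0 ≤ l k) (S : Finset ℕ) (a : ℕ → ℝ) (y : ℝ) :
    ‖∑ k ∈ S, (a k : ℂ) / (y * Complex.I + (l k + 1 : ℝ))‖ ≤ powerSumNorm l S a := by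
  have hre : ∀ k, -1 < (y * Complex.I + l k : ℂ).re := fun k => by simp; linarith [hl k]
  have h1 : ∑ k ∈ S, (a k : ℂ) / (y * Complex.I + (l k + 1 : ℝ)) =
      ∫ x in (0 : ℝ)..1, ∑ k ∈ S, (a k : ℂ) * (x : ℂ) ^ (y * Complex.I + l k : ℂ) := by
    rw [intervalIntegral.integral_finsetSum]
    · refine Finset.sum_congr rfl fun k _ => ?_
      rw [intervalIntegral.integral_const_mul, integral_cpow (Or.inl (hre k))]
      have hne : (y * Complex.I + l k + 1 : ℂ) ≠ 0 := fun h => by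
        have := congrArg Complex.re h
        simp at this
        linarith [hl k]
      rw [Complex.ofReal_one, Complex.one_cpow, Complex.ofReal_zero, Complex.zero_cpow hne]
      push_cast
      rw [sub_zero, mul_one_div, add_assoc]
    · intro k _
      exact (intervalIntegral.intervalIntegrable_cpow' (hre k)).const_mul _
  rw [h1, powerSumNorm]
  refine (intervalIntegral.norm_integral_le_integral_norm zero_le_one).trans_eq ?_
  refine intervalIntegral.integral_congr_ae (Filter.Eventually.of_forall fun x hx => ?_)
  rw [Set.uIoc_of_le zero_le_one] at hx
  have hx0 : (x : ℂ) ≠ 0 := by exact_mod_cast hx.1.ne'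
  have h2 : ∑ k ∈ S, (a k : ℂ) * (x : ℂ) ^ (y * Complex.I + l k : ℂ) =
      (x : ℂ) ^ (y * Complex.I : ℂ) * (powerSum l S a x : ℝ) := by
    rw [powerSum, Complex.ofReal_sum, Finset.mul_sum]
    refine Finset.sum_congr rfl fun k _ => ?_
    rw [Complex.cpow_add _ _ hx0, Complex.ofReal_mul, Complex.ofReal_cpow hx.1.le]
    ring
  rw [h2, norm_mul, Complex.norm_cpow_eq_rpow_re_of_pos hx.1, Complex.norm_real, Real.norm_eq_abs]
  simp

/-- The Mellin transform of a generalized polynomial times a Blaschke product, reflected. -/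
noncomputable def blaschkeMellin (μ : ℕ → ℝ) (S : Finset ℕ) (a : ℕ → ℝ) (w : ℂ) : ℂ :=
  ∑ k ∈ S, (a k : ℂ) * (-1 / (w + μ k)) * ∏ j ∈ S.erase k, (w - μ j) / (w + μ j)

theorem add_ofReal_ne_zero {w : ℂ} (hw : 0 ≤ w.re) {μ : ℝ} (hμ : 0 < μ) : w + μ ≠ 0 := fun h => by
  have := congrArg Complex.re h
  simp at this
  linarith

theorem norm_sub_div_add_le_one {w : ℂ} (hw : 0 ≤ w.re) {μ : ℝ} (hμ : 0 < μ) :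
    ‖(w - μ) / (w + μ)‖ ≤ 1 := by
  rw [norm_div, div_le_one (norm_pos_iff.2 (add_ofReal_ne_zero hw hμ))]
  refine abs_le_of_sq_le_sq' ?_ (norm_nonneg _) |>.2
  rw [← Complex.normSq_eq_norm_sq, ← Complex.normSq_eq_norm_sq, Complex.normSq_apply,
    Complex.normSq_apply]
  simp
  nlinarith

/-- Away from the poles the definition is the reflected Mellin transform times the full Blaschke
product; in the definition the zero at `μ k` has already cancelled the pole of the `k`-th term. -/
theorem blaschkeMellin_eq {μ : ℕ → ℝ} (hμ : ∀ k, 0 < μ k) (S : Finset ℕ) (a : ℕ → ℝ) {w : ℂ}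
    (hw : 0 ≤ w.re) (hne : ∀ k, w ≠ μ k) :
    blaschkeMellin μ S a w =
      (∑ k ∈ S, (a k : ℂ) / (-w + μ k)) * ∏ j ∈ S, (w - μ j) / (w + μ j) := by
  rw [blaschkeMellin, Finset.sum_mul]
  refine Finset.sum_congr rfl fun k hk => ?_
  rw [← Finset.mul_prod_erase S _ hk, ← mul_assoc]
  congr 1
  have h1 := add_ofReal_ne_zero hw (hμ k)
  have h2 : -w + μ k ≠ 0 := fun h => hne k (by linear_combination -h)
  have h3 : w - μ k = -(-w + μ k) := by ring
  rw [h3]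
  field_simp

theorem norm_blaschkeMellin_le_sum {μ : ℕ → ℝ} (hμ : ∀ k, 0 < μ k) (S : Finset ℕ) (a : ℕ → ℝ)
    {w : ℂ} (hw : 0 ≤ w.re) : ‖blaschkeMellin μ S a w‖ ≤ ∑ k ∈ S, |a k| * (1 / μ k) := by
  refine (norm_sum_le _ _).trans (Finset.sum_le_sum fun k _ => ?_)
  rw [norm_mul, norm_mul, Complex.norm_real, Real.norm_eq_abs, norm_prod]
  have h1 : ∏ j ∈ S.erase k, ‖(w - μ j) / (w + μ j)‖ ≤ 1 :=
    Finset.prod_le_one (fun _ _ => norm_nonneg _) fun j _ => norm_sub_div_add_le_one hw (hμ j)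
  have h2 : ‖-1 / (w + μ k)‖ ≤ 1 / μ k := by
    rw [norm_div, norm_neg, norm_one]
    refine one_div_le_one_div_of_le (hμ k) ?_
    have := Complex.re_le_norm (w + μ k)
    simp at this
    linarith
  calc |a k| * ‖-1 / (w + μ k)‖ * ∏ j ∈ S.erase k, ‖(w - μ j) / (w + μ j)‖
      ≤ |a k| * ‖-1 / (w + μ k)‖ * 1 := mul_le_mul_of_nonneg_left h1 (by positivity)
    _ ≤ |a k| * (1 / μ k) := by
      rw [mul_one]; exact mul_le_mul_of_nonneg_left h2 (abs_nonneg _)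

/-- Maximum principle in the half plane. -/
theorem norm_blaschkeMellin_le {l : ℕ → ℝ} (hl : ∀ k, 0 ≤ l k) (S : Finset ℕ) (a : ℕ → ℝ)
    {w : ℂ} (hw : 0 ≤ w.re) :
    ‖blaschkeMellin (fun k => l k + 1) S a w‖ ≤ powerSumNorm l S a := by
  have hμ : ∀ k, 0 < l k + 1 := fun k => by linarith [hl k]
  have hdiff : ∀ z : ℂ, 0 ≤ z.re →
      DifferentiableAt ℂ (blaschkeMellin (fun k => l k + 1) S a) z := by
    intro z hz
    unfold blaschkeMellin
    refine DifferentiableAt.fun_sum fun k _ => ?_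
    refine DifferentiableAt.mul (DifferentiableAt.mul (differentiableAt_const _) ?_) ?_
    · exact (differentiableAt_const _).div (differentiableAt_id.add_const _)
        (add_ofReal_ne_zero hz (hμ k))
    · refine DifferentiableAt.fun_finsetProd fun j _ => ?_
      exact (differentiableAt_id.sub_const _).div (differentiableAt_id.add_const _)
        (add_ofReal_ne_zero hz (hμ j))
  have hbound : ∀ z : ℂ, 0 ≤ z.re → ‖blaschkeMellin (fun k => l k + 1) S a z‖ ≤ _ :=
    fun z hz => norm_blaschkeMellin_le_sum hμ S a hz
  -- The crude bound by `∑ |a k| / μ k` supplies the growth hypotheses. The bound by the `L¹` norm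
  -- is needed only on the imaginary axis, where the Blaschke factors have modulus `1`.
  refine PhragmenLindelof.right_half_plane_of_bounded_on_real ?_ ?_ ?_ ?_ hw
  · refine DifferentiableOn.diffContOnCl fun z hz => ?_
    rw [Complex.closure_setOfPred_lt_re] at hz
    exact (hdiff z hz).differentiableWithinAt
  · refine ⟨1, by norm_num, 0, ?_⟩
    refine Asymptotics.IsBigO.of_bound (∑ k ∈ S, |a k| * (1 / (l k + 1))) ?_
    rw [Filter.eventually_inf_principal]
    refine Filter.Eventually.of_forall fun z hz => ?_
    simpa using hbound z (le_of_lt hz)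
  · refine ⟨∑ k ∈ S, |a k| * (1 / (l k + 1)), ?_⟩
    rw [Filter.eventually_map]
    filter_upwards [Filter.eventually_ge_atTop 0] with x hx
    exact hbound x (by simpa using hx)
  · intro y
    have hre : (0 : ℝ) ≤ (y * Complex.I : ℂ).re := by simp
    rw [blaschkeMellin_eq hμ S a hre, norm_mul, norm_prod]
    · have h1 : ∏ j ∈ S, ‖(y * Complex.I - (l j + 1 : ℝ)) / (y * Complex.I + (l j + 1 : ℝ))‖ = 1 := by
        refine Finset.prod_eq_one fun j _ => ?_
        rw [norm_div, div_eq_one_iff_eq (norm_ne_zero_iff.2 (add_ofReal_ne_zero hre (hμ j)))]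
        rw [← sq_eq_sq₀ (norm_nonneg _) (norm_nonneg _), ← Complex.normSq_eq_norm_sq,
          ← Complex.normSq_eq_norm_sq, Complex.normSq_apply, Complex.normSq_apply]
        simp
        ring
      rw [h1, mul_one]
      have := norm_mellin_le hl S a (-y)
      simpa [neg_mul] using this
    · intro k h
      have := congrArg Complex.re h
      simp at this
      linarith [hl k]

/-- Divide the maximum principle by the Blaschke product: the transform is controlled in the
half-plane of its poles, at the price of the inverse product. -/
theorem norm_mellin_neg_le {l : ℕ → ℝ} (hl : ∀ k, 0 ≤ l k) (S : Finset ℕ) (a : ℕ → ℝ)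
    {w : ℂ} (hw : 0 ≤ w.re) (hne : ∀ k, w ≠ (l k + 1 : ℝ)) :
    ‖∑ k ∈ S, (a k : ℂ) / (-w + (l k + 1 : ℝ))‖ ≤ powerSumNorm l S a *
      ∏ j ∈ S, (‖w + (l j + 1 : ℝ)‖ / ‖w - (l j + 1 : ℝ)‖) := by
  have hμ : ∀ k, 0 < l k + 1 := fun k => by linarith [hl k]
  have h := norm_blaschkeMellin_le hl S a hw
  rw [blaschkeMellin_eq hμ S a hw hne, norm_mul, norm_prod] at h
  have hpos : ∀ j, 0 < ‖w - (l j + 1 : ℝ)‖ := fun j => norm_pos_iff.2 (sub_ne_zero.2 (hne j))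
  have hpos' : ∀ j, 0 < ‖w + (l j + 1 : ℝ)‖ := fun j =>
    norm_pos_iff.2 (add_ofReal_ne_zero hw (hμ j))
  set P := ∏ j ∈ S, (‖w + (l j + 1 : ℝ)‖ / ‖w - (l j + 1 : ℝ)‖) with hP
  have hPP : (∏ j ∈ S, ‖(w - (l j + 1 : ℝ)) / (w + (l j + 1 : ℝ))‖) * P = 1 := by
    rw [hP, ← Finset.prod_mul_distrib]
    refine Finset.prod_eq_one fun j _ => ?_
    have := (hpos j).ne'; have := (hpos' j).ne'
    rw [norm_div]
    field_simp
  have hP0 : 0 ≤ P := Finset.prod_nonneg fun j _ => by positivity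
  calc ‖∑ k ∈ S, (a k : ℂ) / (-w + (l k + 1 : ℝ))‖
      = ‖∑ k ∈ S, (a k : ℂ) / (-w + (l k + 1 : ℝ))‖ *
        (∏ j ∈ S, ‖(w - (l j + 1 : ℝ)) / (w + (l j + 1 : ℝ))‖) * P := by
        rw [mul_assoc, hPP, mul_one]
    _ ≤ _ := mul_le_mul_of_nonneg_right h hP0

/-- At `w = l i + 1` every term but the `i`-th contains a vanishing Blaschke factor, so the value
there isolates `a i`. -/
theorem abs_coeff_le {l : ℕ → ℝ} (hl : ∀ k, 0 ≤ l k) (hinj : Function.Injective l) (S : Finset ℕ)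
    (a : ℕ → ℝ) {i : ℕ} (hi : i ∈ S) : |a i| ≤ powerSumNorm l S a * (2 * (l i + 1)) *
      ∏ j ∈ S.erase i, (|l i + l j + 2| / |l i - l j|) := by
  have hμ : ∀ k, 0 < l k + 1 := fun k => by linarith [hl k]
  have h := norm_blaschkeMellin_le hl S a (w := (l i + 1 : ℝ)) (by simpa using (hμ i).le)
  have h2 : blaschkeMellin (fun k => l k + 1) S a (l i + 1 : ℝ) =
      (a i * (-1 / (2 * (l i + 1))) * ∏ j ∈ S.erase i, ((l i - l j) / (l i + l j + 2)) : ℝ) := by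
    rw [blaschkeMellin, Finset.sum_eq_single_of_mem i hi]
    · push_cast
      congr 1
      · congr 2; ring
      · refine Finset.prod_congr rfl fun j _ => ?_
        congr 1 <;> ring
    · intro k hk hki
      rw [Finset.prod_eq_zero (Finset.mem_erase.2 ⟨hki.symm, hi⟩), mul_zero]
      simp
  rw [h2, Complex.norm_real, Real.norm_eq_abs, abs_mul, abs_mul, Finset.abs_prod, abs_div, abs_neg,
    abs_one, abs_of_pos (show 0 < 2 * (l i + 1) by linarith [hμ i])] at h
  set P := ∏ j ∈ S.erase i, (|l i + l j + 2| / |l i - l j|) with hP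
  have hPP : (∏ j ∈ S.erase i, |(l i - l j) / (l i + l j + 2)|) * P = 1 := by
    rw [hP, ← Finset.prod_mul_distrib]
    refine Finset.prod_eq_one fun j hj => ?_
    have h1 : |l i - l j| ≠ 0 := abs_ne_zero.2 (sub_ne_zero.2 fun h =>
      (Finset.mem_erase.1 hj).1 (hinj h).symm)
    have h2 : |l i + l j + 2| ≠ 0 := abs_ne_zero.2 (by linarith [hl i, hl j])
    rw [abs_div]
    field_simp
  have hP0 : 0 ≤ P := Finset.prod_nonneg fun j _ => by positivity
  have hc : 0 < 2 * (l i + 1) := by linarith [hμ i]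
  calc |a i| = |a i| * (1 / (2 * (l i + 1))) *
        (∏ j ∈ S.erase i, |(l i - l j) / (l i + l j + 2)|) * (2 * (l i + 1)) * P := by
        have e : ∀ x q d : ℝ, d ≠ 0 → q * P = 1 → x = x * (1 / d) * q * d * P := by
          intro x q d hd hq
          have : x * (1 / d) * q * d * P = x * (d * (1 / d)) * (q * P) := by ring
          rw [this, hq, mul_one_div_cancel hd]; ring
        exact e _ _ _ hc.ne' hPP
    _ ≤ _ := mul_le_mul_of_nonneg_right (mul_le_mul_of_nonneg_right h hc.le) hP0

/-- The Blaschke quotients along the ray grow slower than any exponential. -/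
theorem exists_blaschke_ray_bound {ν : ℕ → ℝ} {b δ : ℝ} (hb : 0 ≤ b) (hδ : 0 < δ)
    (hν : ∀ k, δ ≤ ν k) (hsum : Summable fun k => 1 / ν k) {η : ℝ} (hη : 0 < η) :
    ∃ C : ℝ, 0 < C ∧ ∀ (S : Finset ℕ) (r : ℝ), 0 ≤ r →
      ∏ j ∈ S, (‖-(rayDir * r) + (ν j + 2 * b : ℝ)‖ / ‖rayDir * r + ν j‖) ≤
        C * Real.exp (η * r) := by
  set κ := 1 + b / δ with hκ
  have hκ1 : 1 ≤ κ := by rw [hκ]; have := div_nonneg hb hδ.le; linarith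
  set R := 1 + 4 * κ * (2 * b / δ + 2) with hR
  have hR1 : 1 ≤ R := by rw [hR]; have := div_nonneg hb hδ.le; nlinarith [mul_div_assoc 2 b δ]
  have hνpos : ∀ k, 0 < ν k := fun k => hδ.trans_le (hν k)
  have hμ : ∀ k, ν k + b ≤ κ * ν k := by
    intro k
    have : b = b / δ * δ := by field_simp
    have h2 : b / δ * δ ≤ b / δ * ν k := mul_le_mul_of_nonneg_left (hν k) (div_nonneg hb hδ.le)
    rw [hκ]; linarith
  -- This is `|w + μ|² / |w - μ|² = 1 + 4 (re w) μ / |w - μ|²` with `w = b - ω r` and `μ = ν k + b`.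
  have hsq : ∀ k (r : ℝ), (‖-(rayDir * r) + (ν k + 2 * b : ℝ)‖ / ‖rayDir * r + ν k‖) ^ 2 =
      1 + 4 * ((b + r) * (ν k + b)) / ((ν k - r) ^ 2 + r ^ 2) := by
    intro k r
    have hnum : ‖-(rayDir * r) + (ν k + 2 * b : ℝ)‖ ^ 2 = (ν k + 2 * b + r) ^ 2 + r ^ 2 := by
      rw [← Complex.normSq_eq_norm_sq, Complex.normSq_apply]
      simp [rayDir]
      ring
    have hden : (ν k - r) ^ 2 + r ^ 2 ≠ 0 := by
      have := hνpos k
      nlinarith [sq_nonneg (ν k - 2 * r)]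
    rw [div_pow, hnum, normSq_rayDir_mul_add]
    field_simp
    ring
  have hle1 : ∀ k (r : ℝ), 0 ≤ r →
      ‖-(rayDir * r) + (ν k + 2 * b : ℝ)‖ / ‖rayDir * r + ν k‖ ≤
        Real.exp (4 * κ * (b + r) * (1 / ν k)) := by
    intro k r hr
    have hk := hνpos k
    refine abs_le_of_sq_le_sq' ?_ (Real.exp_pos _).le |>.2
    rw [hsq, ← Real.exp_nat_mul]
    have hden : ν k ^ 2 / 2 ≤ (ν k - r) ^ 2 + r ^ 2 := by nlinarith [sq_nonneg (ν k - 2 * r)]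
    have h1 : 4 * ((b + r) * (ν k + b)) / ((ν k - r) ^ 2 + r ^ 2) ≤
        4 * ((b + r) * (κ * ν k)) / (ν k ^ 2 / 2) := by
      refine div_le_div₀ (by positivity) ?_ (by positivity) hden
      have := mul_le_mul_of_nonneg_left (hμ k) (add_nonneg hb hr)
      linarith
    have h2 : 4 * ((b + r) * (κ * ν k)) / (ν k ^ 2 / 2) =
        ((2 : ℕ) : ℝ) * (4 * κ * (b + r) * (1 / ν k)) := by
      field_simp
      push_cast
      ring
    rw [h2] at h1
    linarith [Real.add_one_le_exp (((2 : ℕ) : ℝ) * (4 * κ * (b + r) * (1 / ν k)))]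
  have hle2 : ∀ k (r : ℝ), 0 ≤ r →
      ‖-(rayDir * r) + (ν k + 2 * b : ℝ)‖ / ‖rayDir * r + ν k‖ ≤ R := by
    intro k r hr
    have hk := hνpos k
    refine abs_le_of_sq_le_sq' ?_ (by linarith) |>.2
    rw [hsq]
    have hden : ν k ^ 2 / 2 ≤ (ν k - r) ^ 2 + r ^ 2 := by nlinarith [sq_nonneg (ν k - 2 * r)]
    have hden2 : r * ν k / 2 ≤ (ν k - r) ^ 2 + r ^ 2 := by
      nlinarith [sq_nonneg (ν k - 5 / 4 * r)]
    have hdpos : 0 < (ν k - r) ^ 2 + r ^ 2 := by nlinarith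
    have h1 : 4 * ((b + r) * (ν k + b)) / ((ν k - r) ^ 2 + r ^ 2) ≤ 4 * κ * (2 * b / δ + 2) := by
      rw [div_le_iff₀ hdpos]
      have e1 := mul_le_mul_of_nonneg_left (hμ k) (add_nonneg hb hr)
      have e2 : b * ν k ≤ 2 * b / δ * ((ν k - r) ^ 2 + r ^ 2) := by
        have : b * ν k ≤ b / δ * ν k ^ 2 := by
          rw [div_mul_eq_mul_div, le_div_iff₀ hδ]
          have := mul_le_mul_of_nonneg_left (hν k) (mul_nonneg hb hk.le)
          nlinarith
        have h3 := mul_le_mul_of_nonneg_left hden (div_nonneg (mul_nonneg zero_le_two hb) hδ.le)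
        have : 2 * b / δ * (ν k ^ 2 / 2) = b / δ * ν k ^ 2 := by ring
        linarith
      have e3 : (b + r) * ν k ≤ (2 * b / δ + 2) * ((ν k - r) ^ 2 + r ^ 2) := by linarith
      have e4 := mul_le_mul_of_nonneg_left e3 (show 0 ≤ 4 * κ by linarith)
      calc 4 * ((b + r) * (ν k + b)) ≤ 4 * ((b + r) * (κ * ν k)) := by linarith
        _ = 4 * κ * ((b + r) * ν k) := by ring
        _ ≤ _ := by rw [mul_assoc (4 * κ)]; exact e4
    have : 1 + 4 * ((b + r) * (ν k + b)) / ((ν k - r) ^ 2 + r ^ 2) ≤ R := by rw [hR]; linarith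
    nlinarith
  have hη' : 0 < η / (4 * κ) := by positivity
  -- The uniform bound `R` is spent on the finitely many factors in `s`; outside `s` the sum of the
  -- `1 / ν k` is so small that the exponential bounds multiply to at most `exp (η (b + r))`.
  obtain ⟨s, hs⟩ := summable_iff_vanishing_norm.1 hsum _ hη'
  refine ⟨R ^ s.card * Real.exp (η * b), by positivity, fun S r hr => ?_⟩
  rw [← Finset.prod_filter_mul_prod_filter_not S (· ∈ s), mul_assoc, ← Real.exp_add]
  have hnn : ∀ j, 0 ≤ ‖-(rayDir * r) + (ν j + 2 * b : ℝ)‖ / ‖rayDir * r + ν j‖ := fun j => by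
    positivity
  refine mul_le_mul ?_ ?_ (Finset.prod_nonneg fun j _ => hnn j) (by positivity)
  · calc ∏ j ∈ S.filter (· ∈ s), ‖-(rayDir * r) + (ν j + 2 * b : ℝ)‖ / ‖rayDir * r + ν j‖
        ≤ ∏ j ∈ S.filter (· ∈ s), R :=
          Finset.prod_le_prod (fun j _ => hnn j) fun j _ => hle2 j r hr
      _ = R ^ (S.filter (· ∈ s)).card := by rw [Finset.prod_const]
      _ ≤ R ^ s.card := pow_le_pow_right₀ hR1
          (Finset.card_le_card fun j hj => (Finset.mem_filter.1 hj).2)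
  · calc ∏ j ∈ S.filter (· ∉ s), ‖-(rayDir * r) + (ν j + 2 * b : ℝ)‖ / ‖rayDir * r + ν j‖
        ≤ ∏ j ∈ S.filter (· ∉ s), Real.exp (4 * κ * (b + r) * (1 / ν j)) :=
          Finset.prod_le_prod (fun j _ => hnn j) fun j _ => hle1 j r hr
      _ = Real.exp (4 * κ * (b + r) * ∑ j ∈ S.filter (· ∉ s), 1 / ν j) := by
          rw [← Real.exp_sum, Finset.mul_sum]
      _ ≤ Real.exp (η * b + η * r) := by
          rw [Real.exp_le_exp]
          have h1 := hs (S.filter (· ∉ s)) (by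
            rw [Finset.disjoint_left]
            exact fun j hj => (Finset.mem_filter.1 hj).2)
          have h2 := (le_abs_self _).trans h1.le
          rw [le_div_iff₀ (by positivity)] at h2
          have h3 := mul_le_mul_of_nonneg_right h2 (add_nonneg hb hr)
          linarith

theorem integrableOn_ray_moment {ν s : ℝ} (hν : 0 < ν) (hs : 0 < s) :
    IntegrableOn (fun r : ℝ => rayDir ^ 2 * r * Complex.exp (rayDir * r * s) / (rayDir * r + ν))
      (Set.Ioi 0) := by
  refine Integrable.mono' ((integrableOn_mul_exp_ray hs).const_mul (4 / (ν / 2)))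
    (Measurable.aestronglyMeasurable (by fun_prop)) ?_
  filter_upwards [ae_restrict_mem measurableSet_Ioi] with r hr
  have hr : (0 : ℝ) < r := hr
  rw [norm_div, norm_mul, norm_mul, norm_pow, norm_exp_ray, Complex.norm_real, Real.norm_eq_abs,
    abs_of_pos hr, div_mul_eq_mul_div]
  refine div_le_div₀ (by positivity) ?_ (by positivity) (half_le_norm_rayDir_mul_add r ν)
  have e1 : ‖rayDir‖ ^ 2 ≤ 4 := by nlinarith [norm_rayDir_le, norm_nonneg rayDir]
  rw [mul_assoc]
  exact mul_le_mul_of_nonneg_right e1 (by positivity)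

/-- Bounds for exponential sums away from the origin, in terms of the `L¹` norm of the
generalized polynomial. -/
theorem exists_expSum_bound {l : ℕ → ℝ} (hl : ∀ k, 0 ≤ l k) {β δ : ℝ} (hβ : 0 ≤ β) (hδ : 0 < δ)
    (hlδ : ∀ k, δ ≤ l k - β) (hsum : Summable fun k => 1 / (l k - β)) {s₀ : ℝ} (hs₀ : 0 < s₀) :
    ∃ C : ℝ, 0 < C ∧ ∀ (S : Finset ℕ) (a : ℕ → ℝ) (s : ℝ), s₀ ≤ s →
      |∑ k ∈ S, a k * Real.exp (-((l k - β) * s))| ≤ C * powerSumNorm l S a ∧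
      |∑ k ∈ S, a k * ((l k - β) * Real.exp (-((l k - β) * s)))| ≤ C * powerSumNorm l S a := by
  obtain ⟨c, hc, hrep⟩ := exists_ray_representation
  obtain ⟨C₁, hC₁, hprod⟩ := exists_blaschke_ray_bound (b := 1 + β) (by linarith) hδ hlδ hsum
    (half_pos hs₀)
  have hν : ∀ k, 0 < l k - β := fun k => hδ.trans_le (hlδ k)
  set D₀ := ∫ r in Set.Ioi (0 : ℝ), Real.exp (-(s₀ / 2 * r)) with hD₀
  set D₁ := ∫ r in Set.Ioi (0 : ℝ), r * Real.exp (-(s₀ / 2 * r)) with hD₁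
  have hD₀' : 0 ≤ D₀ := setIntegral_nonneg measurableSet_Ioi fun r _ => (Real.exp_pos _).le
  have hD₁' : 0 ≤ D₁ := setIntegral_nonneg measurableSet_Ioi fun r hr =>
    mul_nonneg (le_of_lt hr) (Real.exp_pos _).le
  refine ⟨(4 * C₁ * (D₀ + D₁ + 1)) / c, by positivity, fun S a s hs => ?_⟩
  have hs0 : 0 < s := hs₀.trans_le hs
  set N := powerSumNorm l S a with hN
  have hN0 : 0 ≤ N := powerSumNorm_nonneg _ _ _
  set Q : ℝ → ℂ := fun r => ∑ k ∈ S, (a k : ℂ) / (rayDir * r + (l k - β : ℝ)) with hQ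
  have hQle : ∀ r : ℝ, 0 < r → ‖Q r‖ ≤ N * (C₁ * Real.exp (s₀ / 2 * r)) := by
    intro r hr
    -- The shift `1 + β` makes `-w + (l k + 1)` equal to `ω r + (l k - β)`, so `Q` is the Mellin
    -- transform on a ray that starts to the right of all poles. It grows at most like `exp (s₀ r /
    -- 2)`, which `|exp (ω r s)| = exp (-(s r))` absorbs for `s ≥ s₀`.
    set w : ℂ := -(rayDir * r) + (1 + β : ℝ) with hw
    have hwre : 0 ≤ w.re := by simp [hw, rayDir]; linarith
    have hwim : w.im ≠ 0 := by simp [hw, rayDir]; exact hr.ne'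
    have h := norm_mellin_neg_le hl S a hwre (fun k hk => hwim (by rw [hk]; simp))
    have e1 : ∀ k, -w + (l k + 1 : ℝ) = rayDir * r + (l k - β : ℝ) := fun k => by
      rw [hw]; push_cast; ring
    have e2 : ∀ k, w + (l k + 1 : ℝ) = -(rayDir * r) + ((l k - β) + 2 * (1 + β) : ℝ) := fun k => by
      rw [hw]; push_cast; ring
    have e3 : ∀ k, ‖w - (l k + 1 : ℝ)‖ = ‖rayDir * r + (l k - β : ℝ)‖ := fun k => by
      rw [← norm_neg, ← e1]; congr 1; ring
    simp only [e1, e2, e3] at h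
    exact h.trans (mul_le_mul_of_nonneg_left (hprod S r hr.le) hN0)
  have hexp : ∀ r : ℝ, 0 < r → Real.exp (-(s * r)) * Real.exp (s₀ / 2 * r) ≤
      Real.exp (-(s₀ / 2 * r)) := by
    intro r hr
    rw [← Real.exp_add, Real.exp_le_exp]
    nlinarith
  have hω := norm_rayDir_le
  have hω2 : ‖rayDir‖ ^ 2 ≤ 4 := by nlinarith [norm_rayDir_le, norm_nonneg rayDir]
  have hfin : ∀ x D : ℝ, c * |x| ≤ 4 * C₁ * N * D → D ≤ D₀ + D₁ + 1 →
      |x| ≤ 4 * C₁ * (D₀ + D₁ + 1) / c * N := by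
    intro x D h1 h2
    rw [div_mul_eq_mul_div, le_div_iff₀ hc]
    have := mul_le_mul_of_nonneg_left h2 (show 0 ≤ 4 * C₁ * N by positivity)
    linarith
  constructor
  · have h1 : ∫ r in Set.Ioi (0 : ℝ), rayDir * Complex.exp (rayDir * r * s) * Q r =
        ∑ k ∈ S, (a k : ℂ) * ∫ r in Set.Ioi (0 : ℝ),
          rayDir * Complex.exp (rayDir * r * s) / (rayDir * r + (l k - β : ℝ)) := by
      simp_rw [← integral_const_mul]
      rw [← integral_finsetSum _ fun k _ => (integrableOn_ray_kernel (hν k) hs0).const_mul _]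
      refine integral_congr_ae (Filter.Eventually.of_forall fun r => ?_)
      simp only [hQ, Finset.mul_sum]
      exact Finset.sum_congr rfl fun k _ => by ring
    have h2 : (∫ r in Set.Ioi (0 : ℝ), rayDir * Complex.exp (rayDir * r * s) * Q r).im =
        c * ∑ k ∈ S, a k * Real.exp (-((l k - β) * s)) := by
      rw [h1, Complex.im_sum, Finset.mul_sum]
      refine Finset.sum_congr rfl fun k _ => ?_
      rw [Complex.im_ofReal_mul, (hrep _ s (hν k) hs0).1]
      ring
    have h3 : ‖∫ r in Set.Ioi (0 : ℝ), rayDir * Complex.exp (rayDir * r * s) * Q r‖ ≤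
        ∫ r in Set.Ioi (0 : ℝ), 4 * C₁ * N * Real.exp (-(s₀ / 2 * r)) := by
      refine norm_integral_le_of_norm_le ((integrableOn_exp_ray (half_pos hs₀)).const_mul _) ?_
      filter_upwards [ae_restrict_mem measurableSet_Ioi] with r hr
      rw [norm_mul, norm_mul, norm_exp_ray]
      calc ‖rayDir‖ * Real.exp (-(s * r)) * ‖Q r‖
          ≤ 4 * Real.exp (-(s * r)) * (N * (C₁ * Real.exp (s₀ / 2 * r))) := by
            gcongr
            · linarith
            · exact hQle r hr
        _ = 4 * C₁ * N * (Real.exp (-(s * r)) * Real.exp (s₀ / 2 * r)) := by ring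
        _ ≤ _ := mul_le_mul_of_nonneg_left (hexp r hr) (by positivity)
    rw [integral_const_mul] at h3
    refine hfin _ D₀ ?_ (by linarith)
    rw [← abs_of_pos hc, ← abs_mul, ← h2]
    exact (Complex.abs_im_le_norm _).trans h3
  · have h1 : ∫ r in Set.Ioi (0 : ℝ), rayDir ^ 2 * r * Complex.exp (rayDir * r * s) * Q r =
        ∑ k ∈ S, (a k : ℂ) * ∫ r in Set.Ioi (0 : ℝ),
          rayDir ^ 2 * r * Complex.exp (rayDir * r * s) / (rayDir * r + (l k - β : ℝ)) := by
      simp_rw [← integral_const_mul]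
      rw [← integral_finsetSum _ fun k _ => (integrableOn_ray_moment (hν k) hs0).const_mul _]
      refine integral_congr_ae (Filter.Eventually.of_forall fun r => ?_)
      simp only [hQ, Finset.mul_sum]
      exact Finset.sum_congr rfl fun k _ => by ring
    have h2 : (∫ r in Set.Ioi (0 : ℝ), rayDir ^ 2 * r * Complex.exp (rayDir * r * s) * Q r).im =
        -(c * ∑ k ∈ S, a k * ((l k - β) * Real.exp (-((l k - β) * s)))) := by
      rw [h1, Complex.im_sum, Finset.mul_sum, ← Finset.sum_neg_distrib]
      refine Finset.sum_congr rfl fun k _ => ?_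
      rw [Complex.im_ofReal_mul, (hrep _ s (hν k) hs0).2]
      ring
    have h3 : ‖∫ r in Set.Ioi (0 : ℝ), rayDir ^ 2 * r * Complex.exp (rayDir * r * s) * Q r‖ ≤
        ∫ r in Set.Ioi (0 : ℝ), 4 * C₁ * N * (r * Real.exp (-(s₀ / 2 * r))) := by
      refine norm_integral_le_of_norm_le ((integrableOn_mul_exp_ray (half_pos hs₀)).const_mul _) ?_
      filter_upwards [ae_restrict_mem measurableSet_Ioi] with r hr
      have hr : (0 : ℝ) < r := hr
      rw [norm_mul, norm_mul, norm_mul, norm_pow, norm_exp_ray, Complex.norm_real,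
        Real.norm_eq_abs, abs_of_pos hr]
      calc ‖rayDir‖ ^ 2 * r * Real.exp (-(s * r)) * ‖Q r‖
          ≤ 4 * r * Real.exp (-(s * r)) * (N * (C₁ * Real.exp (s₀ / 2 * r))) := by
            gcongr
            exact hQle r hr
        _ = 4 * C₁ * N * (r * (Real.exp (-(s * r)) * Real.exp (s₀ / 2 * r))) := by ring
        _ ≤ _ := mul_le_mul_of_nonneg_left (mul_le_mul_of_nonneg_left (hexp r hr) hr.le)
            (by positivity)
    rw [integral_const_mul] at h3
    refine hfin _ D₁ ?_ (by linarith)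
    rw [← abs_of_pos hc, ← abs_mul, ← abs_neg, ← h2]
    exact (Complex.abs_im_le_norm _).trans h3

/-! ### Interior bounds for generalized polynomials -/

theorem continuous_powerSum {l : ℕ → ℝ} (hl : ∀ k, 0 ≤ l k) (S : Finset ℕ) (a : ℕ → ℝ) :
    Continuous (powerSum l S a) :=
  continuous_finsetSum _ fun k _ => continuous_const.mul (Real.continuous_rpow_const (hl k))

/-- Data on a strictly increasing sequence with summable inverses used in the estimates. -/
theorem summable_inv_sub_first {Λ : ℕ → ℝ} (hmono : StrictMono Λ) (hnonneg : ∀ k, 0 ≤ Λ k)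
    (hM : Summable fun k => 1 / Λ k) : Summable fun k => 1 / (Λ k - Λ 0) := by
  have h1 : 0 < Λ 1 := (hnonneg 0).trans_lt (hmono one_pos)
  have h01 : 0 < Λ 1 - Λ 0 := sub_pos.2 (hmono one_pos)
  refine Summable.of_nonneg_of_le (fun k => ?_) (fun k => ?_) (hM.mul_left (Λ 1 / (Λ 1 - Λ 0)))
  · exact one_div_nonneg.2 (sub_nonneg.2 (hmono.monotone (Nat.zero_le k)))
  · rcases Nat.eq_zero_or_pos k with rfl | hk
    · rw [sub_self, div_zero]
      have := hnonneg 0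
      positivity
    · have hk1 : Λ 1 ≤ Λ k := hmono.monotone hk
      have hpos : 0 < Λ k := h1.trans_le hk1
      rw [div_mul_div_comm, mul_one, div_le_div_iff₀ (by linarith [hmono one_pos])
        (mul_pos h01 hpos)]
      nlinarith [mul_nonneg (hnonneg 0) (sub_nonneg.2 hk1)]

/-- The first coefficient is controlled by the `L¹` norm. -/
theorem exists_first_coeff_bound {Λ : ℕ → ℝ} (hmono : StrictMono Λ) (hnonneg : ∀ k, 0 ≤ Λ k)
    (hM : Summable fun k => 1 / Λ k) :
    ∃ C : ℝ, 0 < C ∧ ∀ (n : ℕ) (a : ℕ → ℝ),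
      |a 0| ≤ C * powerSumNorm Λ (Finset.range (n + 1)) a := by
  have hs := summable_inv_sub_first hmono hnonneg hM
  have h0 := hnonneg 0
  -- In `abs_coeff_le` each quotient is `1 + (2 Λ₀ + 2) / (Λⱼ - Λ₀)`, at most the exponential of its
  -- second term; the product is then bounded by a convergent sum, independently of `n`.
  refine ⟨2 * (Λ 0 + 1) * Real.exp ((2 * Λ 0 + 2) * ∑' k, 1 / (Λ k - Λ 0)), by positivity,
    fun n a => ?_⟩
  have h := abs_coeff_le hnonneg hmono.injective (Finset.range (n + 1)) a
    (Finset.mem_range.2 (Nat.succ_pos n))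
  refine h.trans ?_
  rw [mul_assoc, mul_comm]
  refine mul_le_mul_of_nonneg_right (mul_le_mul_of_nonneg_left ?_ (by positivity))
    (powerSumNorm_nonneg _ _ _)
  calc ∏ j ∈ (Finset.range (n + 1)).erase 0, (|Λ 0 + Λ j + 2| / |Λ 0 - Λ j|)
      ≤ ∏ j ∈ (Finset.range (n + 1)).erase 0, Real.exp ((2 * Λ 0 + 2) * (1 / (Λ j - Λ 0))) := by
        refine Finset.prod_le_prod (fun j _ => by positivity) fun j hj => ?_
        have hj0 : 0 < j := Nat.pos_of_ne_zero (Finset.mem_erase.1 hj).1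
        have hlt : 0 < Λ j - Λ 0 := sub_pos.2 (hmono hj0)
        rw [abs_sub_comm, abs_of_pos hlt, abs_of_nonneg (by linarith)]
        have e : (Λ 0 + Λ j + 2) / (Λ j - Λ 0) = (2 * Λ 0 + 2) * (1 / (Λ j - Λ 0)) + 1 := by
          field_simp; ring
        rw [e]
        exact Real.add_one_le_exp _
    _ = Real.exp ((2 * Λ 0 + 2) * ∑ j ∈ (Finset.range (n + 1)).erase 0, 1 / (Λ j - Λ 0)) := by
        rw [← Real.exp_sum, Finset.mul_sum]
    _ ≤ _ := by
        rw [Real.exp_le_exp]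
        refine mul_le_mul_of_nonneg_left ?_ (by linarith)
        exact hs.sum_le_tsum _ fun k _ =>
          one_div_nonneg.2 (sub_nonneg.2 (hmono.monotone (Nat.zero_le k)))

theorem powerSum_range_succ (Λ : ℕ → ℝ) (n : ℕ) (a : ℕ → ℝ) (x : ℝ) :
    powerSum Λ (Finset.range (n + 1)) a x =
      powerSum (fun k => Λ (k + 1)) (Finset.range n) (fun k => a (k + 1)) x + a 0 * x ^ Λ 0 := by
  rw [powerSum, powerSum, Finset.sum_range_succ']

theorem powerSumNorm_tail_le {Λ : ℕ → ℝ} (hnonneg : ∀ k, 0 ≤ Λ k) (n : ℕ) (a : ℕ → ℝ) :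
    powerSumNorm (fun k => Λ (k + 1)) (Finset.range n) (fun k => a (k + 1)) ≤
      powerSumNorm Λ (Finset.range (n + 1)) a + |a 0| := by
  have hc := (continuous_powerSum hnonneg (Finset.range (n + 1)) a).abs
  have hc' := (continuous_powerSum (fun k => hnonneg (k + 1)) (Finset.range n)
    (fun k => a (k + 1))).abs
  rw [powerSumNorm, powerSumNorm]
  calc ∫ x in (0 : ℝ)..1, |powerSum (fun k => Λ (k + 1)) (Finset.range n) (fun k => a (k + 1)) x|
      ≤ ∫ x in (0 : ℝ)..1, (|powerSum Λ (Finset.range (n + 1)) a x| + |a 0|) := by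
        refine intervalIntegral.integral_mono_on zero_le_one (hc'.intervalIntegrable _ _)
          ((hc.add continuous_const).intervalIntegrable _ _) fun x hx => ?_
        have e : powerSum (fun k => Λ (k + 1)) (Finset.range n) (fun k => a (k + 1)) x =
            powerSum Λ (Finset.range (n + 1)) a x - a 0 * x ^ Λ 0 := by
          rw [powerSum_range_succ]; ring
        rw [e]
        refine (abs_sub _ _).trans ?_
        rw [abs_mul, abs_of_nonneg (Real.rpow_nonneg hx.1 _)]
        have := mul_le_mul_of_nonneg_left (Real.rpow_le_one hx.1 hx.2 (hnonneg 0)) (abs_nonneg (a 0))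
        linarith
    _ = _ := by
        rw [intervalIntegral.integral_add (hc.intervalIntegrable _ _)
          (continuous_const.intervalIntegrable _ _)]
        simp

/-- Bounds on generalized polynomials and their derivatives inside the interval. -/
theorem exists_powerSum_deriv_bound {Λ : ℕ → ℝ} (hmono : StrictMono Λ) (hnonneg : ∀ k, 0 ≤ Λ k)
    (hM : Summable fun k => 1 / Λ k) : ∃ β : ℝ, 0 < β ∧ ∀ ρ : ℝ, 0 < ρ → ρ < 1 →
      ∃ C : ℝ, 0 < C ∧ ∀ (n : ℕ) (a : ℕ → ℝ) (x : ℝ), 0 < x → x ≤ ρ →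
        |powerSum Λ (Finset.range (n + 1)) a x| ≤
          C * powerSumNorm Λ (Finset.range (n + 1)) a ∧
        ∃ D, HasDerivAt (powerSum Λ (Finset.range (n + 1)) a) D x ∧
          |D| ≤ C * powerSumNorm Λ (Finset.range (n + 1)) a * x ^ (β - 1) := by
  have h0 := hnonneg 0
  have h1 : 0 < Λ 1 := h0.trans_lt (hmono one_pos)
  -- The first exponent may be `0`, so its term is treated apart through the coefficient bound. The
  -- exponent `β` stays uniformly below all later exponents and, unless `Λ 0 = 0`, does not exceed
  -- `Λ 0`: every derivative term is then `O(x ^ (β - 1))`.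
  obtain ⟨β, hβ, hβ1, hβ0⟩ : ∃ β : ℝ, 0 < β ∧ β ≤ Λ 1 / 2 ∧ (Λ 0 = 0 ∨ β ≤ Λ 0) := by
    rcases h0.eq_or_lt with h | h
    · exact ⟨Λ 1 / 2, by linarith, le_rfl, Or.inl h.symm⟩
    · exact ⟨min (Λ 1 / 2) (Λ 0), lt_min (by linarith) h, min_le_left _ _, Or.inr (min_le_right _ _)⟩
  refine ⟨β, hβ, fun ρ hρ0 hρ1 => ?_⟩
  obtain ⟨C₀, hC₀, hcoef⟩ := exists_first_coeff_bound hmono hnonneg hM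
  have hΛ1 : ∀ k, Λ 1 ≤ Λ (k + 1) := fun k => hmono.monotone (by omega)
  obtain ⟨C₂, hC₂, hexp⟩ := exists_expSum_bound (l := fun k => Λ (k + 1))
    (fun k => hnonneg (k + 1)) hβ.le (half_pos h1) (fun k => by have := hΛ1 k; linarith)
    (by
      refine Summable.of_nonneg_of_le (fun k => ?_) (fun k => ?_)
        (((summable_nat_add_iff 1).2 hM).mul_left 2)
      · have := hΛ1 k
        exact one_div_nonneg.2 (by linarith)
      · have := hΛ1 k
        rw [mul_one_div, div_le_div_iff₀ (by linarith) (by linarith)]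
        linarith)
    (s₀ := -Real.log ρ) (neg_pos.2 (Real.log_neg hρ0 hρ1))
  set K := C₂ * (1 + C₀) with hK
  have hK0 : 0 < K := by positivity
  refine ⟨(C₀ + K) + (Λ 0 * C₀ + K * (1 + β)), by positivity, fun n a x hx0 hxρ => ?_⟩
  set N := powerSumNorm Λ (Finset.range (n + 1)) a with hN
  have hN0 : 0 ≤ N := powerSumNorm_nonneg _ _ _
  have hx1 : x ≤ 1 := hxρ.trans hρ1.le
  have ha0 : |a 0| ≤ C₀ * N := hcoef n a
  have htail : C₂ * powerSumNorm (fun k => Λ (k + 1)) (Finset.range n) (fun k => a (k + 1)) ≤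
      K * N := by
    have := powerSumNorm_tail_le hnonneg n a
    rw [hK, mul_assoc]
    exact mul_le_mul_of_nonneg_left (by linarith) hC₂.le
  -- The substitution `x = exp (-s)` turns exponential sums into powers, and `x ≤ ρ` into `s ≥ s₀`.
  obtain ⟨hb1, hb2⟩ := hexp (Finset.range n) (fun k => a (k + 1)) (-Real.log x)
    (neg_le_neg (Real.log_le_log hx0 hxρ))
  have hpow : ∀ k, Real.exp (-((Λ (k + 1) - β) * -Real.log x)) = x ^ (Λ (k + 1) - β) := by
    intro k
    rw [Real.rpow_def_of_pos hx0]; congr 1; ring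
  simp only [hpow] at hb1 hb2
  replace hb1 := hb1.trans htail
  replace hb2 := hb2.trans htail
  set A := ∑ k ∈ Finset.range n, a (k + 1) * x ^ (Λ (k + 1) - β) with hA
  set B := ∑ k ∈ Finset.range n, a (k + 1) * ((Λ (k + 1) - β) * x ^ (Λ (k + 1) - β)) with hB
  have hxβ : x ^ β ≤ 1 := Real.rpow_le_one hx0.le hx1 hβ.le
  have hxβ0 : 0 ≤ x ^ β := Real.rpow_nonneg hx0.le _
  constructor
  · have e : powerSum Λ (Finset.range (n + 1)) a x = x ^ β * A + a 0 * x ^ Λ 0 := by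
      rw [powerSum_range_succ, powerSum, hA, Finset.mul_sum]
      congr 1
      refine Finset.sum_congr rfl fun k _ => ?_
      rw [mul_left_comm, ← Real.rpow_add hx0]
      congr 2; ring
    rw [e]
    have e1 : |x ^ β * A| ≤ K * N := by
      rw [abs_mul, abs_of_nonneg hxβ0]
      exact (mul_le_of_le_one_left (abs_nonneg _) hxβ).trans hb1
    have e2 : |a 0 * x ^ Λ 0| ≤ C₀ * N := by
      rw [abs_mul, abs_of_nonneg (Real.rpow_nonneg hx0.le _)]
      exact (mul_le_of_le_one_right (abs_nonneg _) (Real.rpow_le_one hx0.le hx1 h0)).trans ha0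
    have e3 : 0 ≤ (Λ 0 * C₀ + K * (1 + β)) * N := by positivity
    calc _ ≤ |x ^ β * A| + |a 0 * x ^ Λ 0| := abs_add_le _ _
      _ ≤ _ := by linarith
  · have hd : HasDerivAt (powerSum Λ (Finset.range (n + 1)) a)
        (∑ k ∈ Finset.range (n + 1), a k * (Λ k * x ^ (Λ k - 1))) x := by
      have : powerSum Λ (Finset.range (n + 1)) a =
          fun x => ∑ k ∈ Finset.range (n + 1), a k * x ^ Λ k := rfl
      rw [this]
      exact HasDerivAt.fun_sum fun k _ =>
        (Real.hasDerivAt_rpow_const (Or.inl hx0.ne')).const_mul (a k)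
    refine ⟨_, hd, ?_⟩
    have e : ∑ k ∈ Finset.range (n + 1), a k * (Λ k * x ^ (Λ k - 1)) =
        x ^ (β - 1) * (B + β * A) + a 0 * (Λ 0 * x ^ (Λ 0 - 1)) := by
      rw [Finset.sum_range_succ', hA, hB, Finset.mul_sum, ← Finset.sum_add_distrib, Finset.mul_sum]
      congr 1
      refine Finset.sum_congr rfl fun k _ => ?_
      have : x ^ (Λ (k + 1) - 1) = x ^ (β - 1) * x ^ (Λ (k + 1) - β) := by
        rw [← Real.rpow_add hx0]; congr 1; ring
      rw [this]; ring
    rw [e]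
    have hxb : 0 ≤ x ^ (β - 1) := Real.rpow_nonneg hx0.le _
    have e1 : |x ^ (β - 1) * (B + β * A)| ≤ K * (1 + β) * N * x ^ (β - 1) := by
      rw [abs_mul, abs_of_nonneg hxb, mul_comm]
      refine mul_le_mul_of_nonneg_right ?_ hxb
      have := abs_add_le B (β * A)
      rw [abs_mul, abs_of_pos hβ] at this
      have := mul_le_mul_of_nonneg_left hb1 hβ.le
      linarith
    have e2 : |a 0 * (Λ 0 * x ^ (Λ 0 - 1))| ≤ Λ 0 * C₀ * N * x ^ (β - 1) := by
      rw [abs_mul, abs_of_nonneg (mul_nonneg h0 (Real.rpow_nonneg hx0.le _))]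
      rcases hβ0 with hz | hle
      · rw [hz]; simp
      · have h2 : x ^ (Λ 0 - 1) ≤ x ^ (β - 1) :=
          Real.rpow_le_rpow_of_exponent_ge hx0 hx1 (by linarith)
        calc |a 0| * (Λ 0 * x ^ (Λ 0 - 1)) ≤ C₀ * N * (Λ 0 * x ^ (β - 1)) := by gcongr
          _ = _ := by ring
    have e3 : 0 ≤ (C₀ + K) * N * x ^ (β - 1) := by positivity
    calc _ ≤ |x ^ (β - 1) * (B + β * A)| + |a 0 * (Λ 0 * x ^ (Λ 0 - 1))| := abs_add_le _ _
      _ ≤ _ := by linarith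

/-- Interior estimates for generalized polynomials: sup bound and a modulus of continuity. -/
theorem exists_powerSum_bound {Λ : ℕ → ℝ} (hmono : StrictMono Λ) (hnonneg : ∀ k, 0 ≤ Λ k)
    (hM : Summable fun k => 1 / Λ k) : ∃ β : ℝ, 0 < β ∧ ∀ ρ : ℝ, 0 < ρ → ρ < 1 →
      ∃ C : ℝ, 0 < C ∧ ∀ (n : ℕ) (a : ℕ → ℝ),
        (∀ x ∈ Set.Icc 0 ρ, |powerSum Λ (Finset.range (n + 1)) a x| ≤
          C * powerSumNorm Λ (Finset.range (n + 1)) a) ∧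
        ∀ x ∈ Set.Icc 0 ρ, ∀ y ∈ Set.Icc 0 ρ, x ≤ y →
          |powerSum Λ (Finset.range (n + 1)) a y - powerSum Λ (Finset.range (n + 1)) a x| ≤
            C * powerSumNorm Λ (Finset.range (n + 1)) a * (y ^ β - x ^ β) := by
  obtain ⟨β, hβ, h⟩ := exists_powerSum_deriv_bound hmono hnonneg hM
  refine ⟨β, hβ, fun ρ hρ0 hρ1 => ?_⟩
  obtain ⟨C, hC, hb⟩ := h ρ hρ0 hρ1
  refine ⟨C + C / β, by positivity, fun n a => ?_⟩
  set p := powerSum Λ (Finset.range (n + 1)) a with hp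
  set N := powerSumNorm Λ (Finset.range (n + 1)) a with hN
  have hN0 : 0 ≤ N := powerSumNorm_nonneg _ _ _
  have hpc : Continuous p := continuous_powerSum hnonneg _ a
  have hβc : Continuous fun x : ℝ => x ^ β := Real.continuous_rpow_const hβ.le
  have hβd : ∀ x : ℝ, 0 < x → HasDerivAt (fun x : ℝ => C / β * N * x ^ β) (C * N * x ^ (β - 1)) x := by
    intro x hx
    refine ((Real.hasDerivAt_rpow_const (Or.inl hx.ne')).const_mul (C / β * N)).congr_deriv ?_
    field_simp
  -- The function `(C / β) N x ^ β` has derivative `C N x ^ (β - 1)`, which dominates `|p'|`; adding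
  -- or subtracting `p` leaves it increasing. Continuity lets the interval include `0`.
  have hmonoOn : ∀ σ : ℝ, |σ| = 1 →
      MonotoneOn (fun x => C / β * N * x ^ β + σ * p x) (Set.Icc 0 ρ) := by
    intro σ hσ
    have hder : ∀ x ∈ Set.Ioo 0 ρ, ∃ D, HasDerivAt (fun x => C / β * N * x ^ β + σ * p x) D x ∧
        0 ≤ D := by
      intro x hx
      obtain ⟨D, hD, hDle⟩ := (hb n a x hx.1 hx.2.le).2
      refine ⟨_, (hβd x hx.1).add (hD.const_mul σ), ?_⟩
      have : |σ * D| ≤ C * N * x ^ (β - 1) := by rw [abs_mul, hσ, one_mul]; exact hDle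
      linarith [neg_abs_le (σ * D)]
    refine monotoneOn_of_deriv_nonneg (convex_Icc 0 ρ)
      ((continuous_const.mul hβc).add (continuous_const.mul hpc)).continuousOn ?_ ?_
    · intro x hx
      rw [interior_Icc] at hx
      obtain ⟨D, hD, -⟩ := hder x hx
      exact hD.differentiableAt.differentiableWithinAt
    · intro x hx
      rw [interior_Icc] at hx
      obtain ⟨D, hD, h0⟩ := hder x hx
      rw [hD.deriv]; exact h0
  have hmod : ∀ x ∈ Set.Icc 0 ρ, ∀ y ∈ Set.Icc 0 ρ, x ≤ y →
      |p y - p x| ≤ C / β * N * (y ^ β - x ^ β) := by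
    intro x hx y hy hxy
    have h1 := hmonoOn 1 (by simp) hx hy hxy
    have h2 := hmonoOn (-1) (by simp) hx hy hxy
    simp only at h1 h2
    rw [abs_le]
    constructor <;> linarith
  have hsub : ∀ x y : ℝ, 0 ≤ x → x ≤ y → 0 ≤ y ^ β - x ^ β := fun x y hx hxy =>
    sub_nonneg.2 (Real.rpow_le_rpow hx hxy hβ.le)
  constructor
  · intro x hx
    rcases hx.1.eq_or_lt with h0 | h0
    · have h1 := hmod 0 ⟨le_rfl, hρ0.le⟩ ρ ⟨hρ0.le, le_rfl⟩ hρ0.le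
      have h2 := (hb n a ρ hρ0 le_rfl).1
      rw [Real.zero_rpow hβ.ne', sub_zero] at h1
      have h3 : C / β * N * ρ ^ β ≤ C / β * N :=
        mul_le_of_le_one_right (by positivity) (Real.rpow_le_one hρ0.le hρ1.le hβ.le)
      have h4 : |p 0| ≤ |p ρ| + |p ρ - p 0| := by
        have := abs_sub_abs_le_abs_sub (p 0) (p ρ)
        rw [abs_sub_comm] at this
        linarith
      rw [← h0]
      linarith
    · have h2 := (hb n a x h0 hx.2).1
      have h3 : 0 ≤ C / β * N := by positivity
      linarith
  · intro x hx y hy hxy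
    refine (hmod x hx y hy hxy).trans ?_
    refine mul_le_mul_of_nonneg_right ?_ (hsub x y hx.1 hxy)
    have : 0 ≤ C * N := by positivity
    linarith

/-! ### Continuous representatives in the Müntz space -/

section
variable {𝕜 : Type*} [RCLike 𝕜]

/-- `p` is a generalized polynomial with exponents from `Λ`. -/
def IsPowerPoly (Λ : ℕ → ℝ) (p : ℝ → 𝕜) : Prop :=
  ∃ (n₀ : ℕ) (c : ℕ → 𝕜), ∀ n ≥ n₀, ∀ x, p x = ∑ k ∈ Finset.range (n + 1), c k * ((x ^ Λ k : ℝ) : 𝕜)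

theorem IsPowerPoly.sub {Λ : ℕ → ℝ} {p q : ℝ → 𝕜} (hp : IsPowerPoly Λ p) (hq : IsPowerPoly Λ q) :
    IsPowerPoly Λ (p - q) := by
  obtain ⟨n, c, h⟩ := hp
  obtain ⟨n', c', h'⟩ := hq
  refine ⟨max n n', c - c', fun m hm x => ?_⟩
  rw [Pi.sub_apply, h m ((le_max_left _ _).trans hm), h' m ((le_max_right _ _).trans hm),
    ← Finset.sum_sub_distrib]
  exact Finset.sum_congr rfl fun k _ => by rw [Pi.sub_apply, sub_mul]

theorem exists_isPowerPoly {Λ : ℕ → ℝ} {f : L1I 𝕜}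
    (hf : f ∈ Submodule.span 𝕜 {f : L1I 𝕜 | ∃ k : ℕ,
      (f : ℝ → 𝕜) =ᵐ[volume.restrict (Set.Icc (0 : ℝ) 1)] fun x : ℝ => ((x ^ Λ k : ℝ) : 𝕜)}) :
    ∃ p, IsPowerPoly Λ p ∧ (f : ℝ → 𝕜) =ᵐ[volume.restrict (Set.Icc (0 : ℝ) 1)] p := by
  induction hf using Submodule.span_induction with
  | mem f hf =>
    obtain ⟨k, hk⟩ := hf
    refine ⟨_, ⟨k, Pi.single k 1, fun n hn x => ?_⟩, hk⟩
    rw [Finset.sum_eq_single_of_mem k (Finset.mem_range.2 (by omega))]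
    · simp
    · intro j _ hj
      rw [Pi.single_eq_of_ne hj, zero_mul]
  | zero =>
    refine ⟨0, ⟨0, 0, fun n _ x => by simp⟩, Lp.coeFn_zero _ _ _⟩
  | add f g _ _ hf hg =>
    obtain ⟨p, ⟨n, c, h⟩, hp⟩ := hf
    obtain ⟨q, ⟨n', c', h'⟩, hq⟩ := hg
    refine ⟨p + q, ⟨max n n', c + c', fun m hm x => ?_⟩, (Lp.coeFn_add f g).trans (hp.add hq)⟩
    rw [Pi.add_apply, h m ((le_max_left _ _).trans hm), h' m ((le_max_right _ _).trans hm),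
      ← Finset.sum_add_distrib]
    exact Finset.sum_congr rfl fun k _ => by rw [Pi.add_apply, add_mul]
  | smul a f _ hf =>
    obtain ⟨p, ⟨n, c, h⟩, hp⟩ := hf
    refine ⟨a • p, ⟨n, a • c, fun m hm x => ?_⟩, (Lp.coeFn_smul a f).trans (hp.const_smul a)⟩
    rw [Pi.smul_apply, h m hm, smul_eq_mul, Finset.mul_sum]
    exact Finset.sum_congr rfl fun k _ => by rw [Pi.smul_apply, smul_eq_mul, mul_assoc]

theorem norm_le_abs_re_add_abs_im (z : 𝕜) : ‖z‖ ≤ |RCLike.re z| + |RCLike.im z| := by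
  refine abs_le_of_sq_le_sq' ?_ (by positivity) |>.2
  rw [RCLike.norm_sq_eq_def]
  nlinarith [mul_nonneg (abs_nonneg (RCLike.re z)) (abs_nonneg (RCLike.im z)),
    sq_abs (RCLike.re z), sq_abs (RCLike.im z)]

/-- Sup bound and modulus of continuity on `[0, ρ]`. -/
def HasInteriorBound (β ρ K : ℝ) (g : ℝ → 𝕜) : Prop :=
  (∀ x ∈ Set.Icc 0 ρ, ‖g x‖ ≤ K) ∧
    ∀ x ∈ Set.Icc 0 ρ, ∀ y ∈ Set.Icc 0 ρ, x ≤ y → ‖g y - g x‖ ≤ K * (y ^ β - x ^ β)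

theorem L1I.norm_eq_of_ae {f : L1I 𝕜} {p : ℝ → 𝕜}
    (h : (f : ℝ → 𝕜) =ᵐ[volume.restrict (Set.Icc (0 : ℝ) 1)] p) :
    ‖f‖ = ∫ x in (0 : ℝ)..1, ‖p x‖ := by
  rw [L1.norm_eq_integral_norm, intervalIntegral.integral_of_le zero_le_one,
    ← integral_Icc_eq_integral_Ioc]
  refine integral_congr_ae ?_
  filter_upwards [h] with x hx
  rw [hx]

theorem exists_isPowerPoly_bound (𝕜 : Type*) [RCLike 𝕜] {Λ : ℕ → ℝ} (hmono : StrictMono Λ)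
    (hnonneg : ∀ k, 0 ≤ Λ k) (hM : Summable fun k => 1 / Λ k) :
    ∃ β : ℝ, 0 < β ∧ ∃ C : ℝ → ℝ, ∀ ρ ∈ Set.Ioo (0 : ℝ) 1, 0 < C ρ ∧
      ∀ (f : L1I 𝕜) (p : ℝ → 𝕜), IsPowerPoly Λ p →
        (f : ℝ → 𝕜) =ᵐ[volume.restrict (Set.Icc (0 : ℝ) 1)] p →
        HasInteriorBound β ρ (C ρ * ‖f‖) p := by
  obtain ⟨β, hβ, h⟩ := exists_powerSum_bound hmono hnonneg hM
  have h' : ∀ ρ : ℝ, ∃ C : ℝ, ρ ∈ Set.Ioo (0 : ℝ) 1 → 0 < C ∧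
      ∀ (f : L1I 𝕜) (p : ℝ → 𝕜), IsPowerPoly Λ p →
        (f : ℝ → 𝕜) =ᵐ[volume.restrict (Set.Icc (0 : ℝ) 1)] p →
        HasInteriorBound β ρ (C * ‖f‖) p := by
    intro ρ
    by_cases hρ : ρ ∈ Set.Ioo (0 : ℝ) 1
    swap
    · exact ⟨0, fun h => absurd h hρ⟩
    obtain ⟨C, hC, hb⟩ := h ρ hρ.1 hρ.2
    -- The factor `2` comes from treating real and imaginary parts separately.
    refine ⟨2 * C, fun _ => ⟨by positivity, fun f p hp hfp => ?_⟩⟩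
    obtain ⟨n, c, hc⟩ := hp
    replace hc := hc n le_rfl
    have hre : ∀ x, RCLike.re (p x) =
        powerSum Λ (Finset.range (n + 1)) (fun k => RCLike.re (c k)) x := by
      intro x
      rw [hc, map_sum, powerSum]
      exact Finset.sum_congr rfl fun k _ => by rw [mul_comm, RCLike.re_ofReal_mul, mul_comm]
    have him : ∀ x, RCLike.im (p x) =
        powerSum Λ (Finset.range (n + 1)) (fun k => RCLike.im (c k)) x := by
      intro x
      rw [hc, map_sum, powerSum]
      exact Finset.sum_congr rfl fun k _ => by rw [mul_comm, RCLike.im_ofReal_mul, mul_comm]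
    have hpc : Continuous p := by
      have : p = fun x => ∑ k ∈ Finset.range (n + 1), c k * ((x ^ Λ k : ℝ) : 𝕜) := funext hc
      rw [this]
      exact continuous_finsetSum _ fun k _ =>
        continuous_const.mul (continuous_rpow_ofReal (hnonneg k))
    have hNre : powerSumNorm Λ (Finset.range (n + 1)) (fun k => RCLike.re (c k)) ≤ ‖f‖ := by
      rw [L1I.norm_eq_of_ae hfp, powerSumNorm]
      refine intervalIntegral.integral_mono_on zero_le_one
        ((continuous_powerSum hnonneg _ _).abs.intervalIntegrable _ _)
        (hpc.norm.intervalIntegrable _ _) fun x _ => ?_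
      rw [← hre]
      exact RCLike.abs_re_le_norm _
    have hNim : powerSumNorm Λ (Finset.range (n + 1)) (fun k => RCLike.im (c k)) ≤ ‖f‖ := by
      rw [L1I.norm_eq_of_ae hfp, powerSumNorm]
      refine intervalIntegral.integral_mono_on zero_le_one
        ((continuous_powerSum hnonneg _ _).abs.intervalIntegrable _ _)
        (hpc.norm.intervalIntegrable _ _) fun x _ => ?_
      rw [← him]
      exact RCLike.abs_im_le_norm _
    obtain ⟨hr1, hr2⟩ := hb n fun k => RCLike.re (c k)
    obtain ⟨hi1, hi2⟩ := hb n fun k => RCLike.im (c k)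
    constructor
    · intro x hx
      have e1 := (hr1 x hx).trans (mul_le_mul_of_nonneg_left hNre hC.le)
      have e2 := (hi1 x hx).trans (mul_le_mul_of_nonneg_left hNim hC.le)
      rw [← hre] at e1
      rw [← him] at e2
      have := norm_le_abs_re_add_abs_im (p x)
      linarith
    · intro x hx y hy hxy
      have hd : 0 ≤ y ^ β - x ^ β := sub_nonneg.2 (Real.rpow_le_rpow hx.1 hxy hβ.le)
      have e1 := (hr2 x hx y hy hxy).trans
        (mul_le_mul_of_nonneg_right (mul_le_mul_of_nonneg_left hNre hC.le) hd)
      have e2 := (hi2 x hx y hy hxy).trans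
        (mul_le_mul_of_nonneg_right (mul_le_mul_of_nonneg_left hNim hC.le) hd)
      rw [← hre, ← hre, ← map_sub] at e1
      rw [← him, ← him, ← map_sub] at e2
      have := norm_le_abs_re_add_abs_im (p y - p x)
      linarith
  choose C hC using h'
  exact ⟨β, hβ, C, fun ρ hρ => hC ρ hρ⟩

/-- Every element of the Müntz space has a representative with interior bounds. -/
theorem exists_muntz_representative (𝕜 : Type*) [RCLike 𝕜] {Λ : ℕ → ℝ} (hmono : StrictMono Λ)
    (hnonneg : ∀ k, 0 ≤ Λ k) (hM : Summable fun k => 1 / Λ k) :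
    ∃ β : ℝ, 0 < β ∧ ∃ C : ℝ → ℝ, (∀ ρ ∈ Set.Ioo (0 : ℝ) 1, 0 < C ρ) ∧
      ∀ f ∈ muntzSpace 𝕜 Λ, ∃ g : ℝ → 𝕜,
        (f : ℝ → 𝕜) =ᵐ[volume.restrict (Set.Icc (0 : ℝ) 1)] g ∧
        ∀ ρ ∈ Set.Ioo (0 : ℝ) 1, HasInteriorBound β ρ (C ρ * ‖f‖) g := by
  obtain ⟨β, hβ, C, hC⟩ := exists_isPowerPoly_bound 𝕜 hmono hnonneg hM
  refine ⟨β, hβ, C, fun ρ hρ => (hC ρ hρ).1, fun f hf => ?_⟩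
  obtain ⟨F, hF, hlim⟩ := mem_closure_iff_seq_limit.1 hf
  choose p hp hpF using fun n => exists_isPowerPoly (hF n)
  -- The interior bound for the differences `p m - p n` turns `L¹` convergence into pointwise
  -- convergence on `[0, 1)`.
  have hcauchy : ∀ x ∈ Set.Ico (0 : ℝ) 1, CauchySeq fun n => p n x := by
    intro x hx
    have hρ : (x + 1) / 2 ∈ Set.Ioo (0 : ℝ) 1 := ⟨by linarith [hx.1], by linarith [hx.2]⟩
    have hxρ : x ∈ Set.Icc (0 : ℝ) ((x + 1) / 2) := ⟨hx.1, by linarith [hx.2]⟩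
    obtain ⟨hCpos, hb⟩ := hC _ hρ
    rw [Metric.cauchySeq_iff]
    intro ε hε
    obtain ⟨N, hN⟩ := Metric.cauchySeq_iff.1 hlim.cauchySeq (ε / C ((x + 1) / 2))
      (div_pos hε hCpos)
    refine ⟨N, fun m hm n hn => ?_⟩
    have h1 := (hb (F m - F n) (p m - p n) ((hp m).sub (hp n))
      ((Lp.coeFn_sub _ _).trans ((hpF m).sub (hpF n)))).1 x hxρ
    have h2 := hN m hm n hn
    rw [dist_eq_norm] at h2 ⊢
    rw [lt_div_iff₀' hCpos] at h2
    exact h1.trans_lt h2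
  set g : ℝ → 𝕜 := fun x => Filter.atTop.limUnder fun n => p n x with hg
  have hgl : ∀ x ∈ Set.Ico (0 : ℝ) 1, Filter.Tendsto (fun n => p n x) Filter.atTop (nhds (g x)) :=
    fun x hx => (hcauchy x hx).tendsto_limUnder
  refine ⟨g, ?_, fun ρ hρ => ?_⟩
  -- A subsequence converges almost everywhere to the class `f`, which identifies the pointwise
  -- limit with `f`.
  · obtain ⟨ns, hns, hae⟩ := (tendstoInMeasure_of_tendsto_Lp hlim).exists_seq_tendsto_ae
    have hall := ae_all_iff.2 hpF
    have hmem : ∀ᵐ x ∂volume.restrict (Set.Icc (0 : ℝ) 1), x ∈ Set.Ico (0 : ℝ) 1 := by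
      rw [← Measure.restrict_congr_set Ico_ae_eq_Icc]
      exact ae_restrict_mem measurableSet_Ico
    filter_upwards [hae, hall, hmem] with x h1 h2 h3
    refine tendsto_nhds_unique h1 ?_
    simp only [h2]
    exact (hgl x h3).comp hns.tendsto_atTop
  · have hsub : ∀ x ∈ Set.Icc 0 ρ, x ∈ Set.Ico (0 : ℝ) 1 := fun x hx =>
      ⟨hx.1, hx.2.trans_lt hρ.2⟩
    have hn : Filter.Tendsto (fun n => C ρ * ‖F n‖) Filter.atTop (nhds (C ρ * ‖f‖)) :=
      hlim.norm.const_mul _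
    have hb := fun n => (hC ρ hρ).2 (F n) (p n) (hp n) (hpF n)
    constructor
    · intro x hx
      exact le_of_tendsto_of_tendsto' (hgl x (hsub x hx)).norm hn fun n => (hb n).1 x hx
    · intro x hx y hy hxy
      exact le_of_tendsto_of_tendsto' ((hgl y (hsub y hy)).sub (hgl x (hsub x hx))).norm
        (hn.mul_const _) fun n => (hb n).2 x hx y hy hxy

theorem continuousOn_of_hasInteriorBound {β : ℝ} (hβ : 0 < β) {K : ℝ → ℝ} {g : ℝ → 𝕜}
    (h : ∀ ρ ∈ Set.Ioo (0 : ℝ) 1, HasInteriorBound β ρ (K ρ) g) :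
    ContinuousOn g (Set.Ico 0 1) := by
  intro x hx
  have hρ : (x + 1) / 2 ∈ Set.Ioo (0 : ℝ) 1 := ⟨by linarith [hx.1], by linarith [hx.2]⟩
  have hxρ : x ∈ Set.Icc (0 : ℝ) ((x + 1) / 2) := ⟨hx.1, by linarith [hx.2]⟩
  have hb := (h _ hρ).2
  set k := K ((x + 1) / 2) with hk
  have hlim : Filter.Tendsto (fun y : ℝ => k * |y ^ β - x ^ β|) (nhdsWithin x (Set.Ico 0 1))
      (nhds 0) := by
    have hc : Continuous fun y : ℝ => k * |y ^ β - x ^ β| :=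
      continuous_const.mul (((Real.continuous_rpow_const hβ.le).sub continuous_const).abs)
    have := (hc.tendsto x).mono_left (nhdsWithin_le_nhds (s := Set.Ico 0 1))
    simpa using this
  refine tendsto_iff_norm_sub_tendsto_zero.2
    (squeeze_zero' (Filter.Eventually.of_forall fun y => norm_nonneg _) ?_ hlim)
  have hlt : ∀ᶠ y in nhdsWithin x (Set.Ico 0 1), y < (x + 1) / 2 :=
    nhdsWithin_le_nhds (gt_mem_nhds (by linarith [hx.2]))
  filter_upwards [hlt, self_mem_nhdsWithin] with y hy hy'
  have hyρ : y ∈ Set.Icc (0 : ℝ) ((x + 1) / 2) := ⟨hy'.1, hy.le⟩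
  rcases le_total x y with hxy | hxy
  · rw [abs_of_nonneg (sub_nonneg.2 (Real.rpow_le_rpow hx.1 hxy hβ.le))]
    exact hb x hxρ y hyρ hxy
  · rw [abs_sub_comm, abs_of_nonneg (sub_nonneg.2 (Real.rpow_le_rpow hy'.1 hxy hβ.le)),
      norm_sub_rev]
    exact hb y hyρ x hxρ hxy

end

/-! ### The Cesàro operator -/

section
variable {𝕜 : Type*} [RCLike 𝕜]

/-- The integral over a short interval is close to the length times any value. -/
theorem norm_integral_sub_le {f : L1I 𝕜} {g : ℝ → 𝕜} {β ρ K : ℝ} (hβ : 0 < β) (hK : 0 ≤ K)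
    (hρ : ρ ≤ 1) (hfg : (f : ℝ → 𝕜) =ᵐ[volume.restrict (Set.Icc (0 : ℝ) 1)] g)
    (h : HasInteriorBound β ρ K g) {a b x : ℝ} (ha : 0 ≤ a) (hb : b ≤ ρ) (hx : x ∈ Set.Icc a b) :
    ‖(∫ t in a..b, (f : ℝ → 𝕜) t) - ((b - a : ℝ) : 𝕜) * g x‖ ≤
      K * (b ^ β - a ^ β) * (b - a) := by
  have hab : a ≤ b := hx.1.trans hx.2
  have hosc : ∀ t ∈ Set.Icc a b, ‖g t - g x‖ ≤ K * (b ^ β - a ^ β) := by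
    have key : ∀ s ∈ Set.Icc a b, ∀ t ∈ Set.Icc a b, s ≤ t →
        ‖g t - g s‖ ≤ K * (b ^ β - a ^ β) := by
      intro s hs t ht hst
      refine (h.2 s ⟨ha.trans hs.1, hs.2.trans hb⟩ t ⟨ha.trans ht.1, ht.2.trans hb⟩ hst).trans ?_
      refine mul_le_mul_of_nonneg_left ?_ hK
      have h1 := Real.rpow_le_rpow (ha.trans ht.1) ht.2 hβ.le
      have h2 := Real.rpow_le_rpow ha hs.1 hβ.le
      linarith
    intro t ht
    rcases le_total x t with hxt | hxt
    · exact key x hx t ht hxt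
    · rw [norm_sub_rev]
      exact key t ht x hx hxt
  have hint := L1I.intervalIntegrable_of_mem f (a := a) (b := b) ⟨ha, hab.trans (hb.trans hρ)⟩
    ⟨ha.trans hab, hb.trans hρ⟩
  have e : (∫ t in a..b, (f : ℝ → 𝕜) t) - ((b - a : ℝ) : 𝕜) * g x =
      ∫ t in a..b, ((f : ℝ → 𝕜) t - g x) := by
    rw [intervalIntegral.integral_sub hint intervalIntegrable_const,
      intervalIntegral.integral_const, RCLike.real_smul_eq_coe_mul]
  rw [e, ← abs_of_nonneg (sub_nonneg.2 hab)]
  refine intervalIntegral.norm_integral_le_of_norm_le_const_ae ?_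
  filter_upwards [(ae_restrict_iff' measurableSet_Icc).1 hfg] with t ht hmem
  rw [Set.uIoc_of_le hab] at hmem
  rw [ht ⟨ha.trans hmem.1.le, hmem.2.trans (hb.trans hρ)⟩]
  simpa only [abs_of_nonneg (sub_nonneg.2 hab)] using hosc t ⟨hmem.1.le, hmem.2⟩

/-- The Cesàro mean of `f`, extended by `g 0`, is continuous. -/
theorem exists_cesaroMean {f : L1I 𝕜} {g : ℝ → 𝕜} {β K : ℝ} (hβ : 0 < β) (hK : 0 ≤ K)
    (hfg : (f : ℝ → 𝕜) =ᵐ[volume.restrict (Set.Icc (0 : ℝ) 1)] g)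
    (h : HasInteriorBound β (1 / 2) K g) :
    ∃ F : C(unitInterval, 𝕜), F 0 = g 0 ∧ ∀ x : unitInterval, 0 < (x : ℝ) →
      F x = (((x : ℝ) : 𝕜))⁻¹ * ∫ t in (0 : ℝ)..x, (f : ℝ → 𝕜) t := by
  classical
  set F : unitInterval → 𝕜 := fun x => if x = 0 then g 0 else
    (((x : ℝ) : 𝕜))⁻¹ * volterra 𝕜 f x with hF
  have hF0 : F 0 = g 0 := if_pos rfl
  have hFx : ∀ x : unitInterval, x ≠ 0 → F x = (((x : ℝ) : 𝕜))⁻¹ * volterra 𝕜 f x :=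
    fun x hx => if_neg hx
  have hc : Continuous F := by
    refine continuous_iff_continuousAt.2 fun x => ?_
    by_cases hx : x = 0
    · subst hx
      have hlim : Filter.Tendsto (fun y : unitInterval => K * (y : ℝ) ^ β) (nhds 0) (nhds 0) := by
        have hc : Continuous fun y : unitInterval => K * (y : ℝ) ^ β :=
          continuous_const.mul ((Real.continuous_rpow_const hβ.le).comp continuous_subtype_val)
        have := hc.tendsto 0
        simpa [Real.zero_rpow hβ.ne'] using this
      refine tendsto_iff_norm_sub_tendsto_zero.2
        (squeeze_zero' (Filter.Eventually.of_forall fun y => norm_nonneg _) ?_ hlim)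
      have hlt : ∀ᶠ y : unitInterval in nhds 0, (y : ℝ) < 1 / 2 :=
        continuous_subtype_val.continuousAt.eventually (gt_mem_nhds (by simp))
      filter_upwards [hlt] with y hy
      by_cases hy0 : y = 0
      · rw [hy0, sub_self, norm_zero]
        exact mul_nonneg hK (Real.rpow_nonneg le_rfl _)
      have hypos : 0 < (y : ℝ) := unitInterval.pos_iff_ne_zero.2 hy0
      have hyne : ((y : ℝ) : 𝕜) ≠ 0 := RCLike.ofReal_ne_zero.2 hypos.ne'
      have key := norm_integral_sub_le hβ hK (by norm_num) hfg h le_rfl hy.le ⟨le_rfl, hypos.le⟩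
      rw [sub_zero, Real.zero_rpow hβ.ne', sub_zero, ← volterra_apply] at key
      have e : F y - F 0 = (((y : ℝ) : 𝕜))⁻¹ * (volterra 𝕜 f y - ((y : ℝ) : 𝕜) * g 0) := by
        rw [hF0, hFx y hy0, mul_sub, inv_mul_cancel_left₀ hyne]
      rw [e, norm_mul, norm_inv, RCLike.norm_ofReal, abs_of_pos hypos, inv_mul_le_iff₀ hypos]
      exact key.trans_eq (mul_comm _ _)
    · have hev : (fun y : unitInterval => (((y : ℝ) : 𝕜))⁻¹ * volterra 𝕜 f y) =ᶠ[nhds x] F := by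
        filter_upwards [isOpen_ne.mem_nhds hx] with y hy
        exact (hFx y hy).symm
      refine ContinuousAt.congr ?_ hev
      refine ContinuousAt.mul (ContinuousAt.inv₀ ?_ ?_) (map_continuous _).continuousAt
      · exact (RCLike.continuous_ofReal.comp continuous_subtype_val).continuousAt
      · have hpos : 0 < (x : ℝ) := unitInterval.pos_iff_ne_zero.2 hx
        exact RCLike.ofReal_ne_zero.2 hpos.ne'
  exact ⟨⟨F, hc⟩, hF0, fun x hx => hFx x (unitInterval.pos_iff_ne_zero.1 hx)⟩

/-- Up to `1/2` the Cesàro mean averages `g`; beyond `1/2` the factor `1 / x` is at most `2`. -/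
theorem norm_cesaroMean_le {f : L1I 𝕜} {g : ℝ → 𝕜} {F : C(unitInterval, 𝕜)} {B : ℝ}
    (hfg : (f : ℝ → 𝕜) =ᵐ[volume.restrict (Set.Icc (0 : ℝ) 1)] g) (hF0 : F 0 = g 0)
    (hF : ∀ x : unitInterval, 0 < (x : ℝ) →
      F x = (((x : ℝ) : 𝕜))⁻¹ * ∫ t in (0 : ℝ)..x, (f : ℝ → 𝕜) t)
    (hB : ∀ t ∈ Set.Icc (0 : ℝ) (1 / 2), ‖g t‖ ≤ B) : ‖F‖ ≤ max B (2 * ‖volterra 𝕜 f‖) := by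
  refine (ContinuousMap.norm_le _ (le_max_of_le_right (by positivity))).2 fun x => ?_
  rcases eq_or_lt_of_le x.2.1 with hx | hx
  · have : x = 0 := Subtype.ext hx.symm
    rw [this, hF0]
    exact le_max_of_le_left (hB 0 ⟨le_rfl, by norm_num⟩)
  rw [hF x hx, norm_mul, norm_inv, RCLike.norm_ofReal, abs_of_pos hx, inv_mul_le_iff₀ hx]
  rcases le_total (x : ℝ) (1 / 2) with hx2 | hx2
  · have h1 : ‖∫ t in (0 : ℝ)..x, (f : ℝ → 𝕜) t‖ ≤ B * |(x : ℝ) - 0| := by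
      refine intervalIntegral.norm_integral_le_of_norm_le_const_ae ?_
      filter_upwards [(ae_restrict_iff' measurableSet_Icc).1 hfg] with t ht hmem
      rw [Set.uIoc_of_le hx.le] at hmem
      rw [ht ⟨hmem.1.le, hmem.2.trans x.2.2⟩]
      exact hB t ⟨hmem.1.le, hmem.2.trans hx2⟩
    rw [sub_zero, abs_of_pos hx, mul_comm] at h1
    exact h1.trans (mul_le_mul_of_nonneg_left (le_max_left _ _) hx.le)
  · have h1 := (volterra 𝕜 f).norm_coe_le_norm x
    rw [volterra_apply] at h1
    have h2 := mul_le_mul_of_nonneg_left (le_max_right B (2 * ‖volterra 𝕜 f‖)) hx.le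
    nlinarith [norm_nonneg (volterra 𝕜 f)]

/-- The points of `[0, 1/2]` whose `β`-th powers are equally spaced. -/
noncomputable def powerNode (β : ℝ) (m j : ℕ) : unitInterval :=
  Set.projIcc 0 1 zero_le_one (1 / 2 * ((j : ℝ) / m) ^ β⁻¹)

theorem coe_powerNode {β : ℝ} (hβ : 0 < β) {m j : ℕ} (hm : 1 ≤ m) (hj : j ≤ m) :
    (powerNode β m j : ℝ) = 1 / 2 * ((j : ℝ) / m) ^ β⁻¹ := by
  have hm' : (0 : ℝ) < m := by exact_mod_cast hm
  have h1 : ((j : ℝ) / m) ^ β⁻¹ ≤ 1 :=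
    Real.rpow_le_one (by positivity) ((div_le_one hm').2 (by exact_mod_cast hj)) (by positivity)
  rw [powerNode, Set.projIcc_of_mem]
  exact ⟨by positivity, by linarith⟩

/-- If `∫ f` vanishes at the nodes, then `g` is small on `[0, 1/2]`. -/
theorem norm_le_of_volterra_eq_zero {f : L1I 𝕜} {g : ℝ → 𝕜} {β K : ℝ} (hβ : 0 < β) (hK : 0 ≤ K)
    (hfg : (f : ℝ → 𝕜) =ᵐ[volume.restrict (Set.Icc (0 : ℝ) 1)] g)
    (h : HasInteriorBound β (1 / 2) K g) {m : ℕ} (hm : 1 ≤ m)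
    (hz : ∀ j < m, volterra 𝕜 f (powerNode β m (j + 1)) = 0) {x : ℝ}
    (hx : x ∈ Set.Icc (0 : ℝ) (1 / 2)) : ‖g x‖ ≤ K / m := by
  have hm' : (0 : ℝ) < m := by exact_mod_cast hm
  have hβ' : 0 < β⁻¹ := inv_pos.2 hβ
  have hnode0 : (powerNode β m 0 : ℝ) = 0 := by
    rw [coe_powerNode hβ hm (Nat.zero_le _)]
    simp [Real.zero_rpow hβ'.ne']
  have hnodem : (powerNode β m m : ℝ) = 1 / 2 := by
    rw [coe_powerNode hβ hm le_rfl, div_self hm'.ne', Real.one_rpow, mul_one]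
  have hz' : ∀ j ≤ m, volterra 𝕜 f (powerNode β m j) = 0 := by
    intro j hj
    rcases j with _ | j
    · rw [volterra_apply, hnode0, intervalIntegral.integral_same]
    · exact hz j hj
  have hmono : ∀ j < m, (powerNode β m j : ℝ) < powerNode β m (j + 1) := by
    intro j hj
    rw [coe_powerNode hβ hm hj.le, coe_powerNode hβ hm hj]
    refine mul_lt_mul_of_pos_left (Real.rpow_lt_rpow (by positivity) ?_ hβ') (by norm_num)
    refine div_lt_div_of_pos_right ?_ hm'
    push_cast
    linarith
  have hpow : ∀ j ≤ m, (powerNode β m j : ℝ) ^ β = (1 / 2) ^ β * ((j : ℝ) / m) := by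
    intro j hj
    rw [coe_powerNode hβ hm hj, Real.mul_rpow (by norm_num) (by positivity),
      Real.rpow_inv_rpow (by positivity) hβ.ne']
  have hex : ∃ j, j < m ∧ x ∈ Set.Icc (powerNode β m j : ℝ) (powerNode β m (j + 1)) := by
    classical
    have hE : ∃ k, x ≤ powerNode β m k := ⟨m, by rw [hnodem]; exact hx.2⟩
    rcases hk : Nat.find hE with _ | k
    · have hs := Nat.find_spec hE
      rw [hk, hnode0] at hs
      refine ⟨0, hm, ?_, hs.trans (powerNode β m (0 + 1)).2.1⟩
      rw [hnode0]
      exact hx.1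
    · have hle : Nat.find hE ≤ m := Nat.find_min' hE (by rw [hnodem]; exact hx.2)
      refine ⟨k, by omega, ?_, hk ▸ Nat.find_spec hE⟩
      exact (not_le.1 (Nat.find_min hE (by omega : k < Nat.find hE))).le
  obtain ⟨j, hj, hxj⟩ := hex
  have hb : (powerNode β m (j + 1) : ℝ) ≤ 1 / 2 := by
    have h1 : ((((j + 1 : ℕ) : ℝ)) / m) ^ β⁻¹ ≤ 1 :=
      Real.rpow_le_one (by positivity) ((div_le_one hm').2 (by exact_mod_cast hj)) hβ'.le
    rw [coe_powerNode hβ hm hj]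
    linarith
  -- On the cell containing `x` the integral of `f` is zero, so the deviation estimate bounds `‖g
  -- x‖` itself, after division by the length, by `K` times the increment `(1 / 2) ^ β / m` of the
  -- `β`-th power.
  have key := norm_integral_sub_le hβ hK (by norm_num) hfg h (powerNode β m j).2.1 hb hxj
  have h0 : ∫ t in (powerNode β m j : ℝ)..powerNode β m (j + 1), (f : ℝ → 𝕜) t = 0 := by
    rw [← intervalIntegral.integral_interval_sub_left
      (L1I.intervalIntegrable f (powerNode β m (j + 1)))
      (L1I.intervalIntegrable f (powerNode β m j)), ← volterra_apply, ← volterra_apply,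
      hz' j hj.le, hz' (j + 1) hj, sub_zero]
  have hpos := sub_pos.2 (hmono j hj)
  rw [h0, zero_sub, norm_neg, norm_mul, RCLike.norm_ofReal, abs_of_pos hpos, mul_comm,
    mul_le_mul_iff_left₀ hpos, hpow j hj.le, hpow (j + 1) hj] at key
  refine key.trans ?_
  rw [div_eq_mul_one_div K]
  refine mul_le_mul_of_nonneg_left ?_ hK
  have e : (1 / 2 : ℝ) ^ β * (((j + 1 : ℕ) : ℝ) / m) - (1 / 2) ^ β * ((j : ℝ) / m) =
      (1 / 2) ^ β * (1 / m) := by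
    push_cast
    ring
  rw [e]
  exact mul_le_of_le_one_left (by positivity)
    (Real.rpow_le_one (by norm_num) (by norm_num) hβ.le)

/-- Reduces the linearity of `Γ` to that of `V`, without examining the values at `0`. -/
theorem continuousMap_ext_of_pos {F G : C(unitInterval, 𝕜)}
    (h : ∀ x : unitInterval, 0 < (x : ℝ) → F x = G x) : F = G := by
  have hd : Dense ({0}ᶜ : Set unitInterval) := dense_compl_singleton 0
  exact ContinuousMap.coe_injective
    (Continuous.ext_on hd F.continuous G.continuous fun x hx =>
      h x (unitInterval.pos_iff_ne_zero.2 hx))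

end

/-- The Cesàro operator on the Müntz space, with its estimate on functions whose primitive
vanishes at the nodes. -/
theorem exists_cesaroMuntz (𝕜 : Type*) [RCLike 𝕜] {Λ : ℕ → ℝ} (hmono : StrictMono Λ)
    (hnonneg : ∀ k, 0 ≤ Λ k) (hM : Summable fun k => 1 / Λ k) :
    ∃ Γ : muntzSpace 𝕜 Λ →L[𝕜] C(unitInterval, 𝕜), IsCesaroMuntz Γ ∧
      ∃ β C : ℝ, 0 < C ∧ ∀ m : ℕ, 1 ≤ m → ∀ f : muntzSpace 𝕜 Λ,
        (∀ j < m, volterraMuntz 𝕜 Λ f (powerNode β m (j + 1)) = 0) →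
        ‖Γ f‖ ≤ max (C * ‖f‖ / m) (2 * ‖volterraMuntz 𝕜 Λ f‖) := by
  obtain ⟨β, hβ, C, hC, hrep⟩ := exists_muntz_representative 𝕜 hmono hnonneg hM
  have hhalf : (1 / 2 : ℝ) ∈ Set.Ioo (0 : ℝ) 1 := by norm_num
  have hC0 := hC _ hhalf
  choose g hfg hg using fun f : muntzSpace 𝕜 Λ => hrep f f.2
  have hK : ∀ f : muntzSpace 𝕜 Λ, 0 ≤ C (1 / 2) * ‖(f : L1I 𝕜)‖ := fun f => by positivity
  choose F hF0 hF using fun f : muntzSpace 𝕜 Λ =>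
    exists_cesaroMean hβ (hK f) (hfg f) (hg f _ hhalf)
  have hV : ∀ (f : muntzSpace 𝕜 Λ) (x : unitInterval), 0 < (x : ℝ) →
      F f x = (((x : ℝ) : 𝕜))⁻¹ * volterraMuntz 𝕜 Λ f x := hF
  let Γ : muntzSpace 𝕜 Λ →L[𝕜] C(unitInterval, 𝕜) := LinearMap.mkContinuous
    { toFun := F
      map_add' := fun f f' => continuousMap_ext_of_pos fun x hx => by
        rw [ContinuousMap.add_apply, hV _ x hx, hV _ x hx, hV _ x hx, map_add,
          ContinuousMap.add_apply, mul_add]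
      map_smul' := fun c f => continuousMap_ext_of_pos fun x hx => by
        rw [RingHom.id_apply, ContinuousMap.smul_apply, hV _ x hx, hV _ x hx, map_smul,
          ContinuousMap.smul_apply, smul_eq_mul, smul_eq_mul, mul_left_comm] }
    (max (C (1 / 2)) (2 * ‖volterra 𝕜‖)) fun f => by
      refine (norm_cesaroMean_le (hfg f) (hF0 f) (hF f) (hg f _ hhalf).1).trans ?_
      rw [max_mul_of_nonneg _ _ (norm_nonneg f), mul_assoc]
      exact max_le_max le_rfl
        (mul_le_mul_of_nonneg_left ((volterra 𝕜).le_opNorm _) zero_le_two)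
  refine ⟨Γ, fun f => ⟨⟨g f, continuousOn_of_hasInteriorBound hβ (hg f), hfg f, (hF0 f).symm⟩,
    hF f⟩, β, C (1 / 2), hC0, fun m hm f hz => ?_⟩
  exact norm_cesaroMean_le (hfg f) (hF0 f) (hF f) fun t ht =>
    norm_le_of_volterra_eq_zero hβ (hK f) (hfg f) (hg f _ hhalf) hm hz ht

/-- Pointwise `V f (x) = x Γ f (x)` with `x ≤ 1`; the lower bounds for `V` therefore pass to `Γ`. -/
theorem norm_volterraMuntz_le_of_isCesaroMuntz {𝕜 : Type*} [RCLike 𝕜] {Λ : ℕ → ℝ}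
    {Γ : muntzSpace 𝕜 Λ →L[𝕜] C(unitInterval, 𝕜)} (hΓ : IsCesaroMuntz Γ) (f : muntzSpace 𝕜 Λ) :
    ‖volterraMuntz 𝕜 Λ f‖ ≤ ‖Γ f‖ := by
  refine (ContinuousMap.norm_le _ (norm_nonneg _)).2 fun x => ?_
  change ‖∫ t in (0 : ℝ)..x, ((f : L1I 𝕜) : ℝ → 𝕜) t‖ ≤ ‖Γ f‖
  rcases eq_or_lt_of_le x.2.1 with hx | hx
  · rw [← hx, intervalIntegral.integral_same, norm_zero]
    exact norm_nonneg _
  have h := (Γ f).norm_coe_le_norm x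
  rw [(hΓ f).2 x hx, norm_mul, norm_inv, RCLike.norm_ofReal, abs_of_pos hx,
    inv_mul_le_iff₀ hx] at h
  exact h.trans (mul_le_of_le_one_left (norm_nonneg _) x.2.2)

/-- Every `n`-dimensional subspace of the Müntz space contains a vector on which the Cesàro operator
is at most of order `1 / n`. -/
theorem exists_cesaroMuntz_le {𝕜 : Type*} [RCLike 𝕜] {Λ : ℕ → ℝ}
    {Γ : muntzSpace 𝕜 Λ →L[𝕜] C(unitInterval, 𝕜)} {β C : ℝ} (hC : 0 < C)
    (hΓ : ∀ m : ℕ, 1 ≤ m → ∀ f : muntzSpace 𝕜 Λ,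
      (∀ j < m, volterraMuntz 𝕜 Λ f (powerNode β m (j + 1)) = 0) →
      ‖Γ f‖ ≤ max (C * ‖f‖ / m) (2 * ‖volterraMuntz 𝕜 Λ f‖)) {n : ℕ} (hn : 1 ≤ n)
    {E : Submodule 𝕜 (muntzSpace 𝕜 Λ)} (hE : Module.finrank 𝕜 E = n) :
    ∃ v ∈ E, v ≠ 0 ∧ ‖Γ v‖ ≤ (3 * C + 6 + ‖Γ‖) / n * ‖v‖ := by
  have hn' : (1 : ℝ) ≤ n := by exact_mod_cast hn
  have hfin : FiniteDimensional 𝕜 E := Module.finite_of_finrank_pos (by omega)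
  rcases eq_or_lt_of_le hn with h1 | h2
  · have : Nontrivial E := Module.nontrivial_of_finrank_pos (R := 𝕜) (by omega)
    obtain ⟨v, hv⟩ := exists_ne (0 : E)
    refine ⟨v, v.2, fun h => hv (Subtype.ext h), (Γ.le_opNorm v).trans ?_⟩
    rw [← h1, Nat.cast_one, div_one]
    exact mul_le_mul_of_nonneg_right (by linarith) (norm_nonneg _)
  -- Half of the dimensions are spent on making the primitive vanish at `m` nodes. The kernel has
  -- dimension `d ≥ n / 2`, where the Volterra bound is still of order `1 / n`. The constant
  -- collects `3 C` from `n ≤ 3 m`, `6` from `2 (2 / n + 1 / n)`, and `‖Γ‖` for `n = 1`.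
  set m := n / 2 with hm
  have hm1 : 1 ≤ m := by omega
  have hm1' : (1 : ℝ) ≤ m := by exact_mod_cast hm1
  let Ψ : E →ₗ[𝕜] (Fin m → 𝕜) := LinearMap.pi fun j =>
    ((ContinuousMap.evalCLM 𝕜 (powerNode β m (j + 1))).comp (volterraMuntz 𝕜 Λ)).toLinearMap.comp
      E.subtype
  have hrk := Ψ.finrank_range_add_finrank_ker
  have hr : Module.finrank 𝕜 (LinearMap.range Ψ) ≤ m := by
    have := Submodule.finrank_le (LinearMap.range Ψ)
    rwa [Module.finrank_fin_fun] at this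
  set d := Module.finrank 𝕜 (LinearMap.ker Ψ) with hd
  have hd1 : 1 ≤ d := by omega
  have hd2 : n ≤ 2 * d := by omega
  have hn3 : n ≤ 3 * m := by omega
  have hd2' : (n : ℝ) ≤ 2 * d := by exact_mod_cast hd2
  have hn3' : (n : ℝ) ≤ 3 * m := by exact_mod_cast hn3
  have hd1' : (1 : ℝ) ≤ d := by exact_mod_cast hd1
  have hmap : Module.finrank 𝕜 ((LinearMap.ker Ψ).map E.subtype) = d :=
    (Submodule.equivMapOfInjective _ E.injective_subtype (LinearMap.ker Ψ)).finrank_eq.symm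
  have hnpos : (0 : ℝ) < n := by linarith
  obtain ⟨v, hv, h0, hle⟩ := exists_volterraMuntz_le hd1 hmap (one_div_pos.2 hnpos)
  obtain ⟨w, hw, rfl⟩ := hv
  have hz : ∀ j < m, volterraMuntz 𝕜 Λ (w : muntzSpace 𝕜 Λ) (powerNode β m (j + 1)) = 0 :=
    fun j hj => congrFun (LinearMap.mem_ker.1 hw) ⟨j, hj⟩
  refine ⟨w, w.2, h0, (hΓ m hm1 w hz).trans (max_le ?_ ?_)⟩
  · rw [div_mul_eq_mul_div, div_le_div_iff₀ (by linarith) hnpos]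
    have hw0 := norm_nonneg (w : muntzSpace 𝕜 Λ)
    calc C * ‖(w : muntzSpace 𝕜 Λ)‖ * n ≤ C * ‖(w : muntzSpace 𝕜 Λ)‖ * (3 * m) :=
          mul_le_mul_of_nonneg_left hn3' (by positivity)
      _ = (3 * C) * ‖(w : muntzSpace 𝕜 Λ)‖ * m := by ring
      _ ≤ (3 * C + 6 + ‖Γ‖) * ‖(w : muntzSpace 𝕜 Λ)‖ * m := by
          have := norm_nonneg Γ
          gcongr
          linarith
  · have hd3 : 1 / (2 * (d : ℝ) - 1) ≤ 2 / n := by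
      rw [div_le_div_iff₀ (by linarith) hnpos]
      linarith
    have h3 : 1 / (2 * (d : ℝ) - 1) + 1 / n ≤ 3 / n := by
      have : (3 : ℝ) / n = 2 / n + 1 / n := by ring
      linarith
    calc 2 * ‖volterraMuntz 𝕜 Λ (w : muntzSpace 𝕜 Λ)‖
        ≤ 2 * (3 / n * ‖(w : muntzSpace 𝕜 Λ)‖) :=
          mul_le_mul_of_nonneg_left
            (hle.trans (mul_le_mul_of_nonneg_right h3 (norm_nonneg _))) zero_le_two
      _ = 6 / n * ‖(w : muntzSpace 𝕜 Λ)‖ := by ring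
      _ ≤ _ := by
          have := norm_nonneg Γ
          gcongr
          linarith

/-- A zero exponent contributes `1 / 0 = 0` to `hMuntz`, so the sum runs over the nonzero exponents.
The continuous representative is part of `IsCesaroMuntz`. The bound `√2 / n` is deduced from the
stronger `hup`, which holds for real and complex scalars alike. -/
theorem theorem5p3 (Λ : ℕ → ℝ) (hmono : StrictMono Λ) (hnonneg : ∀ k, 0 ≤ Λ k)
    (hMuntz : Summable fun k => 1 / Λ k) :
    (∀ (𝕜 : Type) [RCLike 𝕜],
      (FinitelyStrictlySingular (volterraMuntz 𝕜 Λ) ∧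
        ∀ n : ℕ, 1 ≤ n →
          1 / (2 * (n : ℝ) - 1) ≤ bernsteinNumber (volterraMuntz 𝕜 Λ) n ∧
          bernsteinNumber (volterraMuntz 𝕜 Λ) n ≤ √2 / (n : ℝ)) ∧
      ∃ Γ : muntzSpace 𝕜 Λ →L[𝕜] C(unitInterval, 𝕜), IsCesaroMuntz Γ ∧
        FinitelyStrictlySingular Γ ∧
        ∃ C : ℝ, ∀ n : ℕ, 1 ≤ n →
          1 / (2 * (n : ℝ) - 1) ≤ bernsteinNumber Γ n ∧
          bernsteinNumber Γ n ≤ C / (n : ℝ)) ∧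
    ∀ n : ℕ, 1 ≤ n → bernsteinNumber (volterraMuntz ℝ Λ) n = 1 / (2 * (n : ℝ) - 1) := by
  have hlow : ∀ (𝕜 : Type) [RCLike 𝕜] (n : ℕ), 1 ≤ n →
      1 / (2 * (n : ℝ) - 1) ≤ bernsteinNumber (volterraMuntz 𝕜 Λ) n := fun 𝕜 _ n hn =>
    le_bernsteinNumber hn fun ε hε => exists_le_volterraMuntz 𝕜 hmono hnonneg hMuntz hn hε
  have hup : ∀ (𝕜 : Type) [RCLike 𝕜] (n : ℕ), 1 ≤ n →
      bernsteinNumber (volterraMuntz 𝕜 Λ) n ≤ 1 / (2 * (n : ℝ) - 1) := fun 𝕜 _ n hn => by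
    have hn' : (1 : ℝ) ≤ n := by exact_mod_cast hn
    exact bernsteinNumber_le (one_div_nonneg.2 (by linarith)) fun E hE ε hε =>
      exists_volterraMuntz_le hn hE hε
  refine ⟨fun 𝕜 _ => ⟨⟨?_, fun n hn => ⟨hlow 𝕜 n hn, ?_⟩⟩, ?_⟩, fun n hn =>
    le_antisymm (hup ℝ n hn) (hlow ℝ n hn)⟩
  · refine finitelyStrictlySingular_of_tendsto (c := fun n : ℕ => 2 / (n : ℝ))
      (tendsto_const_div_atTop_nhds_zero_nat 2) fun n hn E hE => ?_
    have hn' : (0 : ℝ) < n := by exact_mod_cast hn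
    obtain ⟨v, hv, h0, h⟩ := exists_volterraMuntz_le hn hE (one_div_pos.2 hn')
    refine ⟨v, hv, h0, h.trans (mul_le_mul_of_nonneg_right ?_ (norm_nonneg _))⟩
    have := one_div_two_mul_sub_one_le hn
    have e : (2 : ℝ) / n = 1 / n + 1 / n := by ring
    linarith
  · refine (hup 𝕜 n hn).trans ((one_div_two_mul_sub_one_le hn).trans ?_)
    gcongr
    exact Real.one_le_sqrt.2 one_le_two
  · obtain ⟨Γ, hΓ, β, C, hC, hb⟩ := exists_cesaroMuntz 𝕜 hmono hnonneg hMuntz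
    refine ⟨Γ, hΓ, finitelyStrictlySingular_of_tendsto
      (tendsto_const_div_atTop_nhds_zero_nat _) fun n hn E hE => exists_cesaroMuntz_le hC hb hn hE,
      3 * C + 6 + ‖Γ‖, fun n hn => ⟨?_, ?_⟩⟩
    · refine le_bernsteinNumber hn fun ε hε => ?_
      obtain ⟨E, hE, h⟩ := exists_le_volterraMuntz 𝕜 hmono hnonneg hMuntz hn hε
      exact ⟨E, hE, fun v hv => (h v hv).trans (norm_volterraMuntz_le_of_isCesaroMuntz hΓ v)⟩
    · refine bernsteinNumber_le (by positivity) fun E hE ε hε => ?_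
      obtain ⟨v, hv, h0, h⟩ := exists_cesaroMuntz_le hC hb hn hE
      exact ⟨v, hv, h0, h.trans (mul_le_mul_of_nonneg_right (by linarith) (norm_nonneg _))⟩
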